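/- **Theorem.** Let $N\ge 0$ be an integer, $\boldsymbol z=(z_1,\dots,z_N)$, $\boldsymbol\lambda=(\lambda_1,\dots,\lambda_N)$ commuting variables. *Bethe side.* Let $e_{ij}$ be the matrix units of $\mathfrak{gl}_N$, $e_{ij}(u)=\sum_{s\ge0}(e_{ij}\otimes t^s)u^{-s-1}$ with $e_{ij}\otimes t^s\in\mathfrak{gl}_N[t]=\mathfrak{gl}_N\otimes\mathbb C[t]$, and $\partial=d/du$. Define $B_{ij}\in U(\mathfrak{gl}_N[t])[\boldsymbol\lambda]$ ($1\le i\le N$, $j\ge 0$) by $$\operatorname{rdet}\bigl(\delta_{ij}(\partial-\lambda_i)-e_{ji}(u)\bigr)_{i,j=1}^N=\partial^N+\sum_{i=1}^N\sum_{j\ge0}B_{ij}u^{-j}\partial^{N-i},\qquad \operatorname{rdet}A=\sum_{\sigma\in S_N}(-1)^\sigma a_{1\sigma(1)}\cdots a_{N\sigma(N)}.$$ The Bethe algebra $\mathcal B_N$ is the unital subalgebra generated by all $B_{ij}$. Let $V=\mathbb C^N$ with standard basis $\epsilon_1,\dots,\epsilon_N$. The algebra $U(\mathfrak{gl}_N[t])[\boldsymbol\lambda]$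 acts on $\mathcal V=V^{\otimes N}\otimes\mathbb C[\boldsymbol z,\boldsymbol\lambda]$: $g\otimes t^s$ acts by $\sum_k z_k^s g^{(k)}$, where $g^{(k)}$ is $g$ acting on the $k$-th tensor factor, and $\lambda_i$ acts by multiplication. Let $\mathcal V_{\boldsymbol 1}=(V^{\otimes N})_{\boldsymbol 1}\otimes\mathbb C[\boldsymbol z,\boldsymbol\lambda]$, where $(V^{\otimes N})_{\boldsymbol 1}=\{v: e_{ii}v=v \text{ for all } i\}$; it contains $\epsilon_\tau=\epsilon_{\tau(1)}\otimes\dots\otimes\epsilon_{\tau(N)}$, $\tau\in S_N$. *Cherednik side.* Let $H_N$ be the unital complex algebra with generators $x_i,y_i,s_{jk}$ ($1\le i,j,k\le N$, $j\neq k$) and relations, in each of which distinct letters denote distinct indices, $$s_{ij}=s_{ji},\quad s_{ij}^2=1,\quad s_{ij}s_{jk}=s_{ik}s_{ij},\quad s_{ij}s_{kl}=s_{kl}s_{ij},\quad [x_i,x_j]=[y_i,y_j]=0,$$ $$s_{ij}x_i=x_js_{ij},\quad s_{ij}y_i=y_js_{ij},\quad [s_{ij},x_k]=[s_{ij},y_k]=0,\quad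 [x_i,y_j]=s_{ij},\quad [x_i,y_i]=-\sum_{a\ne i}s_{ia}.$$ Permutations are regarded as elements of $H_N$ through the homomorphism $S_N\to H_N^\times$, $(j\,k)\mapsto s_{jk}$. Put $$\mathcal P^{\mathcal Z}=(-1)^N\sum_{\sigma\in S_N}:\!\prod_{i:\,\sigma(i)=i}\bigl(1-(v-x_i)(u-y_i)\bigr)\!:\,(-1)^\sigma\sigma\ \in H_N[u,v],$$ where the normal ordering $:\ :$ places all $x$'s to the left of all $y$'s. Let $\mathcal Z_N$ be the center of $H_N$. *Claim.* The Bethe algebra preserves $\mathcal V_{\boldsymbol 1}$. Let $\bar B_{ij}\in\operatorname{End}(\mathcal V_{\boldsymbol 1})$ be the images of $B_{ij}$, let $\bar{\mathcal B}_N\subset\operatorname{End}(\mathcal V_{\boldsymbol 1})$ be the image of $\mathcal B_N$, and let $$\mathcal P^{\bar{\mathcal B}}=\prod_{i=1}^N(u-z_i)\Bigl(v^N+\sum_{i=1}^N\sum_{j\ge0}\bar B_{ij}u^{-j}v^{N-i}\Bigr)$$ be the universal Bethe polynomial. There is a linear isomorphism $\iota:\mathcal V_{\boldsymbol 1}\to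 H_N$ with $$\iota\bigl(p(\boldsymbol z)q(\boldsymbol\lambda)\epsilon_\tau\bigr)=q(\boldsymbol x)\,\tau\,p(\boldsymbol y)\qquad\text{for all polynomials } p,q \text{ and all } \tau\in S_N.$$ The series $\mathcal P^{\bar{\mathcal B}}$ is a polynomial in $u$ and $v$ with coefficients in $\operatorname{End}(\mathcal V_{\boldsymbol 1})$, and $$\iota\,\mathcal P^{\bar{\mathcal B}}=\mathcal P^{\mathcal Z}\,\iota ,$$ that is, for all $m,n\ge 0$, $\iota$ intertwines the coefficient of $u^mv^n$ in $\mathcal P^{\bar{\mathcal B}}$ with left multiplication by the coefficient of $u^mv^n$ in $\mathcal P^{\mathcal Z}$. Moreover $\iota$ identifies the action of the Bethe algebra with that of the center: $$\iota\,\bar{\mathcal B}_N\,\iota^{-1}=\{\text{left multiplications by } c : c\in\mathcal Z_N\}\subset\operatorname{End}(H_N).$$ -/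

import Mathlib

open scoped TensorProduct

-- associative rings are Lie rings with the commutator bracket
attribute [local instance] LieRing.ofAssociativeRing

noncomputable section

namespace BetheCherednik

/-! ## The row determinant -/

/-- The row determinant `∑_σ (-1)^σ a_{1σ(1)} a_{2σ(2)} ⋯ a_{nσ(n)}` of a square matrix with
entries in a possibly noncommutative ring (factors in the order of the rows). -/
def rdet {E : Type*} [Ring E] {n : ℕ} (a : Matrix (Fin n) (Fin n) E) : E :=
  ∑ σ : Equiv.Perm (Fin n),
    ((Equiv.Perm.sign σ : ℤˣ) : ℤ) • (List.ofFn fun i => a i (σ i)).prod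

/-! ## Formal differential operators in `u`

The coefficients are power series in `u⁻¹` over a possibly noncommutative algebra `A`.
`PowerSeries A` stands for `A⟦u⁻¹⟧`: its `j`-th coefficient is the coefficient of `u^{-j}`. -/

section DiffOp

variable {A : Type*} [Ring A] [Algebra ℂ A]

/-- The derivative `d/du` on `A⟦u⁻¹⟧`, so `u^{-j} ↦ -j u^{-j-1}`. -/
def uDeriv (f : PowerSeries A) : PowerSeries A :=
  PowerSeries.mk fun n => match n with
    | 0 => 0
    | j + 1 => -((j : ℂ) • PowerSeries.coeff j f)

/-- A differential operator `∑ fₖ ∂ᵏ`, written with its coefficients on the left, is recorded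
by the finite sequence of its coefficients `fₖ ∈ A⟦u⁻¹⟧`. Products of such operators are computed
in the left regular representation, i.e. through `mulFun` and `mulDel` below. -/
abbrev DiffOp (A : Type*) [Ring A] := Polynomial (PowerSeries A)

/-- Left multiplication of differential operators by a function `f ∈ A⟦u⁻¹⟧`:
`∑ fₖ ∂ᵏ ↦ ∑ (f fₖ) ∂ᵏ`. -/
def mulFun (f : PowerSeries A) : Module.End ℂ (DiffOp A) :=
  LinearMap.mulLeft ℂ (Polynomial.C f)

/-- Left multiplication of differential operators by `∂`:
`∑ fₖ ∂ᵏ ↦ ∑ (fₖ ∂ᵏ⁺¹ + fₖ' ∂ᵏ)`. -/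
def mulDel : Module.End ℂ (DiffOp A) where
  toFun P := P * Polynomial.X + P.sum fun k f => Polynomial.monomial k (uDeriv f)
  map_add' P Q := by
    rw [Polynomial.sum_add_index]
    · rw [add_mul]; abel
    · intro i
      have : uDeriv (0 : PowerSeries A) = 0 := by
        ext n; cases n <;> simp [uDeriv]
      simp [this]
    · intro i f g
      rw [← map_add]
      congr 1
      ext n; cases n <;> simp [uDeriv]; abel
  map_smul' c P := by
    have h0 : uDeriv (0 : PowerSeries A) = 0 := by
      ext n; cases n <;> simp [uDeriv]
    have hs : ∀ f : PowerSeries A, uDeriv (c • f) = c • uDeriv f := by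
      intro f
      ext n; cases n <;> simp [uDeriv, smul_comm c]
    rw [Polynomial.sum_smul_index' P c _ (by intro i; simp [h0])]
    simp only [hs, RingHom.id_apply, smul_add, smul_mul_assoc, Polynomial.sum, Finset.smul_sum,
      Polynomial.smul_monomial]

theorem uDeriv_mul (f g : PowerSeries A) : uDeriv (f * g) = uDeriv f * g + f * uDeriv g := by
  ext n
  cases n with
  | zero => simp [uDeriv, PowerSeries.coeff_mul]
  | succ n =>
    rw [map_add, PowerSeries.coeff_mul, PowerSeries.coeff_mul,
      Finset.Nat.sum_antidiagonal_succ, Finset.Nat.sum_antidiagonal_succ']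
    simp only [uDeriv, PowerSeries.coeff_mk, zero_mul, mul_zero, zero_add,
      PowerSeries.coeff_mul, Finset.smul_sum, ← Finset.sum_neg_distrib, ← Finset.sum_add_distrib]
    refine Finset.sum_congr rfl fun p hp => ?_
    have h : (n : ℂ) = p.1 + p.2 := by
      rw [← Finset.HasAntidiagonal.mem_antidiagonal.1 hp]; push_cast; rfl
    rw [h, add_smul, neg_mul, mul_neg, smul_mul_assoc, mul_smul_comm]
    abel

theorem mulDel_monomial (k : ℕ) (f : PowerSeries A) :
    mulDel (Polynomial.monomial k f) =
      Polynomial.monomial (k + 1) f + Polynomial.monomial k (uDeriv f) := by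
  have h0 : uDeriv (0 : PowerSeries A) = 0 := by
    ext n; cases n <;> simp [uDeriv]
  change Polynomial.monomial k f * Polynomial.X + Polynomial.sum _ _ = _
  rw [Polynomial.sum_monomial_index _ _ (by simp [h0]), Polynomial.monomial_mul_X]

/-- The relation `∂ f = f ∂ + f'`. -/
theorem mulDel_mulFun (f : PowerSeries A) :
    mulDel * mulFun f = mulFun f * mulDel + mulFun (uDeriv f) := by
  refine LinearMap.ext fun P => ?_
  induction P using Polynomial.induction_on' with
  | add p q hp hq => rw [map_add, map_add, hp, hq]
  | monomial k g =>
    simp only [Module.End.mul_apply, LinearMap.add_apply, mulFun, LinearMap.mulLeft_apply,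
      Polynomial.C_mul_monomial, mulDel_monomial, uDeriv_mul, map_add]
    abel

/-- The coefficients `fₖ` of the operator `∑ fₖ ∂ᵏ` obtained from a product (or sum of products)
of operators in the left regular representation. -/
def symbol (D : Module.End ℂ (DiffOp A)) : DiffOp A := D 1

/-- The operator `f ∂ᵏ` has the single coefficient `f` at `∂ᵏ`. -/
theorem symbol_mulFun_mulDel_pow (f : PowerSeries A) (k : ℕ) :
    symbol (mulFun f * mulDel ^ k) = Polynomial.monomial k f := by
  have h1 : uDeriv (1 : PowerSeries A) = 0 := by
    ext n; cases n <;> simp +contextual [uDeriv, PowerSeries.coeff_one]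
  have h : ∀ k : ℕ, (mulDel ^ k) (1 : DiffOp A) = Polynomial.monomial k 1 := by
    intro k
    induction k with
    | zero => simp
    | succ k ih => rw [pow_succ', Module.End.mul_apply, ih, mulDel_monomial, h1]; simp
  simp only [symbol, Module.End.mul_apply, h, mulFun, LinearMap.mulLeft_apply,
    Polynomial.C_mul_monomial, mul_one]

end DiffOp

/-! ## The current algebra and the Bethe algebra -/

/-- The current Lie algebra `𝔤𝔩_N[t] = 𝔤𝔩_N ⊗ ℂ[t]`: matrices over `ℂ[t]` with the commutator
as bracket, regarded as a complex Lie algebra. -/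
abbrev Current (N : ℕ) := Matrix (Fin N) (Fin N) (Polynomial ℂ)

/-- The element `e_{ij} ⊗ t^r` of `𝔤𝔩_N[t]`. -/
def eCur (N : ℕ) (i j : Fin N) (r : ℕ) : Current N := Matrix.single i j (Polynomial.X ^ r)

/-- The algebra `U(𝔤𝔩_N[t])[λ₁, …, λ_N] = U(𝔤𝔩_N[t]) ⊗ ℂ[λ₁, …, λ_N]`. -/
def UL (N : ℕ) : Type :=
  UniversalEnvelopingAlgebra ℂ (Current N) ⊗[ℂ] MvPolynomial (Fin N) ℂ

instance (N : ℕ) : Ring (UL N) := inferInstanceAs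
  (Ring (UniversalEnvelopingAlgebra ℂ (Current N) ⊗[ℂ] MvPolynomial (Fin N) ℂ))

instance (N : ℕ) : Algebra ℂ (UL N) := inferInstanceAs
  (Algebra ℂ (UniversalEnvelopingAlgebra ℂ (Current N) ⊗[ℂ] MvPolynomial (Fin N) ℂ))

/-- `e_{ij} ⊗ t^r` as an element of `U(𝔤𝔩_N[t])[λ]`. -/
def eUL (N : ℕ) (i j : Fin N) (r : ℕ) : UL N :=
  (UniversalEnvelopingAlgebra.ι ℂ (eCur N i j r) ⊗ₜ[ℂ] 1 :
    UniversalEnvelopingAlgebra ℂ (Current N) ⊗[ℂ] MvPolynomial (Fin N) ℂ)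

/-- The variable `λ_i` as an element of `U(𝔤𝔩_N[t])[λ]`. -/
def lamUL (N : ℕ) (i : Fin N) : UL N :=
  (1 ⊗ₜ[ℂ] MvPolynomial.X i :
    UniversalEnvelopingAlgebra ℂ (Current N) ⊗[ℂ] MvPolynomial (Fin N) ℂ)

/-- The series `e_{ij}(u) = ∑_{s ≥ 0} (e_{ij} ⊗ t^s) u^{-s-1}`. -/
def eSeries (N : ℕ) (i j : Fin N) : PowerSeries (UL N) :=
  PowerSeries.mk fun n => match n with
    | 0 => 0
    | s + 1 => eUL N i j s

/-- The universal operator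
`𝒟 = rdet (δ_{ij} (∂ - λ_i) - e_{ji}(u))_{i,j}`, in the left regular representation. -/
def universalOperator (N : ℕ) : Module.End ℂ (DiffOp (UL N)) :=
  rdet (Matrix.of fun i j : Fin N =>
    (if i = j then mulDel - mulFun (PowerSeries.C (lamUL N i)) else 0) - mulFun (eSeries N j i))

/-- The elements `B_{ij} ∈ U(𝔤𝔩_N[t])[λ]` given by
`𝒟 = ∂^N + ∑_{i=1}^N ∑_{j ≥ 0} B_{ij} u^{-j} ∂^{N-i}`.
The index `i : Fin N` runs from `0`, so that `betheB N i j` is `B_{i+1,j}`. -/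
def betheB (N : ℕ) (i : Fin N) (j : ℕ) : UL N :=
  PowerSeries.coeff j ((symbol (universalOperator N)).coeff (N - ((i : ℕ) + 1)))

/-- The Bethe algebra: the unital subalgebra of `U(𝔤𝔩_N[t])[λ]` generated by the `B_{ij}`. -/
def betheAlgebra (N : ℕ) : Subalgebra ℂ (UL N) :=
  Algebra.adjoin ℂ {b | ∃ i j, b = betheB N i j}

/-! ## The module `V^{⊗N} ⊗ ℂ[z, λ]` -/

/-- The `N`-th tensor power of the vector representation `V = ℂ^N`. -/
abbrev TensorPower (N : ℕ) := ⨂[ℂ] _ : Fin N, (Fin N → ℂ)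

/-- The polynomial algebra `ℂ[z₁, …, z_N, λ₁, …, λ_N]`; `Sum.inl i` labels `z_i` and
`Sum.inr i` labels `λ_i`. -/
abbrev ZL (N : ℕ) := MvPolynomial (Fin N ⊕ Fin N) ℂ

/-- `p(z)` for a polynomial `p` in `N` variables. -/
def polyZ (N : ℕ) : MvPolynomial (Fin N) ℂ →ₐ[ℂ] ZL N := MvPolynomial.rename Sum.inl

/-- `q(λ)` for a polynomial `q` in `N` variables. -/
def polyLam (N : ℕ) : MvPolynomial (Fin N) ℂ →ₐ[ℂ] ZL N := MvPolynomial.rename Sum.inr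

/-- The space `𝒱` of polynomials in `z, λ` with coefficients in `V^{⊗N}`. -/
def VSpace (N : ℕ) : Type := ZL N ⊗[ℂ] TensorPower N

instance (N : ℕ) : AddCommGroup (VSpace N) :=
  inferInstanceAs (AddCommGroup (ZL N ⊗[ℂ] TensorPower N))

instance (N : ℕ) : Module (ZL N) (VSpace N) :=
  inferInstanceAs (Module (ZL N) (ZL N ⊗[ℂ] TensorPower N))

instance (N : ℕ) : Module ℂ (VSpace N) :=
  inferInstanceAs (Module ℂ (ZL N ⊗[ℂ] TensorPower N))

instance (N : ℕ) : IsScalarTower ℂ (ZL N) (VSpace N) :=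
  inferInstanceAs (IsScalarTower ℂ (ZL N) (ZL N ⊗[ℂ] TensorPower N))

/-- The operator `1 ⊗ ⋯ ⊗ g ⊗ ⋯ ⊗ 1` on `V^{⊗N}`, with `g` acting on the `k`-th factor. -/
def onFactor (N : ℕ) (k : Fin N) (g : Module.End ℂ (Fin N → ℂ)) :
    Module.End ℂ (TensorPower N) :=
  PiTensorProduct.map (Function.update (fun _ => LinearMap.id) k g)

/-- The matrix unit `e_{ij}` as an operator on `V`, `e_{ij} ε_k = δ_{jk} ε_i`. -/
def eVec (N : ℕ) (i j : Fin N) : Module.End ℂ (Fin N → ℂ) :=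
  Matrix.toLin' (Matrix.single i j 1)

/-- `e_{ij}` acting on the `k`-th tensor factor of `𝒱`. -/
def eFactor (N : ℕ) (k i j : Fin N) : Module.End (ZL N) (VSpace N) :=
  (onFactor N k (eVec N i j)).baseChange (ZL N)

/-- The matrix `M ∈ 𝔤𝔩_N[t]`, evaluated at `t = z_k`, acting on the `k`-th factor of `𝒱`. -/
def evalFactor (N : ℕ) (k : Fin N) (M : Current N) : Module.End (ZL N) (VSpace N) :=
  ∑ i, ∑ j, (Polynomial.aeval (MvPolynomial.X (Sum.inl k) : ZL N) (M i j)) • eFactor N k i j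

theorem eVec_single (N : ℕ) (i j k : Fin N) :
    eVec N i j (Pi.single k 1) = if j = k then Pi.single i 1 else 0 := by
  unfold eVec
  ext l
  rw [Matrix.toLin'_apply, Matrix.mulVec_single_one]
  by_cases h : j = k
  · subst h
    by_cases hl : l = i
    · subst hl; simp
    · simp [hl, Ne.symm hl]
  · simp [h]

theorem eVec_mul (N : ℕ) (i j l m : Fin N) :
    eVec N i j * eVec N l m = if j = l then eVec N i m else 0 := by
  unfold eVec
  rw [Module.End.mul_eq_comp, ← Matrix.toLin'_mul]
  split_ifs with h
  · subst h; simp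
  · rw [Matrix.single_mul_single_of_ne _ _ _ _ h]; simp

theorem onFactor_mul (N : ℕ) (k : Fin N) (g h : Module.End ℂ (Fin N → ℂ)) :
    onFactor N k g * onFactor N k h = onFactor N k (g * h) := by
  unfold onFactor
  rw [← PiTensorProduct.map_mul]
  congr 1
  funext i
  by_cases hi : i = k
  · subst hi; simp
  · simp [Function.update_of_ne hi]; rfl

theorem onFactor_comm (N : ℕ) {k l : Fin N} (hkl : k ≠ l) (g h : Module.End ℂ (Fin N → ℂ)) :
    onFactor N k g * onFactor N l h = onFactor N l h * onFactor N k g := by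
  unfold onFactor
  rw [← PiTensorProduct.map_mul, ← PiTensorProduct.map_mul]
  congr 1
  funext i
  by_cases hi : i = k
  · subst hi; simp [Function.update_of_ne hkl]; rfl
  · by_cases hl : i = l
    · subst hl; simp [Function.update_of_ne hi]; rfl
    · simp [Function.update_of_ne hi, Function.update_of_ne hl]

theorem onFactor_zero (N : ℕ) (k : Fin N) : onFactor N k 0 = 0 :=
  (PiTensorProduct.mapMultilinear ℂ (fun _ : Fin N => Fin N → ℂ)
    (fun _ : Fin N => Fin N → ℂ)).map_update_zero (fun _ => LinearMap.id) k

theorem baseChange_onFactor_mul (N : ℕ) (f g : Module.End ℂ (TensorPower N)) :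
    ((f * g).baseChange (ZL N) : Module.End (ZL N) (VSpace N)) =
      (f.baseChange (ZL N) : Module.End (ZL N) (VSpace N)) *
        (g.baseChange (ZL N) : Module.End (ZL N) (VSpace N)) :=
  LinearMap.baseChange_comp (A := ZL N) g f

theorem eFactor_mul (N : ℕ) (k i j l m : Fin N) :
    eFactor N k i j * eFactor N k l m = if j = l then eFactor N k i m else 0 := by
  refine (baseChange_onFactor_mul N _ _).symm.trans ?_
  rw [onFactor_mul, eVec_mul]
  split_ifs with h
  · rfl
  · rw [onFactor_zero]; exact LinearMap.baseChange_zero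

theorem eFactor_comm (N : ℕ) {k k' : Fin N} (h : k ≠ k') (i j l m : Fin N) :
    eFactor N k i j * eFactor N k' l m = eFactor N k' l m * eFactor N k i j := by
  refine (baseChange_onFactor_mul N _ _).symm.trans ?_
  rw [onFactor_comm N h]
  exact baseChange_onFactor_mul N _ _

theorem evalFactor_mul (N : ℕ) (k : Fin N) (M M' : Current N) :
    evalFactor N k (M * M') = evalFactor N k M * evalFactor N k M' := by
  unfold evalFactor
  simp only [Finset.sum_mul, Finset.mul_sum, smul_mul_smul_comm, eFactor_mul, Matrix.mul_apply,
    map_sum, map_mul, Finset.sum_smul, smul_ite, smul_zero]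
  rw [Finset.sum_comm' (s := Finset.univ) (t := fun _ => Finset.univ) (t' := Finset.univ)
    (s' := fun _ => Finset.univ) (by simp)]
  simp only [Finset.sum_ite_eq', Finset.mem_univ, if_true]
  have key : ∀ F : Fin N → Fin N → Fin N → Module.End (ZL N) (VSpace N),
      (∑ y, ∑ x, ∑ i, F x y i) = ∑ i, ∑ y, ∑ x, F x y i := fun F => by
    rw [Finset.sum_comm' (s := Finset.univ) (t := fun _ => Finset.univ) (t' := Finset.univ)
      (s' := fun _ => Finset.univ) (by simp)]
    rw [Finset.sum_congr rfl fun x _ => Finset.sum_comm]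
    rw [Finset.sum_comm]
    exact Finset.sum_congr rfl fun i _ => Finset.sum_comm
  exact key _

theorem evalFactor_comm (N : ℕ) {k k' : Fin N} (h : k ≠ k') (M M' : Current N) :
    evalFactor N k M * evalFactor N k' M' = evalFactor N k' M' * evalFactor N k M := by
  refine Commute.eq ?_
  unfold evalFactor
  refine Commute.sum_left _ _ _ fun i _ => Commute.sum_left _ _ _ fun j _ =>
    Commute.sum_right _ _ _ fun l _ => Commute.sum_right _ _ _ fun m _ => ?_
  exact ((show Commute _ _ from eFactor_comm N h i j l m).smul_left _).smul_right _

/-- The action of `𝔤𝔩_N[t]` on `𝒱`: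
`g ⊗ t^s` sends `p(z,λ) v₁ ⊗ ⋯ ⊗ v_N` to `∑_k z_k^s p(z,λ) v₁ ⊗ ⋯ ⊗ g v_k ⊗ ⋯ ⊗ v_N`; equivalently
`g(u)` acts by `∑_k (u - z_k)⁻¹ g^{(k)}`, expanded in powers of `u⁻¹`. -/
def currentRep (N : ℕ) : Current N →ₗ⁅ℂ⁆ Module.End (ZL N) (VSpace N) where
  toFun M := ∑ k, evalFactor N k M
  map_add' M M' := by
    simp [evalFactor, add_smul, Finset.sum_add_distrib]
  map_smul' c M := by
    simp [evalFactor, Finset.smul_sum, smul_assoc]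
  map_lie' := by
    intro M M'
    have hsub : ∀ k, evalFactor N k ⁅M, M'⁆ =
        evalFactor N k M * evalFactor N k M' - evalFactor N k M' * evalFactor N k M := by
      intro k
      rw [← evalFactor_mul, ← evalFactor_mul, Ring.lie_def]
      simp [evalFactor, sub_smul, Finset.sum_sub_distrib]
    change ∑ k, evalFactor N k ⁅M, M'⁆ = ⁅∑ k, evalFactor N k M, ∑ k, evalFactor N k M'⁆
    simp only [hsub]
    rw [Ring.lie_def, Finset.sum_mul_sum, Finset.sum_mul_sum, Finset.sum_comm (s := Finset.univ)
      (f := fun k k' => evalFactor N k M' * evalFactor N k' M), ← Finset.sum_sub_distrib]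
    refine Finset.sum_congr rfl fun k _ => ?_
    rw [← Finset.sum_sub_distrib, Finset.sum_eq_single k]
    · intro k' _ hk
      rw [evalFactor_comm N hk.symm, sub_self]
    · simp

/-- The action of `U(𝔤𝔩_N[t])[λ]` on `𝒱`; `λ_i` acts by multiplication by `λ_i`. -/
def ulAction (N : ℕ) : UL N →ₐ[ℂ] Module.End (ZL N) (VSpace N) :=
  Algebra.TensorProduct.lift
    (UniversalEnvelopingAlgebra.lift ℂ (currentRep N))
    (((Algebra.ofId (ZL N) (Module.End (ZL N) (VSpace N))).restrictScalars ℂ).comp (polyLam N))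
    (fun a q => Algebra.commute_algebraMap_right (polyLam N q)
      (UniversalEnvelopingAlgebra.lift ℂ (currentRep N) a))

/-- The diagonal action of `e_{ij} ∈ 𝔤𝔩_N` on `V^{⊗N}`. -/
def glTensor (N : ℕ) (i j : Fin N) : Module.End ℂ (TensorPower N) :=
  ∑ k, onFactor N k (eVec N i j)

/-- The subspace of `V^{⊗N}` of weight `(1, …, 1)`: `e_{ii} v = v` for all `i`. -/
def weightOne (N : ℕ) : Submodule ℂ (TensorPower N) where
  carrier := {v | ∀ i, glTensor N i i v = v}
  add_mem' hv hw i := by rw [map_add, hv i, hw i]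
  zero_mem' i := map_zero _
  smul_mem' c v hv i := by rw [map_smul, hv i]

/-- The space `𝒱₁ = (V^{⊗N})_{(1,…,1)} ⊗ ℂ[z, λ]`, as a subspace of `𝒱`. -/
def V1 (N : ℕ) : Submodule (ZL N) (VSpace N) := (weightOne N).baseChange (ZL N)

/-- The vector `ε_τ = ε_{τ(1)} ⊗ ⋯ ⊗ ε_{τ(N)}`. -/
def eps (N : ℕ) (τ : Equiv.Perm (Fin N)) : TensorPower N :=
  PiTensorProduct.tprod ℂ fun k => Pi.single (τ k) 1

theorem eps_mem (N : ℕ) (τ : Equiv.Perm (Fin N)) : eps N τ ∈ weightOne N := by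
  intro i
  have h : ∀ k, onFactor N k (eVec N i i) (eps N τ) = if τ k = i then eps N τ else 0 := by
    intro k
    unfold onFactor eps
    rw [PiTensorProduct.map_tprod]
    split_ifs with hk
    · congr 1
      funext l
      by_cases hl : l = k
      · subst hl; simp [eVec_single, hk]
      · simp [Function.update_of_ne hl]
    · refine MultilinearMap.map_coord_zero _ k ?_
      simp [eVec_single, Ne.symm hk]
  simp only [glTensor, LinearMap.sum_apply, h]
  rw [Finset.sum_eq_single (τ.symm i)]
  · simp
  · intro k _ hk
    rw [if_neg]
    rintro rfl
    simp at hk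
  · simp

/-- The vector `ε_τ` as an element of `𝒱₁`. -/
def epsV1 (N : ℕ) (τ : Equiv.Perm (Fin N)) : V1 N :=
  ⟨1 ⊗ₜ[ℂ] eps N τ, Submodule.tmul_mem_baseChange_of_mem 1 (eps_mem N τ)⟩

/-- The Bethe algebra preserves `𝒱₁`. -/
def BethePreserves (N : ℕ) : Prop :=
  ∀ b ∈ betheAlgebra N, ∀ x ∈ V1 N, ulAction N b x ∈ V1 N

/-- The action of the Bethe algebra on `𝒱₁`, by restriction of its action on `𝒱`. -/
def betheRep (N : ℕ) (hB : BethePreserves N) : betheAlgebra N →ₐ[ℂ] Module.End ℂ (V1 N) where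
  toFun b := ((ulAction N (b : UL N)).restrict (hB b b.2)).restrictScalars ℂ
  map_one' := by ext x; simp
  map_mul' a b := by ext x; simp
  map_zero' := by ext x; simp
  map_add' a b := by ext x; simp
  commutes' c := by
    ext x
    simp [Algebra.algebraMap_eq_smul_one]

/-- The image `B̄_{i+1,j} ∈ End(𝒱₁)` of `B_{i+1,j}`. -/
def betheBbar (N : ℕ) (hB : BethePreserves N) (i : Fin N) (j : ℕ) : Module.End ℂ (V1 N) :=
  betheRep N hB ⟨betheB N i j, Algebra.subset_adjoin ⟨i, j, rfl⟩⟩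

/-- Laurent series in `u⁻¹` with coefficients in a ring `E`: the coefficient with index `k : ℤ`
is the coefficient of `u^{-k}`, and `u` itself is `HahnSeries.single (-1) 1`. -/
abbrev USeries (E : Type*) [Ring E] := LaurentSeries E

/-- The polynomial `∏_i (u - a_i)`. -/
def prodSub {E : Type*} [Ring E] {N : ℕ} (a : Fin N → E) : USeries E :=
  (List.ofFn fun i => (HahnSeries.single (-1) 1 - HahnSeries.single 0 (a i) : USeries E)).prod

/-- The operator of multiplication by `z_i` on `𝒱₁`. -/
def zMul (N : ℕ) (i : Fin N) : Module.End ℂ (V1 N) :=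
  Algebra.lsmul ℂ ℂ (V1 N) (MvPolynomial.X (Sum.inl i) : ZL N)

/-- The universal Bethe polynomial
`w(u, z) (v^N + ∑_{i=1}^N ∑_{j ≥ 0} B̄_{ij} u^{-j} v^{N-i})` with `w(u, z) = ∏_i (u - z_i)`:
a polynomial in `v` whose coefficients are Laurent series in `u⁻¹` over `End(𝒱₁)`. -/
def bethePoly (N : ℕ) (hB : BethePreserves N) :
    Polynomial (USeries (Module.End ℂ (V1 N))) :=
  Polynomial.C (prodSub (zMul N)) *
    (Polynomial.X ^ N + ∑ i : Fin N,
      Polynomial.C (HahnSeries.ofPowerSeries ℤ _ (PowerSeries.mk fun j => betheBbar N hB i j)) *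
        Polynomial.X ^ (N - ((i : ℕ) + 1)))

/-! ## The rational Cherednik algebra -/

/-- The generators `x_i`, `y_i`, `s_{jk}` (`j ≠ k`). -/
inductive Gen (N : ℕ) : Type
  | x (i : Fin N) : Gen N
  | y (i : Fin N) : Gen N
  | s (j k : Fin N) (h : j ≠ k) : Gen N

/-- The free algebra on the generators. -/
abbrev Free (N : ℕ) := FreeAlgebra ℂ (Gen N)

/-- `x_i` in the free algebra. -/
def fx {N : ℕ} (i : Fin N) : Free N := FreeAlgebra.ι ℂ (Gen.x i)
/-- `y_i` in the free algebra. -/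
def fy {N : ℕ} (i : Fin N) : Free N := FreeAlgebra.ι ℂ (Gen.y i)
/-- `s_{jk}` in the free algebra. -/
def fs {N : ℕ} (j k : Fin N) (h : j ≠ k) : Free N := FreeAlgebra.ι ℂ (Gen.s j k h)

/-- The defining relations. Distinct letters stand for distinct indices. -/
inductive Rel (N : ℕ) : Free N → Free N → Prop
  | s_symm (i j : Fin N) (h : i ≠ j) : Rel N (fs i j h) (fs j i h.symm)
  | s_sq (i j : Fin N) (h : i ≠ j) : Rel N (fs i j h * fs i j h) 1
  | s_braid (i j k : Fin N) (hij : i ≠ j) (hjk : j ≠ k) (hik : i ≠ k) :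
      Rel N (fs i j hij * fs j k hjk) (fs i k hik * fs i j hij)
  | s_comm (i j k l : Fin N) (hij : i ≠ j) (hkl : k ≠ l)
      (hik : i ≠ k) (hil : i ≠ l) (hjk : j ≠ k) (hjl : j ≠ l) :
      Rel N (fs i j hij * fs k l hkl) (fs k l hkl * fs i j hij)
  | x_comm (i j : Fin N) (h : i ≠ j) : Rel N (fx i * fx j) (fx j * fx i)
  | y_comm (i j : Fin N) (h : i ≠ j) : Rel N (fy i * fy j) (fy j * fy i)
  | s_x (i j : Fin N) (h : i ≠ j) : Rel N (fs i j h * fx i) (fx j * fs i j h)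
  | s_y (i j : Fin N) (h : i ≠ j) : Rel N (fs i j h * fy i) (fy j * fs i j h)
  | s_x_comm (i j k : Fin N) (h : i ≠ j) (hki : k ≠ i) (hkj : k ≠ j) :
      Rel N (fs i j h * fx k) (fx k * fs i j h)
  | s_y_comm (i j k : Fin N) (h : i ≠ j) (hki : k ≠ i) (hkj : k ≠ j) :
      Rel N (fs i j h * fy k) (fy k * fs i j h)
  | x_y (i j : Fin N) (h : i ≠ j) : Rel N (fx i * fy j - fy j * fx i) (fs i j h)
  | x_y_self (i : Fin N) :
      Rel N (fx i * fy i - fy i * fx i) (-∑ a : {a : Fin N // a ≠ i}, fs i a a.2.symm)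

/-- The rational Cherednik algebra `H_N`. -/
def H (N : ℕ) : Type := RingQuot (Rel N)

instance (N : ℕ) : Ring (H N) := inferInstanceAs (Ring (RingQuot (Rel N)))

instance (N : ℕ) : Algebra ℂ (H N) := inferInstanceAs (Algebra ℂ (RingQuot (Rel N)))

/-- The quotient map from the free algebra onto `H_N`. -/
def mkH (N : ℕ) : Free N →ₐ[ℂ] H N := RingQuot.mkAlgHom ℂ (Rel N)

theorem mkH_rel {N : ℕ} {a b : Free N} (h : Rel N a b) : mkH N a = mkH N b :=
  RingQuot.mkAlgHom_rel ℂ h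

/-- The generator `x_i` of `H_N`. -/
def xH {N : ℕ} (i : Fin N) : H N := mkH N (fx i)
/-- The generator `y_i` of `H_N`. -/
def yH {N : ℕ} (i : Fin N) : H N := mkH N (fy i)
/-- The generator `s_{jk}` of `H_N`. -/
def sH {N : ℕ} (j k : Fin N) (h : j ≠ k) : H N := mkH N (fs j k h)

/-- The relations among the `s_{ij}` define a homomorphism from the symmetric group. -/
theorem exists_permHom {M : Type*} [Monoid M] : ∀ (n : ℕ) (s : Fin n → Fin n → M)
    (_ : ∀ i j, i ≠ j → s i j = s j i) (_ : ∀ i j, i ≠ j → s i j * s i j = 1)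
    (_ : ∀ i j k, i ≠ j → j ≠ k → i ≠ k → s i j * s j k = s i k * s i j)
    (_ : ∀ i j k l, i ≠ j → k ≠ l → i ≠ k → i ≠ l → j ≠ k → j ≠ l →
      s i j * s k l = s k l * s i j),
    ∃ φ : Equiv.Perm (Fin n) →* M, ∀ i j, i ≠ j → φ (Equiv.swap i j) = s i j := by
  intro n
  induction n with
  | zero => exact fun s _ _ _ _ => ⟨1, fun i => i.elim0⟩
  | succ n ih =>
    intro s hsymm hsq hbr hcomm
    have inj := Fin.succ_injective n
    obtain ⟨φ, hφ⟩ := ih (fun i j => s i.succ j.succ)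
      (fun i j h => hsymm _ _ (inj.ne h)) (fun i j h => hsq _ _ (inj.ne h))
      (fun i j k h1 h2 h3 => hbr _ _ _ (inj.ne h1) (inj.ne h2) (inj.ne h3))
      (fun i j k l h1 h2 h3 h4 h5 h6 => hcomm _ _ _ _ (inj.ne h1) (inj.ne h2) (inj.ne h3)
        (inj.ne h4) (inj.ne h5) (inj.ne h6))
    -- the elements `s 0 p`, with `1` for `p = 0`
    let t : Fin (n + 1) → M := fun p => if p = 0 then 1 else s 0 p
    let f : Equiv.Perm (Fin (n + 1)) → M := fun σ =>
      t (Equiv.Perm.decomposeFin σ).1 * φ (Equiv.Perm.decomposeFin σ).2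
    have ht0 : t 0 = 1 := if_pos rfl
    have hts : ∀ p : Fin n, t p.succ = s 0 p.succ := fun p => if_neg (Fin.succ_ne_zero p)
    have hf : ∀ p e, f (Equiv.Perm.decomposeFin.symm (p, e)) = t p * φ e := by
      intro p e
      simp [f]
    have hD : ∀ (p : Fin (n + 1)) (e : Equiv.Perm (Fin n)),
        Equiv.Perm.decomposeFin.symm (p, e) =
          Equiv.swap 0 p * Equiv.Perm.decomposeFin.symm (0, e) := by
      intro p e
      ext x
      refine Fin.cases ?_ (fun y => ?_) x <;> simp
    have hD_mul : ∀ (a b : Fin n) (e : Equiv.Perm (Fin n)),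
        Equiv.Perm.decomposeFin.symm (0, Equiv.swap a b * e) =
          Equiv.swap a.succ b.succ * Equiv.Perm.decomposeFin.symm (0, e) := by
      intro a b e
      ext x
      refine Fin.cases ?_ (fun y => ?_) x
      · simp [Equiv.swap_apply_of_ne_of_ne (Fin.succ_ne_zero a).symm (Fin.succ_ne_zero b).symm]
      · simp [inj.swap_apply]
    have hst : ∀ (a b : Fin n), a ≠ b → ∀ p : Fin (n + 1),
        s a.succ b.succ * t p = t (Equiv.swap a.succ b.succ p) * s a.succ b.succ := by
      intro a b hab p
      have ha := (Fin.succ_ne_zero a).symm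
      have hb := (Fin.succ_ne_zero b).symm
      have hab' := inj.ne hab
      refine Fin.cases ?_ (fun c => ?_) p
      · rw [Equiv.swap_apply_of_ne_of_ne ha hb, ht0, one_mul, mul_one]
      · by_cases hca : c = a
        · subst hca
          rw [Equiv.swap_apply_left, hts, hts, hsymm _ _ ha, hsymm _ _ hb, hsymm _ _ hab']
          exact hbr _ _ _ hab'.symm ha.symm hb.symm
        · by_cases hcb : c = b
          · subst hcb
            rw [Equiv.swap_apply_right, hts, hts, hsymm _ _ ha, hsymm _ _ hb]
            exact hbr _ _ _ hab' hb.symm ha.symm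
          · have hc := (Fin.succ_ne_zero c).symm
            rw [Equiv.swap_apply_of_ne_of_ne (inj.ne hca) (inj.ne hcb), hts]
            exact hcomm _ _ _ _ hab' hc ha.symm (inj.ne (Ne.symm hca)) hb.symm
              (inj.ne (Ne.symm hcb))
    have hf0 : ∀ (q : Fin n) (σ), f (Equiv.swap 0 q.succ * σ) = s 0 q.succ * f σ := by
      intro q σ
      obtain ⟨⟨p, e⟩, rfl⟩ := Equiv.Perm.decomposeFin.symm.surjective σ
      have hq := (Fin.succ_ne_zero q).symm
      rw [hf]
      by_cases hp : p = 0
      · subst hp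
        have : Equiv.swap 0 q.succ * Equiv.Perm.decomposeFin.symm (0, e) =
            Equiv.Perm.decomposeFin.symm (q.succ, e) := by
          rw [hD q.succ]
        rw [this, hf, hts, ht0, one_mul]
      · obtain ⟨r, rfl⟩ := Fin.exists_succ_eq.2 hp
        by_cases hrq : r = q
        · subst hrq
          have : Equiv.swap 0 r.succ * Equiv.Perm.decomposeFin.symm (r.succ, e) =
              Equiv.Perm.decomposeFin.symm (0, e) := by
            rw [hD r.succ, ← mul_assoc, Equiv.swap_mul_self, one_mul]
          rw [this, hf, hts, ht0, one_mul, ← mul_assoc, hsq _ _ hq, one_mul]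
        · have : Equiv.swap 0 q.succ * Equiv.Perm.decomposeFin.symm (r.succ, e) =
              Equiv.Perm.decomposeFin.symm (r.succ, Equiv.swap r q * e) := by
            rw [hD r.succ, hD r.succ, hD_mul, ← mul_assoc, ← mul_assoc,
              Equiv.mul_swap_eq_swap_mul (Equiv.swap 0 r.succ) r.succ q.succ,
              Equiv.swap_apply_right,
              Equiv.swap_apply_of_ne_of_ne hq.symm (inj.ne (Ne.symm hrq))]
          have hr := (Fin.succ_ne_zero r).symm
          rw [this, hf, hts, map_mul, hφ _ _ hrq, ← mul_assoc, ← mul_assoc,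
            hbr 0 r.succ q.succ hr (inj.ne hrq) hq]
    have hf1 : ∀ (a b : Fin n), a ≠ b → ∀ σ,
        f (Equiv.swap a.succ b.succ * σ) = s a.succ b.succ * f σ := by
      intro a b hab σ
      obtain ⟨⟨p, e⟩, rfl⟩ := Equiv.Perm.decomposeFin.symm.surjective σ
      have : Equiv.swap a.succ b.succ * Equiv.Perm.decomposeFin.symm (p, e) =
          Equiv.Perm.decomposeFin.symm (Equiv.swap a.succ b.succ p, Equiv.swap a b * e) := by
        rw [hD, hD (Equiv.swap a.succ b.succ p), hD_mul, ← mul_assoc, ← mul_assoc,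
          Equiv.mul_swap_eq_swap_mul, Equiv.swap_apply_of_ne_of_ne
            (Fin.succ_ne_zero a).symm (Fin.succ_ne_zero b).symm]
      rw [this, hf, hf, map_mul, hφ _ _ hab, ← mul_assoc, ← mul_assoc, hst a b hab]
    have hfs : ∀ i j, i ≠ j → ∀ σ, f (Equiv.swap i j * σ) = s i j * f σ := by
      intro i j
      refine Fin.cases ?_ (fun a => ?_) i
      · refine Fin.cases ?_ (fun b => ?_) j
        · exact fun h => absurd rfl h
        · exact fun _ => hf0 b
      · refine Fin.cases ?_ (fun b => ?_) j
        · intro h σ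
          rw [Equiv.swap_comm, hsymm _ _ h]
          exact hf0 a σ
        · exact fun h => hf1 a b (fun h' => h (by rw [h']))
    have hf_one : f 1 = 1 := by
      have : (1 : Equiv.Perm (Fin (n + 1))) = Equiv.Perm.decomposeFin.symm (0, 1) := by
        rw [Equiv.Perm.decomposeFin_symm_of_one, Equiv.swap_self]; rfl
      rw [this, hf, ht0, map_one, one_mul]
    refine ⟨⟨⟨f, hf_one⟩, fun σ τ => ?_⟩, fun i j h => ?_⟩
    · change f (σ * τ) = f σ * f τ
      induction σ using Equiv.Perm.swap_induction_on with
      | one => rw [one_mul, hf_one, one_mul]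
      | swap_mul σ i j h ih => rw [mul_assoc, hfs i j h (σ * τ), hfs i j h σ, ih,
        ← mul_assoc (s i j) (f σ) (f τ)]
    · change f (Equiv.swap i j) = s i j
      have := hfs i j h 1
      rwa [mul_one, hf_one, mul_one] at this

theorem exists_permH (N : ℕ) : ∃ φ : Equiv.Perm (Fin N) →* H N,
    ∀ i j (h : i ≠ j), φ (Equiv.swap i j) = sH i j h := by
  classical
  obtain ⟨φ, hφ⟩ := exists_permHom N (fun i j => if h : i ≠ j then sH i j h else (1 : H N))
    (fun i j h => by
      simp only [dif_pos h, dif_pos h.symm]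
      exact mkH_rel (Rel.s_symm i j h))
    (fun i j h => by
      simp only [dif_pos h, sH, ← map_mul]
      rw [mkH_rel (Rel.s_sq i j h), map_one])
    (fun i j k hij hjk hik => by
      simp only [dif_pos hij, dif_pos hjk, dif_pos hik, sH, ← map_mul]
      exact mkH_rel (Rel.s_braid i j k hij hjk hik))
    (fun i j k l hij hkl hik hil hjk hjl => by
      simp only [dif_pos hij, dif_pos hkl, sH, ← map_mul]
      exact mkH_rel (Rel.s_comm i j k l hij hkl hik hil hjk hjl))
  exact ⟨φ, fun i j h => by rw [hφ i j h, dif_pos h]⟩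

/-- The homomorphism `S_N → H_N` with `(j k) ↦ s_{jk}`, through which permutations are regarded
as elements of `H_N`. It is unique because transpositions generate `S_N`. -/
def permH (N : ℕ) : Equiv.Perm (Fin N) →* H N := (exists_permH N).choose

theorem permH_swap (N : ℕ) (i j : Fin N) (h : i ≠ j) : permH N (Equiv.swap i j) = sH i j h :=
  (exists_permH N).choose_spec i j h

/-- `p(a₁, …, a_N)` for a polynomial `p` and (commuting) elements `a_i` of an algebra: the linear
map with `X₁^{m₁} ⋯ X_N^{m_N} ↦ a₁^{m₁} ⋯ a_N^{m_N}`. -/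
def evalPoly {N : ℕ} {A : Type*} [Ring A] [Algebra ℂ A] (a : Fin N → A) :
    MvPolynomial (Fin N) ℂ →ₗ[ℂ] A :=
  (MvPolynomial.basisMonomials (Fin N) ℂ).constr ℂ
    fun m => (List.ofFn fun i => a i ^ m i).prod

/-- The normal ordering map `ℂ[x, y] = ℂ[x] ⊗ ℂ[y] → H_N`, which puts the `x_i` to the left
of the `y_i`. In the source `Sum.inl i` labels `x_i` and `Sum.inr i` labels `y_i`. -/
def normalOrder (N : ℕ) : MvPolynomial (Fin N ⊕ Fin N) ℂ →ₗ[ℂ] H N :=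
  (MvPolynomial.basisMonomials (Fin N ⊕ Fin N) ℂ).constr ℂ fun m =>
    (List.ofFn fun i => xH i ^ m (Sum.inl i)).prod *
      (List.ofFn fun i => yH i ^ m (Sum.inr i)).prod

/-- The normal ordering map applied to the coefficients of a polynomial in `u` and `v`.
In `Polynomial (Polynomial _)` the outer variable is `v` and the inner variable is `u`. -/
def normalOrderUV (N : ℕ) (P : Polynomial (Polynomial (MvPolynomial (Fin N ⊕ Fin N) ℂ))) :
    Polynomial (Polynomial (H N)) :=
  P.sum fun n q => Polynomial.monomial n
    (q.sum fun m r => Polynomial.monomial m (normalOrder N r))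

/-- The commutative factor `1 - (v - x_i)(u - y_i)`. -/
def fixFactor (N : ℕ) (i : Fin N) : Polynomial (Polynomial (MvPolynomial (Fin N ⊕ Fin N) ℂ)) :=
  1 - (Polynomial.X - Polynomial.C (Polynomial.C (MvPolynomial.X (Sum.inl i)))) *
    (Polynomial.C Polynomial.X - Polynomial.C (Polynomial.C (MvPolynomial.X (Sum.inr i))))

/-- The universal central polynomial
`(-1)^N ∑_σ :∏_{i, σ(i) = i} (1 - (v - x_i)(u - y_i)): (-1)^σ σ`
in `H_N[u][v]`. -/
def centralPoly (N : ℕ) : Polynomial (Polynomial (H N)) :=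
  (-1) ^ N * ∑ σ : Equiv.Perm (Fin N),
    normalOrderUV N (∏ i : Fin N with σ i = i, fixFactor N i) *
      Polynomial.C (Polynomial.C (((Equiv.Perm.sign σ : ℤˣ) : ℤ) • permH N σ))

end BetheCherednik

end

/-! # The Bethe algebra on the weight space and the center of the rational Cherednik algebra

*The isomorphism.* The space `𝒱₁` is free over `ℂ[z, λ]` with basis `ε_τ`. On this free module
`H_N` acts by Dunkl-type operators: `x_i` is multiplication by `λ_i`, permutations act on `λ` and
on the indices of `ε_τ`, and `y_j` is `z_{τ⁻¹(j)}` plus divided differences in `λ`. Sending `h` to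
`h ε_1` is inverse to `q(λ) p(z) ε_τ ↦ q(x) τ p(y)`, which is the PBW theorem for `H_N`
(`psiEquiv`) and gives `ι` (`iota`). Under `ι`, multiplication by `λ_i` and `z_i` becomes left
multiplication by `x_i` and right multiplication by `y_i`.

*The Bethe operators.* Applying the rows of the row determinant to `ε_τ` one after the other
produces, besides the normally ordered product, terms in which `∂` differentiates some
`(u - z_a)⁻¹` and terms in which two factors meet at the same tensor site; these cancel in pairs
`σ`, `σ (i a)` (`sum_sign_prod_apply`). So the universal operator sends `ε_τ` to the signed sum of
`∏_a (δ_{a σ(a)} (v - λ_a) - (u - z_{τ⁻¹(a)})⁻¹) ε_{στ}` (`evalAt_universalOperator`). Multiplying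
by `∏ (u - z_i)` leaves the product of `1 - (v - λ_a)(u - z_{τ⁻¹(a)})` over the fixed points of `σ`,
which is also what the universal central polynomial times `τ` gives (`coeff_centralPoly_mul_permH`).

*Centrality.* The universal central polynomial commutes with `H_N`: its commutator with `x_j` is
computed from `[x_i, y_j]` and cancels after reindexing (`central_comm_x`), the case of `y_j`
follows by the antiautomorphism that exchanges `x` and `y`, and the elements `v - x_i`, `u - y_i`
satisfy the relations of `H_N` again. As central elements commute with the action of `ℂ[z, λ]`, the
agreement on the `ε_τ` yields the intertwining property (`iota_coeff_bethePoly`). Dividing by the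
coefficient of `v^N`, one finds that the whole Bethe algebra acts by central elements.

*Surjectivity onto the center.* Write elements of `H_N` as `∑_τ f_τ ε_τ` and filter by the degree
in `z`. Commuting a central element with the `y_j` shows that `f_τ` has lower degree than `f_1` for
`τ ≠ 1` (`mem_degLT_of_central`), and commuting it with permutations shows that `f_1` is symmetric
under simultaneous permutations of `z` and `λ`. The leading terms of the Bethe operators contain the
polarized power sums `∑_a λ_a^k z_a^b` (`powerSum_mem_leadingTerms`) and are closed under products,
hence they contain every symmetric polynomial (`mem_leadingTerms_of_symmetric`). Induction on the
degree puts each central element into the image of the Bethe algebra.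
-/

noncomputable section

namespace BetheCherednik

/-! ### Evaluation of polynomials at commuting elements -/

theorem exists_evalHom {ι A : Type*} [Ring A] [Algebra ℂ A] (a : ι → A)
    (h : ∀ i j, Commute (a i) (a j)) :
    ∃ φ : MvPolynomial ι ℂ →ₐ[ℂ] A, ∀ i, φ (MvPolynomial.X i) = a i := by
  have hc : IsMulCommutative (Algebra.adjoin ℂ (Set.range a)) :=
    Algebra.isMulCommutative_adjoin ℂ (by
      rintro _ ⟨i, rfl⟩ _ ⟨j, rfl⟩
      exact h i j)
  let : CommRing (Algebra.adjoin ℂ (Set.range a)) :=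
    { (inferInstance : Ring (Algebra.adjoin ℂ (Set.range a))) with
      mul_comm := fun x y => hc.is_comm.comm x y }
  let b : ι → Algebra.adjoin ℂ (Set.range a) := fun i => ⟨a i, Algebra.subset_adjoin ⟨i, rfl⟩⟩
  refine ⟨(Algebra.adjoin ℂ (Set.range a)).val.comp (MvPolynomial.aeval b), fun i => ?_⟩
  rw [AlgHom.comp_apply, MvPolynomial.aeval_X]
  rfl

/-- Evaluation of polynomials at a family of pairwise commuting elements of an algebra that need
not be commutative. -/
def evalHom {ι A : Type*} [Ring A] [Algebra ℂ A] (a : ι → A)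
    (h : ∀ i j, Commute (a i) (a j)) : MvPolynomial ι ℂ →ₐ[ℂ] A :=
  (exists_evalHom a h).choose

@[simp] theorem evalHom_X {ι A : Type*} [Ring A] [Algebra ℂ A] (a : ι → A)
    (h : ∀ i j, Commute (a i) (a j)) (i : ι) : evalHom a h (MvPolynomial.X i) = a i :=
  (exists_evalHom a h).choose_spec i

theorem evalHom_monomial {N : ℕ} {A : Type*} [Ring A] [Algebra ℂ A] (a : Fin N → A)
    (h : ∀ i j, Commute (a i) (a j)) (m : Fin N →₀ ℕ) :
    evalHom a h (MvPolynomial.monomial m 1) = (List.ofFn fun i => a i ^ m i).prod := by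
  rw [MvPolynomial.monomial_eq, Finsupp.prod_fintype _ _ (by simp), map_one, one_mul,
    ← List.prod_ofFn, map_list_prod, List.map_ofFn]
  congr 2
  funext i
  simp

theorem evalPoly_eq_evalHom {N : ℕ} {A : Type*} [Ring A] [Algebra ℂ A] (a : Fin N → A)
    (h : ∀ i j, Commute (a i) (a j)) (p : MvPolynomial (Fin N) ℂ) :
    evalPoly a p = evalHom a h p := by
  have : evalPoly a = (evalHom a h).toLinearMap := by
    refine (MvPolynomial.basisMonomials (Fin N) ℂ).ext fun m => ?_
    rw [evalPoly, Module.Basis.constr_basis, MvPolynomial.coe_basisMonomials,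
      AlgHom.toLinearMap_apply, evalHom_monomial]
  rw [this]; rfl

/-! ### Permuting the variables and divided differences -/

variable {N : ℕ}

/-- The variable `z_i`. -/
abbrev zv (i : Fin N) : ZL N := MvPolynomial.X (Sum.inl i)

/-- The variable `λ_i`. -/
abbrev lv (i : Fin N) : ZL N := MvPolynomial.X (Sum.inr i)

/-- The permutation `λ_i ↦ λ_{σ(i)}` of the variables `λ`, with the `z_i` fixed. -/
def permLam (σ : Equiv.Perm (Fin N)) : ZL N →ₐ[ℂ] ZL N := MvPolynomial.rename (Sum.map id σ)

/-- The permutation `z_i ↦ z_{σ(i)}` of the variables `z`, with the `λ_i` fixed. -/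
def permZ (σ : Equiv.Perm (Fin N)) : ZL N →ₐ[ℂ] ZL N := MvPolynomial.rename (Sum.map σ id)

@[simp] theorem permLam_zv (σ : Equiv.Perm (Fin N)) (i : Fin N) : permLam σ (zv i) = zv i := by
  simp [permLam]

@[simp] theorem permLam_lv (σ : Equiv.Perm (Fin N)) (i : Fin N) :
    permLam σ (lv i) = lv (σ i) := by
  simp [permLam]

@[simp] theorem permZ_zv (σ : Equiv.Perm (Fin N)) (i : Fin N) : permZ σ (zv i) = zv (σ i) := by
  simp [permZ]

@[simp] theorem permZ_lv (σ : Equiv.Perm (Fin N)) (i : Fin N) : permZ σ (lv i) = lv i := by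
  simp [permZ]

theorem permLam_mul (σ τ : Equiv.Perm (Fin N)) (q : ZL N) :
    permLam (σ * τ) q = permLam σ (permLam τ q) := by
  rw [permLam, permLam, permLam, MvPolynomial.rename_rename]
  congr 2
  funext x; cases x <;> rfl

theorem permLam_one (q : ZL N) : permLam 1 q = q := by
  rw [permLam, show Sum.map id (⇑(1 : Equiv.Perm (Fin N))) = (id : Fin N ⊕ Fin N → _) from by
    funext x; cases x <;> rfl, MvPolynomial.rename_id]
  rfl

theorem lv_sub_ne_zero {i j : Fin N} (h : i ≠ j) : (lv i - lv j : ZL N) ≠ 0 := by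
  rw [sub_ne_zero]
  intro e
  exact h (Sum.inr_injective (MvPolynomial.X_injective e))

theorem lv_sub_dvd (i j : Fin N) (q : ZL N) :
    (lv i - lv j : ZL N) ∣ q - permLam (Equiv.swap i j) q := by
  induction q using MvPolynomial.induction_on with
  | C c => simp [permLam]
  | add p q hp hq =>
    rw [map_add, add_sub_add_comm]
    exact dvd_add hp hq
  | mul_X p k hp =>
    have hk : (lv i - lv j : ZL N) ∣ MvPolynomial.X k - permLam (Equiv.swap i j)
        (MvPolynomial.X k) := by
      rcases k with k | k
      · rw [permLam_zv, sub_self]; exact dvd_zero _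
      · rw [permLam_lv]
        by_cases h1 : k = i
        · subst h1; rw [Equiv.swap_apply_left]
        · by_cases h2 : k = j
          · subst h2; rw [Equiv.swap_apply_right]; exact ⟨-1, by ring⟩
          · rw [Equiv.swap_apply_of_ne_of_ne h1 h2, sub_self]; exact dvd_zero _
    rw [map_mul, show ∀ a b c d : ZL N, a * b - c * d = (a - c) * b + c * (b - d) from
      fun a b c d => by ring]
    exact dvd_add (hp.mul_right _) (hk.mul_left _)

/-- The divided difference `(q - s_{ij} q) / (λ_i - λ_j)`, where `s_{ij}` exchanges `λ_i` and
`λ_j`; by convention it is zero for `i = j`. -/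
def divDiff (i j : Fin N) (q : ZL N) : ZL N :=
  if i = j then 0 else (lv_sub_dvd i j q).choose

theorem divDiff_self (i : Fin N) (q : ZL N) : divDiff i i q = 0 := if_pos rfl

theorem mul_divDiff (i j : Fin N) (q : ZL N) :
    (lv i - lv j) * divDiff i j q = q - permLam (Equiv.swap i j) q := by
  rw [divDiff]
  split_ifs with h
  · subst h
    rw [Equiv.swap_self, show Equiv.refl (Fin N) = 1 from rfl, permLam_one]
    ring
  · exact (lv_sub_dvd i j q).choose_spec.symm

theorem eq_divDiff {i j : Fin N} (h : i ≠ j) {q r : ZL N}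
    (hr : (lv i - lv j) * r = q - permLam (Equiv.swap i j) q) : r = divDiff i j q :=
  mul_left_cancel₀ (lv_sub_ne_zero h) (hr.trans (mul_divDiff i j q).symm)

theorem divDiff_add (i j : Fin N) (q r : ZL N) :
    divDiff i j (q + r) = divDiff i j q + divDiff i j r := by
  by_cases h : i = j
  · subst h; simp [divDiff_self]
  · symm
    apply eq_divDiff h
    rw [mul_add, mul_divDiff, mul_divDiff, map_add]; ring

theorem divDiff_mul (i j : Fin N) (q r : ZL N) :
    divDiff i j (q * r) = divDiff i j q * r + permLam (Equiv.swap i j) q * divDiff i j r := by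
  by_cases h : i = j
  · subst h; simp [divDiff_self]
  · symm
    apply eq_divDiff h
    rw [mul_add, ← mul_assoc, mul_divDiff, mul_left_comm, mul_divDiff, map_mul]; ring

theorem divDiff_eq_zero {i j : Fin N} {q : ZL N} (hq : permLam (Equiv.swap i j) q = q) :
    divDiff i j q = 0 := by
  by_cases h : i = j
  · subst h; simp [divDiff_self]
  · symm
    apply eq_divDiff h
    rw [hq]; ring

theorem divDiff_smul (i j : Fin N) (c : ℂ) (q : ZL N) :
    divDiff i j (c • q) = c • divDiff i j q := by
  rw [MvPolynomial.smul_eq_C_mul, divDiff_mul, divDiff_eq_zero (by simp [permLam]), zero_mul,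
    zero_add, MvPolynomial.smul_eq_C_mul]
  simp [permLam]

theorem divDiff_zero (i j : Fin N) : divDiff i j (0 : ZL N) = 0 := divDiff_eq_zero (by simp)

theorem divDiff_one (i j : Fin N) : divDiff i j (1 : ZL N) = 0 := divDiff_eq_zero (by simp)

theorem divDiff_zv_mul (i j k : Fin N) (q : ZL N) :
    divDiff i j (zv k * q) = zv k * divDiff i j q := by
  rw [divDiff_mul, divDiff_eq_zero (by simp), permLam_zv]; ring

theorem divDiff_lv_left {i j : Fin N} (h : i ≠ j) : divDiff i j (lv i : ZL N) = 1 := by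
  symm
  apply eq_divDiff h
  simp

theorem divDiff_lv_right {i j : Fin N} (h : i ≠ j) : divDiff i j (lv j : ZL N) = -1 := by
  symm
  apply eq_divDiff h
  simp

theorem divDiff_lv_of_ne {i j k : Fin N} (hi : k ≠ i) (hj : k ≠ j) :
    divDiff i j (lv k : ZL N) = 0 :=
  divDiff_eq_zero (by rw [permLam_lv, Equiv.swap_apply_of_ne_of_ne hi hj])

theorem swap_apply_eq_mul (σ : Equiv.Perm (Fin N)) (i j : Fin N) :
    Equiv.swap (σ i) (σ j) * σ = σ * Equiv.swap i j := (Equiv.mul_swap_eq_swap_mul σ i j).symm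

theorem permLam_divDiff (σ : Equiv.Perm (Fin N)) (i j : Fin N) (q : ZL N) :
    permLam σ (divDiff i j q) = divDiff (σ i) (σ j) (permLam σ q) := by
  by_cases h : i = j
  · subst h; simp [divDiff_self]
  · apply eq_divDiff (σ.injective.ne h)
    rw [← permLam_mul, swap_apply_eq_mul, permLam_mul, ← map_sub, ← mul_divDiff]
    simp

/-! ### The polynomial representation of the rational Cherednik algebra -/

/-- The free module `⨁_τ ℂ[z, λ] ε_τ`, whose elements are recorded by their coefficients. -/
abbrev Mod (N : ℕ) := Equiv.Perm (Fin N) → ZL N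

/-- The basis vector `ε_τ`. -/
abbrev ev (τ : Equiv.Perm (Fin N)) : Mod N := Pi.single τ 1

/-- The operator `q(λ) p(z) ε_τ ↦ q(σλ) p(z) ε_{στ}`. -/
def opS (σ : Equiv.Perm (Fin N)) : Module.End ℂ (Mod N) where
  toFun f τ := permLam σ (f (σ⁻¹ * τ))
  map_add' f g := by ext1 τ; simp
  map_smul' c f := by ext1 τ; simp

/-- Multiplication by `λ_i`. -/
def opX (i : Fin N) : Module.End ℂ (Mod N) where
  toFun f τ := lv i * f τ
  map_add' f g := by ext1 τ; simp [mul_add]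
  map_smul' c f := by ext1 τ; simp

/-- The operator by which `y_j` acts: `q(λ) p(z) ε_τ` goes to
`q(λ) z_{τ⁻¹(j)} p(z) ε_τ` plus divided differences of `q`. -/
def opY (j : Fin N) : Module.End ℂ (Mod N) where
  toFun f τ := zv (τ⁻¹ j) * f τ + ∑ a, divDiff j a (f (Equiv.swap j a * τ))
  map_add' f g := by
    ext1 τ; simp only [Pi.add_apply, divDiff_add, Finset.sum_add_distrib]; ring
  map_smul' c f := by
    ext1 τ; simp only [Pi.smul_apply, divDiff_smul, RingHom.id_apply, smul_add, Finset.smul_sum,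
      mul_smul_comm]

theorem opS_apply (σ τ : Equiv.Perm (Fin N)) (f : Mod N) :
    opS σ f τ = permLam σ (f (σ⁻¹ * τ)) := rfl

theorem opX_eq_smul (i : Fin N) (f : Mod N) : opX i f = (lv i : ZL N) • f := rfl

theorem opY_apply (j : Fin N) (f : Mod N) (τ : Equiv.Perm (Fin N)) :
    opY j f τ = zv (τ⁻¹ j) * f τ + ∑ a, divDiff j a (f (Equiv.swap j a * τ)) := rfl

theorem opS_mul (σ τ : Equiv.Perm (Fin N)) : opS (σ * τ) = opS σ * opS τ := by
  refine LinearMap.ext fun f => funext fun ρ => ?_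
  rw [Module.End.mul_apply, opS_apply, opS_apply, opS_apply, permLam_mul, mul_inv_rev, mul_assoc]

theorem opS_one : opS (1 : Equiv.Perm (Fin N)) = 1 := by
  refine LinearMap.ext fun f => funext fun ρ => ?_
  rw [opS_apply, permLam_one, inv_one, one_mul]; rfl

theorem opS_opX (σ : Equiv.Perm (Fin N)) (i : Fin N) : opS σ * opX i = opX (σ i) * opS σ := by
  refine LinearMap.ext fun f => funext fun ρ => ?_
  simp [opS_apply, opX_eq_smul]

theorem opS_opY (σ : Equiv.Perm (Fin N)) (j : Fin N) : opS σ * opY j = opY (σ j) * opS σ := by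
  refine LinearMap.ext fun f => funext fun ρ => ?_
  simp only [Module.End.mul_apply, opS_apply, opY_apply, map_add, map_mul, map_sum, permLam_zv,
    permLam_divDiff]
  congr 1
  conv_rhs => rw [← Equiv.sum_comp σ]
  refine Finset.sum_congr rfl fun a _ => ?_
  rw [← mul_assoc, ← mul_assoc]
  congr 4
  rw [eq_inv_mul_iff_mul_eq, ← mul_assoc, ← swap_apply_eq_mul, mul_assoc, mul_inv_cancel, mul_one]

theorem opX_comm (i j : Fin N) : opX i * opX j = opX j * opX i := by
  refine LinearMap.ext fun f => funext fun ρ => ?_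
  simp only [Module.End.mul_apply, opX_eq_smul, Pi.smul_apply, smul_eq_mul]; ring

theorem opY_zv_smul (j k : Fin N) (f : Mod N) :
    opY j ((zv k : ZL N) • f) = (zv k : ZL N) • opY j f := by
  funext ρ
  simp only [opY_apply, Pi.smul_apply, smul_eq_mul, divDiff_zv_mul, mul_add, Finset.mul_sum]
  ring

/-- The relation `[x_i, y_j] = s_{ij}`: it comes from the divided difference of `λ_i` with respect
to the exchange of `λ_j` and `λ_i`. -/
theorem opX_opY (i j : Fin N) (h : i ≠ j) :
    opX i * opY j - opY j * opX i = opS (Equiv.swap i j) := by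
  refine LinearMap.ext fun f => funext fun ρ => ?_
  simp only [LinearMap.sub_apply, Module.End.mul_apply, opX_eq_smul, opS_apply, opY_apply,
    Pi.sub_apply, Pi.smul_apply, smul_eq_mul, divDiff_mul, Finset.sum_add_distrib]
  rw [Finset.sum_eq_single i (f := fun a => divDiff j a (lv i) * f (Equiv.swap j a * ρ)),
    divDiff_lv_right h.symm]
  · have : ∀ a, permLam (Equiv.swap j a) (lv i) * divDiff j a (f (Equiv.swap j a * ρ)) =
        lv i * divDiff j a (f (Equiv.swap j a * ρ)) + if a = i then
          (lv j - lv i) * divDiff j a (f (Equiv.swap j a * ρ)) else 0 := by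
      intro a
      by_cases ha : a = i
      · subst ha; simp only [permLam_lv, Equiv.swap_apply_right, if_true]; ring
      · rw [permLam_lv, Equiv.swap_apply_of_ne_of_ne h (Ne.symm ha), if_neg ha, add_zero]
    simp only [this, Finset.sum_add_distrib, Finset.sum_ite_eq', Finset.mem_univ, if_true,
      mul_divDiff, ← Finset.mul_sum]
    rw [Equiv.swap_comm j i, Equiv.swap_inv]
    ring
  · intro a _ ha
    rw [divDiff_lv_of_ne h (Ne.symm ha), zero_mul]
  · simp

theorem opX_opY_self (i : Fin N) :
    opX i * opY i - opY i * opX i = -∑ a : {a : Fin N // a ≠ i}, opS (Equiv.swap i a) := by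
  refine LinearMap.ext fun f => funext fun ρ => ?_
  have hs : (∑ a : {a : Fin N // a ≠ i}, opS (Equiv.swap i a)) f ρ =
      ∑ a : Fin N, if a ≠ i then opS (Equiv.swap i a) f ρ else 0 := by
    rw [LinearMap.sum_apply, Finset.sum_apply, ← Finset.sum_filter]
    exact (Finset.sum_subtype (Finset.univ.filter fun a => a ≠ i) (by simp)
      fun a => opS (Equiv.swap i a) f ρ).symm
  rw [LinearMap.neg_apply, Pi.neg_apply, hs]
  simp only [LinearMap.sub_apply, Module.End.mul_apply, opX_eq_smul, opY_apply,
    Pi.sub_apply, Pi.smul_apply, smul_eq_mul, mul_add, Finset.mul_sum]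
  have : ∀ a, divDiff i a (lv i * f (Equiv.swap i a * ρ)) =
      lv i * divDiff i a (f (Equiv.swap i a * ρ)) +
        if a ≠ i then opS (Equiv.swap i a) f ρ else 0 := by
    intro a
    by_cases ha : a = i
    · subst ha; simp [divDiff_self]
    · have h2 := mul_divDiff i a (f (Equiv.swap i a * ρ))
      rw [divDiff_mul, divDiff_lv_left (Ne.symm ha), permLam_lv, Equiv.swap_apply_left, if_pos ha,
        opS_apply, Equiv.swap_inv]
      linear_combination -h2
  rw [Finset.sum_congr rfl fun a _ => this a, Finset.sum_add_distrib]
  ring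

/-- A linear map out of `⨁_τ ℂ[z, λ] ε_τ` that is compatible with multiplication by the variables
vanishes if it vanishes at all `ε_τ`. -/
theorem eq_zero_of_smul_X {K : Type*} [AddCommGroup K] [Module ℂ K] (T : Mod N →ₗ[ℂ] K)
    (θ : Fin N ⊕ Fin N → K → K) (hθ : ∀ k, θ k 0 = 0)
    (hT : ∀ k f, T ((MvPolynomial.X k : ZL N) • f) = θ k (T f)) (h0 : ∀ τ, T (ev τ) = 0) :
    T = 0 := by
  have h : ∀ τ (g : ZL N), T (Pi.single τ g) = 0 := by
    intro τ g
    induction g using MvPolynomial.induction_on with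
    | C c =>
      rw [← mul_one (MvPolynomial.C c), ← MvPolynomial.smul_eq_C_mul, Pi.single_smul, map_smul,
        h0, smul_zero]
    | add p q hp hq => rw [Pi.single_add, map_add, hp, hq, add_zero]
    | mul_X p k hp => rw [mul_comm, ← smul_eq_mul, Pi.single_smul, hT, hp, hθ]
  refine LinearMap.ext fun f => ?_
  rw [← Finset.univ_sum_single f, map_sum, Finset.sum_eq_zero fun τ _ => h τ _,
    LinearMap.zero_apply]

theorem opY_ev (j : Fin N) (τ : Equiv.Perm (Fin N)) :
    opY j (ev τ) = (zv (τ⁻¹ j) : ZL N) • ev τ := by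
  funext ρ
  rw [opY_apply, Finset.sum_eq_zero, add_zero, Pi.smul_apply, smul_eq_mul]
  · by_cases h : ρ = τ
    · subst h; rfl
    · rw [show ev τ ρ = 0 from Pi.single_eq_of_ne h _]; simp
  · intro a _
    by_cases h : Equiv.swap j a * ρ = τ
    · rw [h, show ev τ τ = 1 from Pi.single_eq_same _ _, divDiff_one]
    · rw [show ev τ _ = 0 from Pi.single_eq_of_ne h _, divDiff_zero]

theorem opY_comm (i j : Fin N) : opY i * opY j = opY j * opY i := by
  by_cases hij : i = j
  · rw [hij]
  rw [← sub_eq_zero]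
  -- the commutator is linear over `ℂ[z, λ]`, by the Jacobi identity, and it kills every `ε_τ`
  have hx : ∀ k, (opY i * opY j - opY j * opY i) * opX k =
      opX k * (opY i * opY j - opY j * opY i) := by
    have comm : ∀ a b c : Fin N, c ≠ a → c ≠ b →
        opS (Equiv.swap a b) * opY c = opY c * opS (Equiv.swap a b) := by
      intro a b c ha hb
      rw [opS_opY, Equiv.swap_apply_of_ne_of_ne ha hb]
    -- `[y_i, [y_j, x_k]] = [y_j, [y_i, x_k]]`
    have key : ∀ k, opY i * (opX k * opY j - opY j * opX k) -
        (opX k * opY j - opY j * opX k) * opY i =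
        opY j * (opX k * opY i - opY i * opX k) - (opX k * opY i - opY i * opX k) * opY j := by
      have main : ∀ i j : Fin N, i ≠ j → opY i * (opX j * opY j - opY j * opX j) -
        (opX j * opY j - opY j * opX j) * opY i =
        opY j * (opX j * opY i - opY i * opX j) - (opX j * opY i - opY i * opX j) * opY j := by
        intro i j hij
        rw [opX_opY_self, opX_opY j i hij.symm, opS_opY, Equiv.swap_apply_left]
        generalize hS : (∑ a : {a : Fin N // a ≠ j}, opS (Equiv.swap j a.1)) = S
        have h1 : opY i * -S = -(opY i * S) := LinearMap.ext fun f => map_neg (opY i) (S f)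
        have h2 : -S * opY i = -(S * opY i) := rfl
        rw [h1, h2, ← hS, Finset.mul_sum, Finset.sum_mul, sub_neg_eq_add, neg_add_eq_sub,
          ← Finset.sum_sub_distrib, Finset.sum_eq_single ⟨i, hij⟩]
        · rw [opS_opY]; simp
        · rintro ⟨a, ha⟩ _ hne
          rw [comm _ _ _ hij (fun h => hne (Subtype.ext h.symm)), sub_self]
        · simp
      intro k
      by_cases hki : k = i
      · subst hki; exact (main j k (Ne.symm hij)).symm
      by_cases hkj : k = j
      · subst hkj; exact main i k hij
      rw [opX_opY k j hkj, opX_opY k i hki, comm _ _ _ (Ne.symm hki) hij,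
        comm _ _ _ (Ne.symm hkj) (Ne.symm hij), sub_self, sub_self]
    intro k
    have := key k
    simp only [mul_sub, sub_mul, ← mul_assoc] at this ⊢
    rw [← sub_eq_zero] at this ⊢
    rw [← neg_eq_zero, ← this]
    abel
  refine eq_zero_of_smul_X _ (fun k f => (MvPolynomial.X k : ZL N) • f) (by simp) ?_ ?_
  · rintro (k | k) f
    · simp [opY_zv_smul, smul_sub]
    · exact LinearMap.congr_fun (hx k) f
  · intro τ
    simp only [LinearMap.sub_apply, Module.End.mul_apply, opY_ev, opY_zv_smul, smul_smul]
    rw [mul_comm, sub_self]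

/-! ### The relations of the rational Cherednik algebra -/

/-- Elements `x_i`, `y_i` and a homomorphism `s` from the symmetric group that satisfy the
relations of the rational Cherednik algebra, in an arbitrary algebra `A`. -/
structure CherednikData (N : ℕ) (A : Type*) [Ring A] [Algebra ℂ A] where
  x : Fin N → A
  y : Fin N → A
  s : Equiv.Perm (Fin N) →* A
  x_comm : ∀ i j, Commute (x i) (x j)
  y_comm : ∀ i j, Commute (y i) (y j)
  s_x : ∀ σ i, s σ * x i = x (σ i) * s σ
  s_y : ∀ σ i, s σ * y i = y (σ i) * s σ
  x_y : ∀ i j, i ≠ j → x i * y j - y j * x i = s (Equiv.swap i j)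
  x_y_self : ∀ i, x i * y i - y i * x i = -∑ a ∈ Finset.univ.erase i, s (Equiv.swap i a)

theorem xH_comm (i j : Fin N) : Commute (xH i : H N) (xH j) := by
  by_cases h : i = j
  · rw [h]
  · have := mkH_rel (Rel.x_comm i j h)
    rwa [map_mul, map_mul] at this

theorem yH_comm (i j : Fin N) : Commute (yH i : H N) (yH j) := by
  by_cases h : i = j
  · rw [h]
  · have := mkH_rel (Rel.y_comm i j h)
    rwa [map_mul, map_mul] at this

/-- Conjugation by permutations permutes a family as soon as it does so for transpositions. -/
theorem permH_conj (v : Fin N → H N) (h1 : ∀ i j (h : i ≠ j), sH i j h * v i = v j * sH i j h)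
    (h2 : ∀ i j k (h : i ≠ j), k ≠ i → k ≠ j → sH i j h * v k = v k * sH i j h)
    (σ : Equiv.Perm (Fin N)) (i : Fin N) : permH N σ * v i = v (σ i) * permH N σ := by
  induction σ using Equiv.Perm.swap_induction_on with
  | one => simp
  | swap_mul σ a b hab ih =>
    rw [map_mul, mul_assoc, ih, ← mul_assoc, ← mul_assoc, Equiv.Perm.mul_apply]
    congr 1
    by_cases ha : σ i = a
    · rw [ha, Equiv.swap_apply_left, permH_swap N a b hab, h1]
    · by_cases hb : σ i = b
      · rw [hb, Equiv.swap_apply_right, Equiv.swap_comm, permH_swap N b a (Ne.symm hab), h1]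
      · rw [Equiv.swap_apply_of_ne_of_ne ha hb, permH_swap N a b hab, h2 _ _ _ _ ha hb]

theorem sum_ne_eq_sum_erase {A : Type*} [AddCommMonoid A] (i : Fin N) (g : Fin N → A) :
    ∑ a : {a : Fin N // a ≠ i}, g a = ∑ a ∈ Finset.univ.erase i, g a :=
  (Finset.sum_subtype (Finset.univ.erase i) (by simp) g).symm

/-- The generators of `H_N` satisfy its relations. -/
def dataH (N : ℕ) : CherednikData N (H N) where
  x := xH
  y := yH
  s := permH N
  x_comm := xH_comm
  y_comm := yH_comm
  s_x := permH_conj xH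
    (fun i j h => by have := mkH_rel (Rel.s_x i j h); rwa [map_mul, map_mul] at this)
    (fun i j k h hi hj => by
      have := mkH_rel (Rel.s_x_comm i j k h hi hj); rwa [map_mul, map_mul] at this)
  s_y := permH_conj yH
    (fun i j h => by have := mkH_rel (Rel.s_y i j h); rwa [map_mul, map_mul] at this)
    (fun i j k h hi hj => by
      have := mkH_rel (Rel.s_y_comm i j k h hi hj); rwa [map_mul, map_mul] at this)
  x_y i j h := by
    have := mkH_rel (Rel.x_y i j h)
    rw [map_sub, map_mul, map_mul] at this
    rw [permH_swap N i j h]; exact this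
  x_y_self i := by
    have := mkH_rel (Rel.x_y_self i)
    rw [map_sub, map_mul, map_mul, map_neg, map_sum] at this
    rw [← sum_ne_eq_sum_erase i fun a => permH N (Equiv.swap i a)]
    refine this.trans ?_
    congr 1
    exact Finset.sum_congr rfl fun a _ => (permH_swap N i a a.2.symm).symm

/-- An induction principle: a property of elements of `H_N` that holds for the scalars and the
generators and is stable under sums and products holds everywhere. -/
theorem H_induction {p : H N → Prop} (hc : ∀ c, p (algebraMap ℂ (H N) c)) (hx : ∀ i, p (xH i))
    (hy : ∀ i, p (yH i)) (hs : ∀ σ, p (permH N σ)) (hmul : ∀ a b, p a → p b → p (a * b))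
    (hadd : ∀ a b, p a → p b → p (a + b)) (h : H N) : p h := by
  obtain ⟨a, rfl⟩ : ∃ a, mkH N a = h := RingQuot.mkAlgHom_surjective ℂ (Rel N) h
  induction a using FreeAlgebra.induction with
  | grade0 r => rw [AlgHom.commutes]; exact hc r
  | grade1 g =>
    rcases g with i | i | ⟨i, j, hij⟩
    · exact hx i
    · exact hy i
    · have := hs (Equiv.swap i j)
      rwa [permH_swap N i j hij] at this
  | mul a b ha hb => rw [map_mul]; exact hmul _ _ ha hb
  | add a b ha hb => rw [map_add]; exact hadd _ _ ha hb

/-- The action of the generators on the polynomial representation. -/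
def genAction : Gen N → Module.End ℂ (Mod N)
  | .x i => opX i
  | .y i => opY i
  | .s i j _ => opS (Equiv.swap i j)

theorem genAction_rel {a b : Free N} (h : Rel N a b) :
    FreeAlgebra.lift ℂ (genAction (N := N)) a = FreeAlgebra.lift ℂ genAction b := by
  cases h <;> simp only [map_mul, map_one, map_sub, map_neg, map_sum, fx, fy, fs,
    FreeAlgebra.lift_ι_apply, genAction]
  case s_symm i j h => rw [Equiv.swap_comm]
  case s_sq i j h => rw [← opS_mul, Equiv.swap_mul_self, opS_one]
  case s_braid i j k hij hjk hik =>
    rw [← opS_mul, ← opS_mul, Equiv.mul_swap_eq_swap_mul, Equiv.swap_apply_right,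
      Equiv.swap_apply_of_ne_of_ne hik.symm hjk.symm]
  case s_comm i j k l hij hkl hik hil hjk hjl =>
    rw [← opS_mul, ← opS_mul, Equiv.mul_swap_eq_swap_mul,
      Equiv.swap_apply_of_ne_of_ne hik.symm hjk.symm,
      Equiv.swap_apply_of_ne_of_ne hil.symm hjl.symm]
  case x_comm i j h => exact opX_comm i j
  case y_comm i j h => exact opY_comm i j
  case s_x i j h => rw [opS_opX, Equiv.swap_apply_left]
  case s_y i j h => rw [opS_opY, Equiv.swap_apply_left]
  case s_x_comm i j k h hi hj => rw [opS_opX, Equiv.swap_apply_of_ne_of_ne hi hj]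
  case s_y_comm i j k h hi hj => rw [opS_opY, Equiv.swap_apply_of_ne_of_ne hi hj]
  case x_y i j h => exact opX_opY i j h
  case x_y_self i => exact opX_opY_self i

/-- The polynomial representation of `H_N`. -/
def rho (N : ℕ) : H N →ₐ[ℂ] Module.End ℂ (Mod N) :=
  (RingQuot.liftAlgHom ℂ ⟨FreeAlgebra.lift ℂ genAction, fun _ _ h => genAction_rel h⟩ :
    RingQuot (Rel N) →ₐ[ℂ] Module.End ℂ (Mod N))

theorem rho_mkH (a : Free N) : rho N (mkH N a) = FreeAlgebra.lift ℂ genAction a :=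
  RingQuot.liftAlgHom_mkAlgHom_apply ..

theorem rho_xH (i : Fin N) : rho N (xH i) = opX i := by
  rw [xH, rho_mkH, fx, FreeAlgebra.lift_ι_apply]; rfl

theorem rho_yH (i : Fin N) : rho N (yH i) = opY i := by
  rw [yH, rho_mkH, fy, FreeAlgebra.lift_ι_apply]; rfl

theorem rho_permH (σ : Equiv.Perm (Fin N)) : rho N (permH N σ) = opS σ := by
  induction σ using Equiv.Perm.swap_induction_on with
  | one => rw [map_one, map_one, opS_one]
  | swap_mul σ a b hab ih =>
    rw [map_mul, map_mul, ih, opS_mul, permH_swap N a b hab, sH, rho_mkH, fs,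
      FreeAlgebra.lift_ι_apply]; rfl

/-- The variables `z` act by multiplication, which commutes with `H_N`; under the PBW isomorphism
they become right multiplications. -/
theorem rho_zv_smul (h : H N) (k : Fin N) (f : Mod N) :
    rho N h ((zv k : ZL N) • f) = (zv k : ZL N) • rho N h f := by
  induction h using H_induction generalizing f with
  | hc c => simp [Algebra.algebraMap_eq_smul_one, smul_comm c]
  | hx i => rw [rho_xH, opX_eq_smul, opX_eq_smul, smul_comm]
  | hy i => rw [rho_yH, opY_zv_smul]
  | hs σ =>
    rw [rho_permH]
    funext τ
    simp [opS_apply]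
  | hmul a b ha hb => rw [map_mul, Module.End.mul_apply, hb, ha, Module.End.mul_apply]
  | hadd a b ha hb => rw [map_add, LinearMap.add_apply, ha, hb, LinearMap.add_apply, smul_add]

/-! ### The PBW isomorphism -/

/-- The operators on `H_N` by which the variables act: `z_i` by right multiplication by `y_i`, and
`λ_i` by left multiplication by `x_i`. -/
def thetaGen (N : ℕ) : Fin N ⊕ Fin N → Module.End ℂ (H N) :=
  Sum.elim (fun i => LinearMap.mulRight ℂ (yH i)) (fun i => LinearMap.mulLeft ℂ (xH i))

theorem thetaGen_comm (a b : Fin N ⊕ Fin N) : Commute (thetaGen N a) (thetaGen N b) := by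
  refine LinearMap.ext fun h => ?_
  rcases a with i | i <;> rcases b with j | j <;>
    simp only [thetaGen, Sum.elim_inl, Sum.elim_inr, Module.End.mul_apply,
      LinearMap.mulRight_apply, LinearMap.mulLeft_apply, mul_assoc]
  · rw [(yH_comm i j).eq]
  · rw [← mul_assoc, (xH_comm i j).eq, mul_assoc]

/-- The action of `ℂ[z, λ]` on `H_N` through left multiplication by the `x_i` and right
multiplication by the `y_i`. -/
def theta (N : ℕ) : ZL N →ₐ[ℂ] Module.End ℂ (H N) := evalHom (thetaGen N) thetaGen_comm

theorem theta_zv (i : Fin N) (h : H N) : theta N (zv i) h = h * yH i := by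
  rw [theta, evalHom_X]; rfl

theorem theta_lv (i : Fin N) (h : H N) : theta N (lv i) h = xH i * h := by
  rw [theta, evalHom_X]; rfl

theorem theta_polyLam (q : MvPolynomial (Fin N) ℂ) (h : H N) :
    theta N (polyLam N q) h = evalHom xH xH_comm q * h := by
  have : (theta N).comp (polyLam N) = (Algebra.lmul ℂ (H N)).comp (evalHom xH xH_comm) := by
    refine MvPolynomial.algHom_ext fun i => LinearMap.ext fun h => ?_
    simp [polyLam, theta_lv]
  exact LinearMap.congr_fun (AlgHom.congr_fun this q) h

theorem theta_polyZ (p : MvPolynomial (Fin N) ℂ) (h : H N) :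
    theta N (polyZ N p) h = h * evalHom yH yH_comm p := by
  induction p using MvPolynomial.induction_on generalizing h with
  | C c =>
    rw [← MvPolynomial.algebraMap_eq, AlgHom.commutes, AlgHom.commutes, AlgHom.commutes,
      Algebra.algebraMap_eq_smul_one, Algebra.algebraMap_eq_smul_one]
    simp
  | add p q hp hq => rw [map_add, map_add, LinearMap.add_apply, hp, hq, map_add, mul_add]
  | mul_X p i hp =>
    rw [map_mul, mul_comm, map_mul, Module.End.mul_apply, hp, polyZ, MvPolynomial.rename_X,
      theta_zv, map_mul, evalHom_X, mul_assoc]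

/-- The linear map with `q(λ) p(z) ε_τ ↦ q(x) τ p(y)`. -/
def psi (N : ℕ) : Mod N →ₗ[ℂ] H N where
  toFun f := ∑ τ, theta N (f τ) (permH N τ)
  map_add' f g := by simp [Finset.sum_add_distrib]
  map_smul' c f := by simp [Finset.smul_sum]

theorem psi_apply (f : Mod N) : psi N f = ∑ τ, theta N (f τ) (permH N τ) := rfl

theorem psi_smul (g : ZL N) (f : Mod N) : psi N (g • f) = theta N g (psi N f) := by
  simp [psi_apply]

theorem psi_ev (τ : Equiv.Perm (Fin N)) : psi N (ev τ) = permH N τ := by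
  rw [psi_apply, Finset.sum_eq_single τ]
  · simp
  · intro ρ _ h
    rw [show ev τ ρ = 0 from Pi.single_eq_of_ne h _]; simp
  · simp

theorem psi_zv_smul (i : Fin N) (f : Mod N) : psi N ((zv i : ZL N) • f) = psi N f * yH i := by
  rw [psi_smul, theta_zv]

theorem psi_opX (i : Fin N) (f : Mod N) : psi N (opX i f) = xH i * psi N f := by
  rw [opX_eq_smul, psi_smul, theta_lv]

theorem opS_ev (σ τ : Equiv.Perm (Fin N)) : opS σ (ev τ) = ev (σ * τ) := by
  funext ρ
  rw [opS_apply]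
  by_cases h : ρ = σ * τ
  · rw [h, inv_mul_cancel_left]
    simp
  · rw [show ev (σ * τ) ρ = 0 from Pi.single_eq_of_ne h _,
      show ev τ (σ⁻¹ * ρ) = 0 from Pi.single_eq_of_ne (by rwa [Ne, inv_mul_eq_iff_eq_mul]) _,
      map_zero]

theorem opS_zv_smul (σ : Equiv.Perm (Fin N)) (k : Fin N) (f : Mod N) :
    opS σ ((zv k : ZL N) • f) = (zv k : ZL N) • opS σ f := by
  rw [← rho_permH, rho_zv_smul]

theorem psi_opS (σ : Equiv.Perm (Fin N)) (f : Mod N) : psi N (opS σ f) = permH N σ * psi N f := by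
  have : psi N ∘ₗ opS σ - LinearMap.mulLeft ℂ (permH N σ) ∘ₗ psi N = 0 := by
    refine eq_zero_of_smul_X _ (Sum.elim (fun i h => h * yH i) (fun i h => xH (σ i) * h))
      (by rintro (k | k) <;> simp) ?_ ?_
    · rintro (k | k) f
      · simp only [LinearMap.sub_apply, LinearMap.comp_apply, opS_zv_smul, psi_zv_smul,
          LinearMap.mulLeft_apply, Sum.elim_inl, sub_mul, mul_assoc]
      · have h1 : opS σ (opX k f) = opX (σ k) (opS σ f) :=
          LinearMap.congr_fun (opS_opX σ k) f
        simp only [LinearMap.sub_apply, LinearMap.comp_apply, ← opX_eq_smul, h1, psi_opX,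
          LinearMap.mulLeft_apply, Sum.elim_inr, mul_sub, ← mul_assoc]
        rw [show permH N σ * xH k = xH (σ k) * permH N σ from (dataH N).s_x σ k]
    · intro τ
      simp [psi_ev, opS_ev]
  exact sub_eq_zero.1 (LinearMap.congr_fun this f)

theorem psi_opY (j : Fin N) (f : Mod N) : psi N (opY j f) = yH j * psi N f := by
  have : psi N ∘ₗ opY j - LinearMap.mulLeft ℂ (yH j) ∘ₗ psi N = 0 := by
    refine eq_zero_of_smul_X _ (Sum.elim (fun i h => h * yH i) (fun i h => xH i * h))
      (by rintro (k | k) <;> simp) ?_ ?_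
    · rintro (k | k) f
      · simp only [LinearMap.sub_apply, LinearMap.comp_apply, opY_zv_smul, psi_zv_smul,
          LinearMap.mulLeft_apply, Sum.elim_inl, sub_mul, mul_assoc]
      · have h1 : psi N ((opX k * opY j - opY j * opX k) f) =
            (xH k * yH j - yH j * xH k) * psi N f := by
          by_cases hkj : k = j
          · subst hkj
            rw [opX_opY_self, show xH k * yH k - yH k * xH k = _ from (dataH N).x_y_self k,
              LinearMap.neg_apply, map_neg, neg_mul, LinearMap.sum_apply, map_sum,
              Finset.sum_mul, ← sum_ne_eq_sum_erase k fun a => (dataH N).s (Equiv.swap k a) * _]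
            congr 1
            exact Finset.sum_congr rfl fun a _ => psi_opS _ _
          · rw [opX_opY k j hkj, show xH k * yH j - yH j * xH k = _ from (dataH N).x_y k j hkj]
            exact psi_opS _ _
        simp only [LinearMap.sub_apply, Module.End.mul_apply, map_sub, psi_opX, sub_mul] at h1
        simp only [LinearMap.sub_apply, LinearMap.comp_apply, ← opX_eq_smul, psi_opX,
          LinearMap.mulLeft_apply, Sum.elim_inr, mul_sub]
        rw [sub_eq_sub_iff_sub_eq_sub] at h1
        rw [← mul_assoc, ← mul_assoc, ← neg_inj, neg_sub, neg_sub, ← sub_eq_zero,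
          ← sub_eq_zero.2 h1]
        abel
    · intro τ
      simp only [LinearMap.sub_apply, LinearMap.comp_apply, opY_ev, psi_zv_smul, psi_ev,
        LinearMap.mulLeft_apply]
      rw [show permH N τ * yH (τ⁻¹ j) = yH (τ (τ⁻¹ j)) * permH N τ from (dataH N).s_y _ _]
      simp
  exact sub_eq_zero.1 (LinearMap.congr_fun this f)

/-- The PBW isomorphism turns the polynomial representation into left multiplication. -/
theorem psi_rho (h : H N) (f : Mod N) : psi N (rho N h f) = h * psi N f := by
  induction h using H_induction generalizing f with
  | hc c => simp [Algebra.algebraMap_eq_smul_one]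
  | hx i => rw [rho_xH, psi_opX]
  | hy i => rw [rho_yH, psi_opY]
  | hs σ => rw [rho_permH, psi_opS]
  | hmul a b ha hb => rw [map_mul, Module.End.mul_apply, ha, hb, mul_assoc]
  | hadd a b ha hb => rw [map_add, LinearMap.add_apply, map_add, ha, hb, add_mul]

theorem psi_rho_ev_one (h : H N) : psi N (rho N h (ev 1)) = h := by
  rw [psi_rho, psi_ev, map_one, mul_one]

theorem rho_psi_ev_one (f : Mod N) : rho N (psi N f) (ev 1) = f := by
  have : (LinearMap.applyₗ (ev 1) ∘ₗ (rho N).toLinearMap ∘ₗ psi N) - LinearMap.id = 0 := by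
    refine eq_zero_of_smul_X _ (fun k f => (MvPolynomial.X k : ZL N) • f) (by simp) ?_ ?_
    · rintro (k | k) f
      · simp only [LinearMap.sub_apply, LinearMap.comp_apply, psi_zv_smul, AlgHom.toLinearMap_apply,
          map_mul, rho_yH, LinearMap.applyₗ_apply_apply, Module.End.mul_apply, opY_ev, rho_zv_smul,
          LinearMap.id_apply, smul_sub]
        simp
      · simp only [LinearMap.sub_apply, LinearMap.comp_apply, ← opX_eq_smul, psi_opX,
          AlgHom.toLinearMap_apply, map_mul, rho_xH, LinearMap.applyₗ_apply_apply,
          Module.End.mul_apply, LinearMap.id_apply, map_sub]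
    · intro τ
      simp only [LinearMap.sub_apply, LinearMap.comp_apply, psi_ev, AlgHom.toLinearMap_apply,
        rho_permH, LinearMap.applyₗ_apply_apply, opS_ev, LinearMap.id_apply, mul_one, sub_self]
  exact sub_eq_zero.1 (LinearMap.congr_fun this f)

/-- The PBW theorem for `H_N`: the elements `q(x) τ p(y)` identify `H_N` with
`⨁_τ ℂ[z, λ] ε_τ`. -/
def psiEquiv (N : ℕ) : Mod N ≃ₗ[ℂ] H N where
  __ := psi N
  invFun h := rho N h (ev 1)
  left_inv := rho_psi_ev_one
  right_inv := psi_rho_ev_one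

theorem psi_injective : Function.Injective (psi N) := (psiEquiv N).injective

/-! ### A central element built from the Cherednik relations -/

namespace CherednikData

variable {A : Type*} [Ring A] [Algebra ℂ A] (D : CherednikData N A)

/-- The product of the `x_i` over a set of indices. -/
def prodX (I : Finset (Fin N)) : A := evalHom D.x D.x_comm (∏ i ∈ I, MvPolynomial.X i)

/-- The product of the `y_i` over a set of indices. -/
def prodY (I : Finset (Fin N)) : A := evalHom D.y D.y_comm (∏ i ∈ I, MvPolynomial.X i)

theorem prodX_insert {i : Fin N} {I : Finset (Fin N)} (h : i ∉ I) :
    D.prodX (insert i I) = D.x i * D.prodX I := by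
  rw [prodX, Finset.prod_insert h, map_mul, evalHom_X, prodX]

theorem prodX_insert' {i : Fin N} {I : Finset (Fin N)} (h : i ∉ I) :
    D.prodX (insert i I) = D.prodX I * D.x i := by
  rw [prodX, Finset.prod_insert h, mul_comm, map_mul, evalHom_X, prodX]

theorem prodY_insert {i : Fin N} {I : Finset (Fin N)} (h : i ∉ I) :
    D.prodY (insert i I) = D.y i * D.prodY I := by
  rw [prodY, Finset.prod_insert h, map_mul, evalHom_X, prodY]

theorem prodY_insert' {i : Fin N} {I : Finset (Fin N)} (h : i ∉ I) :
    D.prodY (insert i I) = D.prodY I * D.y i := by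
  rw [prodY, Finset.prod_insert h, mul_comm, map_mul, evalHom_X, prodY]

@[simp] theorem prodX_empty : D.prodX ∅ = 1 := by simp [prodX]

@[simp] theorem prodY_empty : D.prodY ∅ = 1 := by simp [prodY]

theorem s_prodX (σ : Equiv.Perm (Fin N)) (I : Finset (Fin N)) :
    D.s σ * D.prodX I = D.prodX (I.map σ.toEmbedding) * D.s σ := by
  induction I using Finset.induction_on with
  | empty => simp
  | insert i I hi ih =>
    rw [prodX_insert _ hi, ← mul_assoc, s_x, mul_assoc, ih, Finset.map_insert, prodX_insert,
      mul_assoc]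
    · rfl
    · simpa using hi

theorem s_prodY (σ : Equiv.Perm (Fin N)) (I : Finset (Fin N)) :
    D.s σ * D.prodY I = D.prodY (I.map σ.toEmbedding) * D.s σ := by
  induction I using Finset.induction_on with
  | empty => simp
  | insert i I hi ih =>
    rw [prodY_insert _ hi, ← mul_assoc, s_y, mul_assoc, ih, Finset.map_insert, prodY_insert,
      mul_assoc]
    · rfl
    · simpa using hi

theorem s_prodX_of_fix {σ : Equiv.Perm (Fin N)} {I : Finset (Fin N)} (h : ∀ i ∈ I, σ i = i) :
    D.s σ * D.prodX I = D.prodX I * D.s σ := by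
  rw [s_prodX]
  congr 2
  rw [Finset.map_eq_image]
  exact (Finset.image_congr h).trans Finset.image_id

theorem s_prodY_of_fix {σ : Equiv.Perm (Fin N)} {I : Finset (Fin N)} (h : ∀ i ∈ I, σ i = i) :
    D.s σ * D.prodY I = D.prodY I * D.s σ := by
  rw [s_prodY]
  congr 2
  rw [Finset.map_eq_image]
  exact (Finset.image_congr h).trans Finset.image_id

theorem swap_fix {i k : Fin N} {I : Finset (Fin N)} (hi : i ∉ I) (hk : k ∉ I) :
    ∀ a ∈ I, Equiv.swap i k a = a := fun _ ha =>
  Equiv.swap_apply_of_ne_of_ne (fun e => hi (e ▸ ha)) (fun e => hk (e ▸ ha))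

/-- The commutator of `∏_{i ∈ I} y_i` with `x_k` for `k ∉ I`. -/
theorem prodY_mul_x_of_notMem {I : Finset (Fin N)} {k : Fin N} (hk : k ∉ I) :
    D.prodY I * D.x k =
      D.x k * D.prodY I - ∑ i ∈ I, D.prodY (I.erase i) * D.s (Equiv.swap i k) := by
  induction I using Finset.induction_on with
  | empty => simp
  | insert i I hi ih =>
    rw [Finset.mem_insert, not_or] at hk
    have h1 : D.y i * D.x k = D.x k * D.y i - D.s (Equiv.swap i k) := by
      rw [Equiv.swap_comm, ← D.x_y k i hk.1]; abel
    rw [prodY_insert _ hi, mul_assoc, ih hk.2, mul_sub, ← mul_assoc, h1, sub_mul,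
      s_prodY_of_fix _ (swap_fix hi hk.2), Finset.sum_insert hi, Finset.erase_insert hi, sub_sub,
      mul_assoc, Finset.mul_sum]
    congr 2
    refine Finset.sum_congr rfl fun a ha => ?_
    have hai : a ≠ i := fun e => hi (e ▸ ha)
    rw [Finset.erase_insert_of_ne hai.symm, prodY_insert _
      (fun h => hi (Finset.mem_of_mem_erase h)), mul_assoc]

/-- The commutator of `∏_{i ∈ I} y_i` with `x_k` for `k ∈ I`. -/
theorem prodY_mul_x_of_mem {I : Finset (Fin N)} {k : Fin N} (hk : k ∈ I) :
    D.prodY I * D.x k =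
      D.x k * D.prodY I + ∑ a ∈ Iᶜ, D.prodY (I.erase k) * D.s (Equiv.swap k a) := by
  obtain ⟨J, hJ, rfl⟩ : ∃ J, k ∉ J ∧ insert k J = I :=
    ⟨I.erase k, Finset.notMem_erase k I, Finset.insert_erase hk⟩
  have h1 : D.y k * D.x k = D.x k * D.y k + ∑ a ∈ Finset.univ.erase k, D.s (Equiv.swap k a) := by
    rw [← neg_neg (∑ a ∈ Finset.univ.erase k, D.s (Equiv.swap k a)), ← D.x_y_self k]; abel
  have h2 : Finset.univ.erase k = J ∪ (insert k J)ᶜ := by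
    ext a
    by_cases hak : a = k
    · subst hak; simp [hJ]
    · simp [hak, em]
  have h3 : Disjoint J (insert k J)ᶜ :=
    Finset.disjoint_left.2 fun a ha h => by simp [ha] at h
  rw [prodY_insert _ hJ, mul_assoc, prodY_mul_x_of_notMem _ hJ, mul_sub, ← mul_assoc, h1, add_mul,
    h2, Finset.sum_union h3, add_mul, Finset.erase_insert hJ, Finset.sum_mul, Finset.sum_mul,
    Finset.mul_sum, mul_assoc]
  rw [Finset.sum_congr (s₁ := J) (g := fun i => D.y k * (D.prodY (J.erase i) *
    D.s (Equiv.swap i k))) rfl, Finset.sum_congr (s₁ := (insert k J)ᶜ)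
    (g := fun a => D.prodY J * D.s (Equiv.swap k a)) rfl]
  · abel
  · intro a ha
    rw [Finset.mem_compl, Finset.mem_insert, not_or] at ha
    exact D.s_prodY_of_fix (swap_fix hJ ha.2)
  · intro a ha
    have hak : a ≠ k := fun e => hJ (e ▸ ha)
    conv_lhs => rw [← Finset.insert_erase ha]
    rw [prodY_insert _ (Finset.notMem_erase a J), ← mul_assoc, s_y, Equiv.swap_apply_right,
      mul_assoc, s_prodY_of_fix _ (swap_fix (fun h => hJ (Finset.mem_of_mem_erase h))
        (Finset.notMem_erase a J)), Equiv.swap_comm]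

/-- The pairs of a permutation and a set of its fixed points. -/
def fixPairs (N : ℕ) : Finset (Finset (Fin N) × Equiv.Perm (Fin N)) :=
  Finset.univ.filter fun p => ∀ i ∈ p.1, p.2 i = i

/-- The sign `(-1)^{|I|} (-1)^σ`. -/
def pairSign (p : Finset (Fin N) × Equiv.Perm (Fin N)) : ℤ :=
  (-1) ^ p.1.card * ((Equiv.Perm.sign p.2 : ℤˣ) : ℤ)

/-- The element `∑_σ ∑_I (-1)^{|I|} (-1)^σ (∏_{i ∈ I} x_i) (∏_{i ∈ I} y_i) σ`, where `I` runs over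
the sets of fixed points of `σ`. -/
def central : A := ∑ p ∈ fixPairs N, pairSign p • (D.prodX p.1 * D.prodY p.1 * D.s p.2)

theorem mem_fixPairs {p : Finset (Fin N) × Equiv.Perm (Fin N)} :
    p ∈ fixPairs N ↔ ∀ i ∈ p.1, p.2 i = i := by simp [fixPairs]

theorem pairSign_insert_swap {I : Finset (Fin N)} {σ : Equiv.Perm (Fin N)} {i j k : Fin N}
    (hi : i ∉ I) (hjk : j ≠ k) :
    pairSign (insert i I, Equiv.swap j k * σ) = pairSign (I, σ) := by
  simp [pairSign, Finset.card_insert_of_notMem hi, Equiv.Perm.sign_swap hjk, pow_succ]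

/-- The pairs in `fixPairs` whose permutation moves `j`. -/
def movPairs (j : Fin N) : Finset (Finset (Fin N) × Equiv.Perm (Fin N)) :=
  (fixPairs N).filter fun p => p.2 j ≠ j

theorem notMem_of_mem_movPairs {j : Fin N} {p : Finset (Fin N) × Equiv.Perm (Fin N)}
    (h : p ∈ movPairs j) : j ∉ p.1 ∧ p.2 j ∉ p.1 := by
  rw [movPairs, Finset.mem_filter, mem_fixPairs] at h
  exact ⟨fun hj => h.2 (h.1 j hj), fun hj => h.2 (p.2.injective (h.1 _ hj))⟩

/-- The contributions of the commutators with `j ∈ I`, reindexed by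
`(I, σ, a) ↦ (I \ {j}, (j a) σ)`. -/
theorem sum_fixPairs_mem (j : Fin N) :
    ∑ p ∈ fixPairs N with j ∈ p.1, ∑ a ∈ p.1ᶜ,
      pairSign p • (D.prodX p.1 * (D.prodY (p.1.erase j) * D.s (Equiv.swap j a)) * D.s p.2) =
    ∑ p ∈ movPairs j, pairSign p • (D.prodX p.1 * D.x j * D.prodY p.1 * D.s p.2) := by
  rw [Finset.sum_sigma']
  refine Finset.sum_nbij' (fun q => (q.1.1.erase j, Equiv.swap j q.2 * q.1.2))
    (fun p => ⟨(insert j p.1, Equiv.swap j (p.2 j) * p.2), p.2 j⟩) ?_ ?_ ?_ ?_ ?_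
  · rintro ⟨⟨I, σ⟩, a⟩ h
    simp only [Finset.mem_sigma, Finset.mem_filter, mem_fixPairs, Finset.mem_compl] at h
    simp only [movPairs, Finset.mem_filter, mem_fixPairs, Finset.mem_erase, Equiv.Perm.mul_apply]
    obtain ⟨⟨h1, h2⟩, h3⟩ := h
    refine ⟨fun i hi => ?_, ?_⟩
    · rw [h1 i hi.2, Equiv.swap_apply_of_ne_of_ne hi.1 (fun e => h3 (by rw [← e]; exact hi.2))]
    · rw [h1 j h2, Equiv.swap_apply_left]
      exact fun e => h3 (e ▸ h2)
  · rintro ⟨I, σ⟩ h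
    have h' := notMem_of_mem_movPairs h
    rw [movPairs, Finset.mem_filter, mem_fixPairs] at h
    simp only [Finset.mem_sigma, Finset.mem_filter, mem_fixPairs, Finset.mem_compl,
      Finset.mem_insert, not_or, Equiv.Perm.mul_apply, true_or, and_true]
    refine ⟨?_, h.2, h'.2⟩
    rintro i (rfl | hi)
    · rw [Equiv.swap_apply_right]
    · rw [h.1 i hi, swap_fix h'.1 h'.2 i hi]
  · rintro ⟨⟨I, σ⟩, a⟩ h
    simp only [Finset.mem_sigma, Finset.mem_filter, mem_fixPairs, Finset.mem_compl] at h
    have e : (Equiv.swap j a * σ) j = a := by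
      rw [Equiv.Perm.mul_apply, h.1.1 j h.1.2, Equiv.swap_apply_left]
    simp only [e, Finset.insert_erase h.1.2, ← mul_assoc, Equiv.swap_mul_self, one_mul]
  · rintro ⟨I, σ⟩ h
    have h' := notMem_of_mem_movPairs h
    simp only [Finset.erase_insert h'.1, ← mul_assoc, Equiv.swap_mul_self, one_mul]
  · rintro ⟨⟨I, σ⟩, a⟩ h
    simp only [Finset.mem_sigma, Finset.mem_filter, mem_fixPairs, Finset.mem_compl] at h
    obtain ⟨⟨h1, h2⟩, h3⟩ := h
    have hja : j ≠ a := fun e => h3 (e ▸ h2)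
    have hs : pairSign (I, σ) = pairSign (I.erase j, Equiv.swap j a * σ) := by
      rw [← pairSign_insert_swap (Finset.notMem_erase j I) hja, Finset.insert_erase h2, ← mul_assoc,
        Equiv.swap_mul_self, one_mul]
    change pairSign (I, σ) • _ = pairSign _ • _
    rw [hs, ← prodX_insert' _ (Finset.notMem_erase j I), Finset.insert_erase h2, map_mul]
    simp only [mul_assoc]

/-- The contributions of the commutators with `j ∉ I`, reindexed by
`(I, σ, i) ↦ (I \ {i}, (i σ(j)) σ)`. -/
theorem sum_fixPairs_notMem (j : Fin N) :
    ∑ p ∈ fixPairs N with j ∉ p.1, ∑ i ∈ p.1,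
      pairSign p • (D.prodX p.1 * (D.prodY (p.1.erase i) * D.s (Equiv.swap i (p.2 j))) * D.s p.2) =
    ∑ p ∈ movPairs j, pairSign p • (D.prodX p.1 * D.x (p.2 j) * D.prodY p.1 * D.s p.2) := by
  rw [Finset.sum_sigma']
  refine Finset.sum_nbij' (fun q => (q.1.1.erase q.2, Equiv.swap q.2 (q.1.2 j) * q.1.2))
    (fun p => ⟨(insert (p.2 j) p.1, Equiv.swap (p.2 j) (p.2 (p.2 j)) * p.2), p.2 j⟩)
    ?_ ?_ ?_ ?_ ?_
  · rintro ⟨⟨I, σ⟩, a⟩ h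
    simp only [Finset.mem_sigma, Finset.mem_filter, mem_fixPairs] at h
    simp only [movPairs, Finset.mem_filter, mem_fixPairs, Finset.mem_erase, Equiv.Perm.mul_apply]
    obtain ⟨⟨h1, h2⟩, h3⟩ := h
    refine ⟨fun i hi => ?_, ?_⟩
    · rw [h1 i hi.2, Equiv.swap_apply_of_ne_of_ne hi.1]
      exact fun e => h2 (σ.injective ((h1 i hi.2).trans e) ▸ hi.2)
    · rw [Equiv.swap_apply_right]
      exact fun e => h2 (e ▸ h3)
  · rintro ⟨I, σ⟩ h
    have h' := notMem_of_mem_movPairs h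
    rw [movPairs, Finset.mem_filter, mem_fixPairs] at h
    simp only [Finset.mem_sigma, Finset.mem_filter, mem_fixPairs,
      Finset.mem_insert, not_or, Equiv.Perm.mul_apply, true_or, and_true]
    refine ⟨?_, fun e => h.2 e.symm, h'.1⟩
    rintro i (rfl | hi)
    · rw [Equiv.swap_apply_right]
    · rw [h.1 i hi, Equiv.swap_apply_of_ne_of_ne]
      · exact fun e => h'.2 (e ▸ hi)
      · intro e
        exact h'.2 (σ.injective ((h.1 i hi).trans e) ▸ hi)
  · rintro ⟨⟨I, σ⟩, a⟩ h
    simp only [Finset.mem_sigma, Finset.mem_filter, mem_fixPairs] at h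
    have e : (Equiv.swap a (σ j) * σ) j = a := by
      rw [Equiv.Perm.mul_apply, Equiv.swap_apply_right]
    have e2 : (Equiv.swap a (σ j) * σ) a = σ j := by
      rw [Equiv.Perm.mul_apply, h.1.1 a h.2, Equiv.swap_apply_left]
    simp only [e, e2, Finset.insert_erase h.2, ← mul_assoc, Equiv.swap_mul_self, one_mul]
  · rintro ⟨I, σ⟩ h
    have h' := notMem_of_mem_movPairs h
    simp only [Finset.erase_insert h'.2, ← mul_assoc, Equiv.Perm.mul_apply, Equiv.swap_apply_left,
      Equiv.swap_mul_self, one_mul]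
  · rintro ⟨⟨I, σ⟩, a⟩ h
    simp only [Finset.mem_sigma, Finset.mem_filter, mem_fixPairs] at h
    obtain ⟨⟨h1, h2⟩, h3⟩ := h
    have hja : a ≠ σ j := fun e => h2 (σ.injective ((h1 a h3).trans e) ▸ h3)
    have hs : pairSign (I, σ) = pairSign (I.erase a, Equiv.swap a (σ j) * σ) := by
      rw [← pairSign_insert_swap (Finset.notMem_erase a I) hja, Finset.insert_erase h3, ← mul_assoc,
        Equiv.swap_mul_self, one_mul]
    change pairSign (I, σ) • _ = pairSign _ • _
    rw [hs, Equiv.Perm.mul_apply, Equiv.swap_apply_right,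
      ← prodX_insert' _ (Finset.notMem_erase a I), Finset.insert_erase h3, map_mul]
    simp only [mul_assoc]

/-- The commutator with `x_j` is computed termwise. The contributions of `[y_i, x_j]` shift a
point out of `I` while multiplying `σ` by a transposition; they cancel against the terms that
arise from moving `x_j` across `σ`. -/
theorem central_comm_x (j : Fin N) : Commute D.central (D.x j) := by
  have hx : ∀ i (I : Finset (Fin N)), D.x i * D.prodX I = D.prodX I * D.x i := by
    intro i I
    have := congrArg (evalHom D.x D.x_comm)
      (mul_comm (MvPolynomial.X i) (∏ i ∈ I, MvPolynomial.X i))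
    rwa [map_mul, map_mul, evalHom_X] at this
  rw [Commute, SemiconjBy, ← sub_eq_zero, central, Finset.sum_mul, Finset.mul_sum,
    ← Finset.sum_sub_distrib]
  have key : ∀ p ∈ fixPairs N,
      pairSign p • (D.prodX p.1 * D.prodY p.1 * D.s p.2) * D.x j -
        D.x j * pairSign p • (D.prodX p.1 * D.prodY p.1 * D.s p.2) =
      ((if p.2 j ≠ j then pairSign p • (D.prodX p.1 * D.x (p.2 j) * D.prodY p.1 * D.s p.2) else 0) -
        (if p.2 j ≠ j then pairSign p • (D.prodX p.1 * D.x j * D.prodY p.1 * D.s p.2) else 0)) +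
      ((if j ∈ p.1 then ∑ a ∈ p.1ᶜ,
          pairSign p • (D.prodX p.1 * (D.prodY (p.1.erase j) * D.s (Equiv.swap j a)) * D.s p.2)
          else 0) -
        if j ∉ p.1 then ∑ i ∈ p.1, pairSign p •
          (D.prodX p.1 * (D.prodY (p.1.erase i) * D.s (Equiv.swap i (p.2 j))) * D.s p.2)
          else 0) := by
    rintro ⟨I, σ⟩ hp
    rw [mem_fixPairs] at hp
    dsimp only at hp ⊢
    rw [smul_mul_assoc, mul_smul_comm, ← smul_sub, mul_assoc _ (D.s σ), s_x,
      ← mul_assoc _ (D.x (σ j)), mul_assoc (D.prodX I)]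
    have h0 : D.x j * (D.prodX I * D.prodY I * D.s σ) = D.prodX I * D.x j * D.prodY I * D.s σ := by
      simp only [← mul_assoc, hx]
    by_cases hj : j ∈ I
    · have hσ := hp j hj
      rw [if_neg (not_not.2 hσ), if_neg (not_not.2 hσ), if_pos hj, if_neg (not_not.2 hj), hσ, h0,
        prodY_mul_x_of_mem _ hj, ← Finset.smul_sum, ← Finset.sum_mul, ← Finset.mul_sum,
        ← Finset.mul_sum]
      simp only [mul_add, add_mul, mul_assoc, add_sub_cancel_left, sub_zero, zero_add, sub_self,
        Finset.mul_sum, Finset.sum_mul]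
    · have hσj : σ j ∉ I := fun h => hj (σ.injective (hp _ h) ▸ h)
      rw [if_neg hj, if_pos hj, h0, prodY_mul_x_of_notMem _ hσj, ← Finset.smul_sum,
        ← Finset.sum_mul, ← Finset.mul_sum]
      by_cases h : σ j = j
      · rw [if_neg (not_not.2 h), if_neg (not_not.2 h), h, sub_self, zero_add, zero_sub, ← smul_neg]
        congr 1
        simp only [mul_sub, sub_mul, mul_assoc]
        abel
      · rw [if_pos h, if_pos h, ← smul_sub, zero_sub, ← sub_eq_add_neg, ← smul_sub]
        congr 1
        simp only [mul_sub, sub_mul, mul_assoc]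
        abel
  rw [Finset.sum_congr rfl key, Finset.sum_add_distrib, Finset.sum_sub_distrib,
    Finset.sum_sub_distrib, ← Finset.sum_filter, ← Finset.sum_filter, ← Finset.sum_filter,
    ← Finset.sum_filter, sum_fixPairs_mem, sum_fixPairs_notMem]
  simp only [movPairs]
  abel

theorem central_comm_s (τ : Equiv.Perm (Fin N)) : Commute (D.s τ) D.central := by
  rw [Commute, SemiconjBy, central, Finset.mul_sum, Finset.sum_mul]
  refine Finset.sum_nbij' (fun p => (p.1.map τ.toEmbedding, τ * p.2 * τ⁻¹))
    (fun p => (p.1.map τ⁻¹.toEmbedding, τ⁻¹ * p.2 * τ)) ?_ ?_ ?_ ?_ ?_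
  · rintro ⟨I, σ⟩ h
    rw [mem_fixPairs] at h ⊢
    intro i hi
    obtain ⟨a, ha, rfl⟩ := Finset.mem_map.1 hi
    simp [h a ha]
  · rintro ⟨I, σ⟩ h
    rw [mem_fixPairs] at h ⊢
    intro i hi
    obtain ⟨a, ha, rfl⟩ := Finset.mem_map.1 hi
    simp [h a ha]
  · rintro ⟨I, σ⟩ _
    refine Prod.ext ?_ ?_
    · dsimp only
      rw [Finset.map_map]
      conv_rhs => rw [← Finset.map_refl (s := I)]
      congr 1
      ext a
      simp
    · simp [mul_assoc]
  · rintro ⟨I, σ⟩ _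
    refine Prod.ext ?_ ?_
    · dsimp only
      rw [Finset.map_map]
      conv_rhs => rw [← Finset.map_refl (s := I)]
      congr 1
      ext a
      simp
    · simp [mul_assoc]
  · rintro ⟨I, σ⟩ _
    have hs : pairSign (I.map τ.toEmbedding, τ * σ * τ⁻¹) = pairSign (I, σ) := by
      rw [pairSign, pairSign, Finset.card_map, Equiv.Perm.sign_mul, Equiv.Perm.sign_mul,
        Equiv.Perm.sign_inv, mul_right_comm, Int.units_mul_self, one_mul]
    rw [hs, mul_smul_comm, smul_mul_assoc]
    congr 1
    rw [← mul_assoc, ← mul_assoc, s_prodX, mul_assoc _ (D.s τ), s_prodY, mul_assoc _ (D.s _),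
      ← map_mul, inv_mul_cancel_right, map_mul]
    simp only [mul_assoc]

/-- The relations are stable under exchanging `x` with `y` and reversing products. -/
def op : CherednikData N Aᵐᵒᵖ where
  x i := MulOpposite.op (D.y i)
  y i := MulOpposite.op (D.x i)
  s :=
    { toFun := fun σ => MulOpposite.op (D.s σ⁻¹)
      map_one' := by simp
      map_mul' := fun σ τ => by rw [mul_inv_rev, map_mul, MulOpposite.op_mul] }
  x_comm i j := (D.y_comm i j).op
  y_comm i j := (D.x_comm i j).op
  s_x σ i := by
    change MulOpposite.op (D.s σ⁻¹) * MulOpposite.op (D.y i) =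
      MulOpposite.op (D.y (σ i)) * MulOpposite.op (D.s σ⁻¹)
    rw [← MulOpposite.op_mul, ← MulOpposite.op_mul, s_y, Equiv.Perm.inv_def, Equiv.symm_apply_apply]
  s_y σ i := by
    change MulOpposite.op (D.s σ⁻¹) * MulOpposite.op (D.x i) =
      MulOpposite.op (D.x (σ i)) * MulOpposite.op (D.s σ⁻¹)
    rw [← MulOpposite.op_mul, ← MulOpposite.op_mul, s_x, Equiv.Perm.inv_def, Equiv.symm_apply_apply]
  x_y i j h := by
    change _ = MulOpposite.op (D.s (Equiv.swap i j)⁻¹)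
    rw [← MulOpposite.op_mul, ← MulOpposite.op_mul, ← MulOpposite.op_sub, D.x_y j i h.symm,
      Equiv.swap_inv, Equiv.swap_comm]
  x_y_self i := by
    change _ = -∑ a ∈ Finset.univ.erase i, MulOpposite.op (D.s (Equiv.swap i a)⁻¹)
    rw [← MulOpposite.op_mul, ← MulOpposite.op_mul, ← MulOpposite.op_sub, D.x_y_self,
      MulOpposite.op_neg, Finset.op_sum]
    simp only [Equiv.swap_inv]

theorem op_prodX (I : Finset (Fin N)) : D.op.prodX I = MulOpposite.op (D.prodY I) := by
  induction I using Finset.induction_on with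
  | empty => simp
  | insert i I hi ih =>
    rw [prodX_insert _ hi, prodY_insert' _ hi, ih, MulOpposite.op_mul]; rfl

theorem op_prodY (I : Finset (Fin N)) : D.op.prodY I = MulOpposite.op (D.prodX I) := by
  induction I using Finset.induction_on with
  | empty => simp
  | insert i I hi ih =>
    rw [prodY_insert _ hi, prodX_insert' _ hi, ih, MulOpposite.op_mul]; rfl

/-- The antiautomorphism that exchanges `x` and `y` fixes the element `central`, by inversion of
the permutations in the sum. -/
theorem op_central : D.op.central = MulOpposite.op D.central := by
  rw [central, central, Finset.op_sum]
  refine Finset.sum_nbij' (fun p => (p.1, p.2⁻¹)) (fun p => (p.1, p.2⁻¹)) ?_ ?_ ?_ ?_ ?_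
  · rintro ⟨I, σ⟩ h
    rw [mem_fixPairs] at h ⊢
    exact fun i hi => Equiv.Perm.inv_eq_iff_eq.2 (h i hi).symm
  · rintro ⟨I, σ⟩ h
    rw [mem_fixPairs] at h ⊢
    exact fun i hi => Equiv.Perm.inv_eq_iff_eq.2 (h i hi).symm
  · rintro ⟨I, σ⟩ _; simp
  · rintro ⟨I, σ⟩ _; simp
  · rintro ⟨I, σ⟩ h
    rw [mem_fixPairs] at h
    have h' : ∀ i ∈ I, σ⁻¹ i = i := fun i hi => Equiv.Perm.inv_eq_iff_eq.2 (h i hi).symm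
    have hs : pairSign (I, σ⁻¹) = pairSign (I, σ) := by simp [pairSign]
    rw [hs, MulOpposite.op_smul, op_prodX, op_prodY]
    congr 1
    change _ * _ * MulOpposite.op (D.s σ⁻¹) = _
    rw [← MulOpposite.op_mul, ← MulOpposite.op_mul, ← mul_assoc, s_prodX_of_fix _ h', mul_assoc,
      s_prodY_of_fix _ h', ← mul_assoc]

theorem central_comm_y (j : Fin N) : Commute D.central (D.y j) := by
  have h : Commute D.op.central (MulOpposite.op (D.y j)) := D.op.central_comm_x j
  rw [op_central] at h
  exact h.unop

/-- The relations are stable under replacing `x_i` by `v - x_i` and `y_i` by `u - y_i` for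
commuting elements `u`, `v` that commute with the image of `A`. -/
def shift {B : Type*} [Ring B] [Algebra ℂ B] (c : A →+* B) (u v : B) (hu : ∀ a, Commute u (c a))
    (hv : ∀ a, Commute v (c a)) (huv : Commute u v) : CherednikData N B where
  x i := v - c (D.x i)
  y i := u - c (D.y i)
  s := (c : A →* B).comp D.s
  x_comm i j := (((Commute.refl v).sub_right (hv _))).sub_left
    ((hv _).symm.sub_right ((D.x_comm i j).map c))
  y_comm i j := (((Commute.refl u).sub_right (hu _))).sub_left
    ((hu _).symm.sub_right ((D.y_comm i j).map c))
  s_x σ i := by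
    change c (D.s σ) * _ = _ * c (D.s σ)
    rw [mul_sub, sub_mul, ← map_mul, s_x, map_mul, (hv _).eq]
  s_y σ i := by
    change c (D.s σ) * _ = _ * c (D.s σ)
    rw [mul_sub, sub_mul, ← map_mul, s_y, map_mul, (hu _).eq]
  x_y i j h := by
    change _ = c (D.s _)
    rw [← D.x_y i j h]
    simp only [sub_mul, mul_sub, map_sub, map_mul, (hu _).eq, (hv _).eq, huv.eq]
    abel
  x_y_self i := by
    change _ = -∑ a ∈ Finset.univ.erase i, c (D.s (Equiv.swap i a))
    rw [← map_sum, ← map_neg, ← D.x_y_self i]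
    simp only [sub_mul, mul_sub, map_sub, map_mul, (hu _).eq, (hv _).eq, huv.eq]
    abel

end CherednikData

/-- The elements `v - x_i`, `u - y_i` of `H_N[u, v]`, which satisfy the same relations as
`x_i`, `y_i`. -/
def dataUV (N : ℕ) : CherednikData N (Polynomial (Polynomial (H N))) :=
  (dataH N).shift (Polynomial.C.comp Polynomial.C) (Polynomial.C Polynomial.X) Polynomial.X
    (fun a => (Polynomial.commute_X (Polynomial.C a)).map Polynomial.C)
    (fun _ => Polynomial.commute_X _) (Polynomial.commute_X _).symm

/-! ### Normal ordering and the universal central polynomial -/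

theorem evalHom_prod_pow {A : Type*} [Ring A] [Algebra ℂ A] (a : Fin N → A)
    (h : ∀ i j, Commute (a i) (a j)) (m : Fin N → ℕ) :
    evalHom a h (∏ i, MvPolynomial.X i ^ m i) = (List.ofFn fun i => a i ^ m i).prod := by
  rw [← List.prod_ofFn, map_list_prod, List.map_ofFn]
  congr 2
  funext i
  simp

theorem normalOrder_eq (r : MvPolynomial (Fin N ⊕ Fin N) ℂ) :
    normalOrder N r = theta N (MvPolynomial.rename Sum.swap r) 1 := by
  have : normalOrder N = LinearMap.applyₗ (1 : H N) ∘ₗ (theta N).toLinearMap ∘ₗ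
      (MvPolynomial.rename Sum.swap).toLinearMap := by
    refine (MvPolynomial.basisMonomials (Fin N ⊕ Fin N) ℂ).ext fun m => ?_
    rw [normalOrder, Module.Basis.constr_basis, MvPolynomial.coe_basisMonomials]
    simp only [LinearMap.comp_apply, AlgHom.toLinearMap_apply, LinearMap.applyₗ_apply_apply]
    have h : MvPolynomial.rename Sum.swap (MvPolynomial.monomial m (1 : ℂ)) =
        polyLam N (∏ i, MvPolynomial.X i ^ m (Sum.inl i)) *
          polyZ N (∏ i, MvPolynomial.X i ^ m (Sum.inr i)) := by
      rw [MvPolynomial.monomial_eq, Finsupp.prod_fintype _ _ (by simp), map_one, one_mul,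
        Fintype.prod_sum_type]
      simp [polyLam, polyZ]
    rw [h, map_mul, Module.End.mul_apply, theta_polyZ, one_mul, theta_polyLam, evalHom_prod_pow,
      evalHom_prod_pow]
  rw [this]; rfl

theorem normalOrder_one : normalOrder N 1 = 1 := by simp [normalOrder_eq]

theorem normalOrder_X_inl_mul (i : Fin N) (r : MvPolynomial (Fin N ⊕ Fin N) ℂ) :
    normalOrder N (MvPolynomial.X (Sum.inl i) * r) = xH i * normalOrder N r := by
  rw [normalOrder_eq, normalOrder_eq, map_mul, map_mul, MvPolynomial.rename_X,
    Module.End.mul_apply]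
  exact theta_lv _ _

theorem normalOrder_X_inr_mul (i : Fin N) (r : MvPolynomial (Fin N ⊕ Fin N) ℂ) :
    normalOrder N (MvPolynomial.X (Sum.inr i) * r) = normalOrder N r * yH i := by
  rw [normalOrder_eq, normalOrder_eq, map_mul, map_mul, MvPolynomial.rename_X,
    Module.End.mul_apply]
  exact theta_zv _ _

/-- Normally ordered elements followed by a permutation `ρ`, in terms of the action of `ℂ[z, λ]`
on `H_N`: moving `y_i` across `ρ` turns it into `y_{ρ⁻¹(i)}`. -/
theorem normalOrder_mul_permH (r : MvPolynomial (Fin N ⊕ Fin N) ℂ) (ρ : Equiv.Perm (Fin N)) :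
    normalOrder N r * permH N ρ =
      theta N (MvPolynomial.aeval (Sum.elim lv fun i => zv (ρ⁻¹ i)) r) (permH N ρ) := by
  have h : ∀ (r : MvPolynomial (Fin N ⊕ Fin N) ℂ) (a : H N),
      theta N (MvPolynomial.rename Sum.swap r) a * permH N ρ =
        theta N (MvPolynomial.aeval (Sum.elim lv fun i => zv (ρ⁻¹ i)) r) (a * permH N ρ) := by
    intro r
    induction r using MvPolynomial.induction_on with
    | C c =>
      intro a
      rw [← MvPolynomial.algebraMap_eq, AlgHom.commutes, AlgHom.commutes, AlgHom.commutes,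
        AlgHom.commutes, Algebra.algebraMap_eq_smul_one]
      simp
    | add p q hp hq => intro a; simp [add_mul, hp, hq]
    | mul_X p k hp =>
      intro a
      rw [map_mul (MvPolynomial.rename _), map_mul (theta N), map_mul (MvPolynomial.aeval _),
        map_mul (theta N), Module.End.mul_apply, hp, Module.End.mul_apply,
        MvPolynomial.rename_X, MvPolynomial.aeval_X]
      congr 1
      rcases k with k | k
      · rw [Sum.swap_inl, Sum.elim_inl, theta_lv, theta_lv, mul_assoc]
      · rw [Sum.swap_inr, Sum.elim_inr, theta_zv, theta_zv, mul_assoc, mul_assoc,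
          show permH N ρ * yH (ρ⁻¹ k) = yH (ρ (ρ⁻¹ k)) * permH N ρ from (dataH N).s_y _ _]
        simp
  rw [normalOrder_eq, h, one_mul]

theorem coeff_normalOrderUV (P : Polynomial (Polynomial (MvPolynomial (Fin N ⊕ Fin N) ℂ)))
    (n m : ℕ) :
    ((normalOrderUV N P).coeff n).coeff m = normalOrder N ((P.coeff n).coeff m) := by
  rw [normalOrderUV, Polynomial.sum, Polynomial.finsetSum_coeff, Polynomial.finsetSum_coeff]
  simp only [Polynomial.coeff_monomial]
  rw [Finset.sum_eq_single n]
  · rw [if_pos rfl, Polynomial.sum, Polynomial.finsetSum_coeff]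
    simp only [Polynomial.coeff_monomial]
    rw [Finset.sum_eq_single m]
    · rw [if_pos rfl]
    · intro k _ hk; rw [if_neg hk]
    · intro hm; rw [if_pos rfl, Polynomial.notMem_support_iff.1 hm, map_zero]
  · intro k _ hk; rw [if_neg hk, Polynomial.coeff_zero]
  · intro hn; rw [if_pos rfl, Polynomial.notMem_support_iff.1 hn]; simp

theorem normalOrderUV_ext {P : Polynomial (Polynomial (MvPolynomial (Fin N ⊕ Fin N) ℂ))}
    {Q : Polynomial (Polynomial (H N))}
    (h : ∀ n m, normalOrder N ((P.coeff n).coeff m) = (Q.coeff n).coeff m) :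
    normalOrderUV N P = Q := by
  ext n m
  rw [coeff_normalOrderUV, h]

theorem normalOrderUV_one : normalOrderUV N 1 = 1 := by
  refine normalOrderUV_ext fun n m => ?_
  rw [Polynomial.coeff_one, Polynomial.coeff_one]
  split_ifs
  · rw [Polynomial.coeff_one, Polynomial.coeff_one]
    split_ifs
    · exact normalOrder_one
    · exact map_zero _
  · exact map_zero _

theorem normalOrderUV_zsmul (c : ℤ) (P : Polynomial (Polynomial (MvPolynomial (Fin N ⊕ Fin N) ℂ))) :
    normalOrderUV N (c • P) = c • normalOrderUV N P :=
  normalOrderUV_ext fun n m => by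
    simp only [Polynomial.coeff_smul, coeff_normalOrderUV, map_zsmul]

theorem normalOrderUV_sum {ι : Type*} (s : Finset ι)
    (P : ι → Polynomial (Polynomial (MvPolynomial (Fin N ⊕ Fin N) ℂ))) :
    normalOrderUV N (∑ i ∈ s, P i) = ∑ i ∈ s, normalOrderUV N (P i) :=
  normalOrderUV_ext fun n m => by
    simp only [Polynomial.finsetSum_coeff, coeff_normalOrderUV, map_sum]

theorem sub_mul_bivariate {R : Type*} [CommRing R] (a b c : Polynomial (Polynomial R)) :
    (a - b) * c = a * c - b * c := sub_mul a b c

theorem prod_one_sub_bivariate {R : Type*} [CommRing R] {ι : Type*} [DecidableEq ι]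
    (s : Finset ι) (f : ι → Polynomial (Polynomial R)) :
    ∏ i ∈ s, (1 - f i) = ∑ I ∈ s.powerset, ((-1 : ℤ) ^ I.card) • ∏ i ∈ I, f i := by
  rw [Finset.prod_sub]
  refine Finset.sum_congr rfl fun I _ => ?_
  rw [Finset.prod_const_one, mul_one, zsmul_eq_mul]
  push_cast
  rfl

theorem normalOrderUV_x_mul (i : Fin N)
    (P : Polynomial (Polynomial (MvPolynomial (Fin N ⊕ Fin N) ℂ))) :
    normalOrderUV N
      ((Polynomial.X - Polynomial.C (Polynomial.C (MvPolynomial.X (Sum.inl i)))) * P) =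
      (dataUV N).x i * normalOrderUV N P := by
  change _ = (Polynomial.X - Polynomial.C (Polynomial.C (xH i))) * _
  refine normalOrderUV_ext fun n m => ?_
  rw [sub_mul_bivariate, sub_mul, Polynomial.coeff_sub, Polynomial.coeff_sub,
    Polynomial.coeff_C_mul,
    Polynomial.coeff_C_mul, Polynomial.coeff_sub, Polynomial.coeff_sub, Polynomial.coeff_C_mul,
    Polynomial.coeff_C_mul, map_sub]
  cases n <;> simp [coeff_normalOrderUV, normalOrder_X_inl_mul]

theorem normalOrderUV_y_mul (i : Fin N)
    (P : Polynomial (Polynomial (MvPolynomial (Fin N ⊕ Fin N) ℂ))) :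
    normalOrderUV N ((Polynomial.C Polynomial.X -
      Polynomial.C (Polynomial.C (MvPolynomial.X (Sum.inr i)))) * P) =
      normalOrderUV N P * (dataUV N).y i := by
  change _ = _ * (Polynomial.C Polynomial.X - Polynomial.C (Polynomial.C (yH i)))
  refine normalOrderUV_ext fun n m => ?_
  rw [sub_mul_bivariate, mul_sub, Polynomial.coeff_sub, Polynomial.coeff_sub,
    Polynomial.coeff_C_mul,
    Polynomial.coeff_C_mul, Polynomial.coeff_sub, Polynomial.coeff_sub, Polynomial.coeff_C_mul,
    map_sub]
  cases m <;> simp [coeff_normalOrderUV, normalOrder_X_inr_mul]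

theorem normalOrderUV_prod (I : Finset (Fin N)) :
    normalOrderUV N (∏ i ∈ I,
      ((Polynomial.X - Polynomial.C (Polynomial.C (MvPolynomial.X (Sum.inl i)))) *
        (Polynomial.C Polynomial.X - Polynomial.C (Polynomial.C (MvPolynomial.X (Sum.inr i)))))) =
      (dataUV N).prodX I * (dataUV N).prodY I := by
  induction I using Finset.induction_on with
  | empty => simp [normalOrderUV_one]
  | insert i I hi ih =>
    rw [Finset.prod_insert hi, mul_assoc, normalOrderUV_x_mul, normalOrderUV_y_mul, ih,
      CherednikData.prodX_insert _ hi, CherednikData.prodY_insert' _ hi]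
    simp only [mul_assoc]

/-- Expanding the products over fixed points, with `v - x_i` and `u - y_i` in normal order, gives
the element `central` for the shifted data. -/
theorem centralPoly_eq : centralPoly N = (-1) ^ N * (dataUV N).central := by
  rw [centralPoly, CherednikData.central, CherednikData.fixPairs, Finset.sum_filter,
    ← Finset.univ_product_univ, Finset.sum_product_right]
  congr 1
  refine Finset.sum_congr rfl fun σ _ => ?_
  simp only [fixFactor]
  rw [prod_one_sub_bivariate, normalOrderUV_sum, ← Finset.sum_filter, Finset.sum_mul]
  have hset : (Finset.univ.filter fun I : Finset (Fin N) => ∀ i ∈ I, σ i = i) =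
      (Finset.univ.filter fun i => σ i = i).powerset := by
    ext I
    simp [Finset.subset_iff]
  rw [hset]
  refine Finset.sum_congr rfl fun I _ => ?_
  rw [normalOrderUV_zsmul, normalOrderUV_prod,
    CherednikData.pairSign]
  change _ * _ = _ • (_ * Polynomial.C (Polynomial.C (permH N σ)))
  rw [mul_smul, smul_mul_assoc, map_zsmul, map_zsmul, mul_smul_comm]

theorem centralPoly_comm (h : H N) :
    centralPoly N * Polynomial.C (Polynomial.C h) =
      Polynomial.C (Polynomial.C h) * centralPoly N := by
  have hsgn : ∀ Q : Polynomial (Polynomial (H N)), Commute ((-1) ^ N) Q := fun Q =>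
    (Commute.neg_one_left Q).pow_left N
  have hV : ∀ Q : Polynomial (Polynomial (H N)), Commute Q Polynomial.X := fun Q =>
    (Polynomial.commute_X Q).symm
  have hU : ∀ Q : Polynomial (Polynomial (H N)), Commute Q (Polynomial.C Polynomial.X) := by
    intro Q
    induction Q using Polynomial.induction_on' with
    | add p q hp hq => exact hp.add_left hq
    | monomial n a =>
      rw [← Polynomial.C_mul_X_pow_eq_monomial]
      exact (((Polynomial.commute_X a).symm).map Polynomial.C).mul_left
        ((Polynomial.commute_X _).pow_left n)
  rw [centralPoly_eq]
  induction h using H_induction with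
  | hc c =>
    exact (Algebra.commutes (A := Polynomial (Polynomial (H N))) c _).symm
  | hx i =>
    have h1 : Commute ((-1) ^ N * (dataUV N).central) (Polynomial.X - (dataUV N).x i) :=
      (hV _).sub_right ((hsgn _).mul_left ((dataUV N).central_comm_x i))
    rwa [show Polynomial.X - (dataUV N).x i = Polynomial.C (Polynomial.C (xH i)) from
      sub_sub_cancel _ _] at h1
  | hy i =>
    have h1 : Commute ((-1) ^ N * (dataUV N).central)
        (Polynomial.C Polynomial.X - (dataUV N).y i) :=
      (hU _).sub_right ((hsgn _).mul_left ((dataUV N).central_comm_y i))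
    rwa [show Polynomial.C Polynomial.X - (dataUV N).y i = Polynomial.C (Polynomial.C (yH i)) from
      sub_sub_cancel _ _] at h1
  | hs σ => exact (hsgn _).mul_left ((dataUV N).central_comm_s σ).symm
  | hmul a b ha hb => rw [map_mul, map_mul, ← mul_assoc, ha, mul_assoc, hb, mul_assoc]
  | hadd a b ha hb => rw [map_add, map_add, mul_add, ha, hb, add_mul]

/-- The coefficients of the universal central polynomial are central. -/
theorem coeff_centralPoly_comm (n m : ℕ) (h : H N) :
    ((centralPoly N).coeff n).coeff m * h = h * ((centralPoly N).coeff n).coeff m := by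
  have := congrArg (fun Q => (Polynomial.coeff Q n).coeff m) (centralPoly_comm h)
  simpa using this

/-- The product `∏_{σ(i) = i} (1 - (v - λ_i) (u - z_{ρ⁻¹(i)}))`. -/
def fixProd (σ ρ : Equiv.Perm (Fin N)) : Polynomial (Polynomial (ZL N)) :=
  ∏ i : Fin N with σ i = i,
    (1 - (Polynomial.X - Polynomial.C (Polynomial.C (lv i))) *
      (Polynomial.C Polynomial.X - Polynomial.C (Polynomial.C (zv (ρ⁻¹ i)))))

theorem map_prod_fixFactor (σ ρ : Equiv.Perm (Fin N)) :
    (∏ i : Fin N with σ i = i, fixFactor N i).map (Polynomial.mapRingHom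
      (MvPolynomial.aeval (Sum.elim lv fun i => zv (ρ⁻¹ i)) : _ →ₐ[ℂ] ZL N).toRingHom) =
      fixProd σ ρ := by
  rw [Polynomial.map_prod, fixProd]
  refine Finset.prod_congr rfl fun i _ => ?_
  simp [fixFactor]

theorem coeff_centralPoly_mul_permH (n m : ℕ) (τ : Equiv.Perm (Fin N)) :
    ((centralPoly N).coeff n).coeff m * permH N τ =
      ∑ σ, ((-1) ^ N * ((Equiv.Perm.sign σ : ℤˣ) : ℤ)) •
        theta N (((fixProd σ (σ * τ)).coeff n).coeff m) (permH N (σ * τ)) := by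
  have hsign : ∀ P : Polynomial (Polynomial (H N)),
      (-1) ^ N * P = ((-1 : ℤ) ^ N) • P := by
    intro P; rw [zsmul_eq_mul]; push_cast; rfl
  rw [centralPoly, hsign, Finset.smul_sum, Polynomial.finsetSum_coeff, Polynomial.finsetSum_coeff,
    Finset.sum_mul]
  refine Finset.sum_congr rfl fun σ _ => ?_
  rw [map_zsmul, map_zsmul, mul_smul_comm, ← mul_smul, Polynomial.coeff_smul, Polynomial.coeff_smul,
    Polynomial.coeff_mul_C, Polynomial.coeff_mul_C, coeff_normalOrderUV, smul_mul_assoc, mul_assoc,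
    ← map_mul, normalOrder_mul_permH, ← map_prod_fixFactor, Polynomial.coeff_map]
  simp

/-! ### Signed sums of products of rows -/

/-- If applying the row `i` of each product to `Φ (i + 1) σ` gives `Φ i σ` up to terms that are
symmetric under `σ ↦ σ (i a)` for some `a > i`, then the signed sums of all products agree
with the signed sum of `Φ 0`: the symmetric terms cancel in pairs. -/
theorem sum_sign_prod_apply {W : Type*} [AddCommGroup W] [Module ℂ W] (n : ℕ)
    (L : Fin n → Fin n → Module.End ℂ W) (Φ : ℕ → Equiv.Perm (Fin n) → W)
    (d : Fin n → Fin n → Equiv.Perm (Fin n) → W)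
    (step : ∀ (i : Fin n) σ, L i (σ i) (Φ (i + 1) σ) =
      Φ i σ + ∑ a with i < a, (d i a σ + d i a (σ * Equiv.swap i a))) :
    ∑ σ : Equiv.Perm (Fin n), ((Equiv.Perm.sign σ : ℤˣ) : ℤ) •
        (List.ofFn fun i => L i (σ i)).prod (Φ n σ) =
      ∑ σ : Equiv.Perm (Fin n), ((Equiv.Perm.sign σ : ℤˣ) : ℤ) • Φ 0 σ := by
  have main : ∀ m ≤ n, ∑ σ : Equiv.Perm (Fin n), ((Equiv.Perm.sign σ : ℤˣ) : ℤ) •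
        ((List.ofFn fun i => L i (σ i)).take m).prod (Φ m σ) =
      ∑ σ : Equiv.Perm (Fin n), ((Equiv.Perm.sign σ : ℤˣ) : ℤ) • Φ 0 σ := by
    intro m
    induction m with
    | zero => simp
    | succ m ih =>
      intro hm
      rw [← ih (Nat.le_of_succ_le hm)]
      set i : Fin n := ⟨m, hm⟩ with hi
      have h1 : ∀ σ : Equiv.Perm (Fin n),
          ((List.ofFn fun i => L i (σ i)).take (m + 1)).prod (Φ (m + 1) σ) =
            ((List.ofFn fun i => L i (σ i)).take m).prod (Φ m σ) +
            ∑ a with i < a, (((List.ofFn fun i => L i (σ i)).take m).prod (d i a σ) +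
              ((List.ofFn fun i => L i (σ i)).take m).prod (d i a (σ * Equiv.swap i a))) := by
        intro σ
        rw [List.prod_take_succ _ _ (by simpa using hm), Module.End.mul_apply, List.getElem_ofFn]
        have := step i σ
        rw [hi] at this
        rw [this, map_add, map_sum]
        simp only [map_add, hi]
      simp only [h1, smul_add, Finset.sum_add_distrib, Finset.smul_sum]
      rw [add_eq_left, ← Finset.sum_add_distrib]
      simp only [← Finset.sum_add_distrib]
      rw [Finset.sum_comm]
      refine Finset.sum_eq_zero fun a ha => ?_
      have hia : i < a := (Finset.mem_filter.1 ha).2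
      rw [Finset.sum_add_distrib, ← Equiv.sum_comp (Equiv.mulRight (Equiv.swap i a))
        fun σ : Equiv.Perm (Fin n) => ((Equiv.Perm.sign σ : ℤˣ) : ℤ) •
          ((List.ofFn fun i => L i (σ i)).take m).prod (d i a σ), ← Finset.sum_add_distrib]
      refine Finset.sum_eq_zero fun σ _ => ?_
      have hl : ((List.ofFn fun r => L r ((σ * Equiv.swap i a) r)).take m) =
          ((List.ofFn fun r => L r (σ r)).take m) := by
        refine List.ext_getElem (by simp) fun r h2 h3 => ?_
        simp only [List.length_take, List.length_ofFn, lt_inf_iff] at h2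
        rw [List.getElem_take, List.getElem_take, List.getElem_ofFn, List.getElem_ofFn,
          Equiv.Perm.mul_apply, Equiv.swap_apply_of_ne_of_ne]
        · exact fun e => absurd (congrArg Fin.val e) (by simp [hi]; omega)
        · intro e
          have h4 := congrArg Fin.val e
          have h5 : m < (a : ℕ) := hia
          simp at h4
          omega
      rw [Equiv.coe_mulRight, hl, Equiv.Perm.sign_mul, Equiv.Perm.sign_swap hia.ne]
      simp
  have := main n le_rfl
  simpa [List.take_of_length_le] using this

/-! ### Products of first order operators with commuting coefficients -/

/-- The expansion of `1 / (u - z)` in powers of `u⁻¹`. -/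
def geom {K : Type*} [CommRing K] (z : K) : PowerSeries K :=
  PowerSeries.mk fun n => match n with
    | 0 => 0
    | s + 1 => z ^ s

theorem geom_eq {K : Type*} [CommRing K] (z : K) :
    geom z = PowerSeries.X * (1 + PowerSeries.C z * geom z) := by
  ext n
  cases n with
  | zero => simp [geom]
  | succ n =>
    rw [PowerSeries.coeff_succ_X_mul, map_add, PowerSeries.coeff_C_mul]
    cases n with
    | zero => simp [geom]
    | succ n => simp [geom, PowerSeries.coeff_one, pow_succ']

section Comm

variable {K : Type*} [CommRing K] [Algebra ℂ K]

theorem mulDel_C_mul {A : Type*} [Ring A] [Algebra ℂ A] (f : PowerSeries A) (P : DiffOp A) :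
    mulDel (Polynomial.C f * P) = Polynomial.C f * mulDel P + Polynomial.C (uDeriv f) * P :=
  LinearMap.congr_fun (mulDel_mulFun f) P

theorem uDeriv_zero {A : Type*} [Ring A] [Algebra ℂ A] : uDeriv (0 : PowerSeries A) = 0 := by
  ext n; cases n <;> simp [uDeriv]

theorem coeff_mulDel {A : Type*} [Ring A] [Algebra ℂ A] (P : DiffOp A) (k : ℕ) :
    (mulDel P).coeff k = (P * Polynomial.X).coeff k + uDeriv (P.coeff k) := by
  change (P * Polynomial.X + P.sum fun k f => Polynomial.monomial k (uDeriv f)).coeff k = _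
  rw [Polynomial.coeff_add, Polynomial.sum, Polynomial.finsetSum_coeff]
  simp only [Polynomial.coeff_monomial]
  rw [Finset.sum_eq_single k]
  · rw [if_pos rfl]
  · intro l _ hl; rw [if_neg hl]
  · intro hk; rw [if_pos rfl, Polynomial.notMem_support_iff.1 hk, uDeriv_zero]

theorem mulDel_X_mul {A : Type*} [Ring A] [Algebra ℂ A] (P : DiffOp A) :
    mulDel (Polynomial.X * P) = Polynomial.X * mulDel P := by
  ext1 k
  rw [coeff_mulDel]
  cases k with
  | zero => simp [uDeriv_zero]
  | succ k =>
    rw [Polynomial.coeff_X_mul, Polynomial.coeff_X_mul, coeff_mulDel, Polynomial.coeff_mul_X]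
    cases k <;> simp

theorem uDeriv_geom (z : K) : uDeriv (geom z) = -geom z ^ 2 := by
  -- both sides satisfy the linear equation obtained by differentiating `(1 - z u⁻¹) f = u⁻¹`
  have hX : uDeriv (PowerSeries.X : PowerSeries K) = -PowerSeries.X ^ 2 := by
    ext n
    rcases n with _ | _ | _ | n <;>
      simp [uDeriv, PowerSeries.coeff_X, PowerSeries.coeff_X_pow]
  have hC : uDeriv (1 + PowerSeries.C z * geom z) = PowerSeries.C z * uDeriv (geom z) := by
    ext n
    rcases n with _ | n
    · simp [uDeriv]
    · rcases n with _ | n <;> simp [uDeriv, PowerSeries.coeff_one]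
  have h1 := congrArg uDeriv (geom_eq z)
  rw [uDeriv_mul, hX, hC] at h1
  have h2 := geom_eq z
  set g := geom z
  set X : PowerSeries K := PowerSeries.X
  set c : PowerSeries K := PowerSeries.C z
  have hu : IsUnit (1 - X * c) := by
    rw [PowerSeries.isUnit_iff_constantCoeff]
    simp [X]
  apply hu.mul_left_cancel
  linear_combination h1 + (g + X) * h2

/-- The factor `δ (v - l) - ζ`, where `δ` is `1` or `0`. -/
def factor (p : Prop) [Decidable p] (l : K) (ζ : PowerSeries K) : DiffOp K :=
  (if p then Polynomial.X - Polynomial.C (PowerSeries.C l) else 0) - Polynomial.C ζ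

theorem uDeriv_C (l : K) : uDeriv (PowerSeries.C l) = 0 := by
  ext n
  rcases n with _ | _ | n <;> simp [uDeriv, PowerSeries.coeff_C]

theorem mulDel_factor_mul (p : Prop) [Decidable p] (l z : K) (P : DiffOp K) :
    mulDel (factor p l (geom z) * P) =
      factor p l (geom z) * mulDel P + Polynomial.C (geom z ^ 2) * P := by
  rw [factor]
  split_ifs
  · rw [sub_mul, sub_mul, map_sub, map_sub, mulDel_X_mul, mulDel_C_mul, mulDel_C_mul, uDeriv_C,
      uDeriv_geom, map_neg, map_zero]
    ring
  · rw [sub_mul, map_sub, mulDel_C_mul, uDeriv_geom, map_neg, zero_mul, map_zero]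
    ring

theorem mulDel_one {A : Type*} [Ring A] [Algebra ℂ A] :
    mulDel (1 : DiffOp A) = Polynomial.X := by
  rw [← Polynomial.monomial_zero_one, mulDel_monomial, ← Polynomial.monomial_one_one_eq_X,
    show uDeriv (1 : PowerSeries A) = 0 from ?_, map_zero, add_zero]
  ext n; rcases n with _ | _ | n <;> simp [uDeriv, PowerSeries.coeff_one]

/-- Moving `∂` to the right across a product of factors `δ (v - l) - (u - z)⁻¹` differentiates one
of the factors, which gives `(u - z)⁻²`. -/
theorem mulDel_prod_factor {ι : Type*} [DecidableEq ι] (I : Finset ι) (p : ι → Prop)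
    [DecidablePred p] (l z : ι → K) :
    mulDel (∏ a ∈ I, factor (p a) (l a) (geom (z a))) =
      Polynomial.X * ∏ a ∈ I, factor (p a) (l a) (geom (z a)) +
        ∑ a ∈ I, Polynomial.C (geom (z a) ^ 2) *
          ∏ b ∈ I.erase a, factor (p b) (l b) (geom (z b)) := by
  induction I using Finset.induction_on with
  | empty => rw [Finset.prod_empty, mulDel_one]; simp
  | insert i I hi ih =>
    rw [Finset.prod_insert hi, mulDel_factor_mul, ih, Finset.sum_insert hi, Finset.erase_insert hi]
    have : ∑ a ∈ I, Polynomial.C (geom (z a) ^ 2) *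
          ∏ b ∈ (insert i I).erase a, factor (p b) (l b) (geom (z b)) =
        factor (p i) (l i) (geom (z i)) * ∑ a ∈ I, Polynomial.C (geom (z a) ^ 2) *
          ∏ b ∈ I.erase a, factor (p b) (l b) (geom (z b)) := by
      rw [Finset.mul_sum]
      refine Finset.sum_congr rfl fun a ha => ?_
      have hai : i ≠ a := fun e => hi (e ▸ ha)
      rw [Finset.erase_insert_of_ne hai, Finset.prod_insert fun h => hi (Finset.mem_of_mem_erase h)]
      ring
    rw [this]
    ring

end Comm

/-! ### The action of the universal operator on the vectors `ε_τ` -/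

/-- The vector `ε_{g(1)} ⊗ ⋯ ⊗ ε_{g(N)}` of `𝒱`. -/
def epsF (g : Fin N → Fin N) : VSpace N :=
  (1 ⊗ₜ[ℂ] (PiTensorProduct.tprod ℂ fun k => (Pi.single (g k) 1 : Fin N → ℂ)) :
    ZL N ⊗[ℂ] TensorPower N)

theorem onFactor_eps (k i j : Fin N) (g : Fin N → Fin N) :
    onFactor N k (eVec N i j)
      (PiTensorProduct.tprod ℂ fun k => (Pi.single (g k) 1 : Fin N → ℂ)) =
      if g k = j then PiTensorProduct.tprod ℂ fun l =>
        (Pi.single (Function.update g k i l) 1 : Fin N → ℂ) else 0 := by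
  unfold onFactor
  rw [PiTensorProduct.map_tprod]
  split_ifs with hk
  · congr 1
    funext l
    by_cases hl : l = k
    · subst hl; simp [eVec_single, hk]
    · simp [Function.update_of_ne hl]
  · refine MultilinearMap.map_coord_zero _ k ?_
    simp [eVec_single, Ne.symm hk]

theorem eFactor_epsF (k i j : Fin N) (g : Fin N → Fin N) :
    eFactor N k i j (epsF g) = if g k = j then epsF (Function.update g k i) else 0 := by
  refine (LinearMap.baseChange_tmul (A := ZL N) (onFactor N k (eVec N i j)) 1 _).trans ?_
  rw [onFactor_eps]
  split_ifs
  · rfl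
  · exact TensorProduct.tmul_zero _ _

theorem ulAction_lamUL (i : Fin N) (x : VSpace N) :
    ulAction N (lamUL N i) x = (lv i : ZL N) • x := by
  have h : ulAction N (lamUL N i) =
      UniversalEnvelopingAlgebra.lift ℂ (currentRep N) 1 *
      (((Algebra.ofId (ZL N) (Module.End (ZL N) (VSpace N))).restrictScalars ℂ).comp (polyLam N))
        (MvPolynomial.X i) := Algebra.TensorProduct.lift_tmul _ _ _ _ _
  rw [h, map_one, one_mul]
  simp [polyLam, Algebra.ofId_apply]

theorem evalFactor_eCur (k i j : Fin N) (r : ℕ) :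
    evalFactor N k (eCur N i j r) = (zv k : ZL N) ^ r • eFactor N k i j := by
  rw [evalFactor, Finset.sum_eq_single i, Finset.sum_eq_single j]
  · simp [eCur]
  · intro b _ hb
    simp [eCur, Matrix.single_apply_of_ne _ _ _ _ _ (fun h => hb h.2.symm)]
  · simp
  · intro b _ hb
    refine Finset.sum_eq_zero fun c _ => ?_
    simp [eCur, Matrix.single_apply_of_ne _ _ _ _ _ (fun h => hb h.1.symm)]
  · simp

theorem ulAction_eUL (i j : Fin N) (r : ℕ) (x : VSpace N) :
    ulAction N (eUL N i j r) x = ∑ k, (zv k : ZL N) ^ r • eFactor N k i j x := by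
  have h : ulAction N (eUL N i j r) =
      UniversalEnvelopingAlgebra.lift ℂ (currentRep N)
        (UniversalEnvelopingAlgebra.ι ℂ (eCur N i j r)) *
      (((Algebra.ofId (ZL N) (Module.End (ZL N) (VSpace N))).restrictScalars ℂ).comp (polyLam N))
        1 := Algebra.TensorProduct.lift_tmul _ _ _ _ _
  rw [h, map_one, mul_one, UniversalEnvelopingAlgebra.lift_ι_apply]
  change (∑ k, evalFactor N k (eCur N i j r)) x = _
  simp [evalFactor_eCur, LinearMap.sum_apply]

/-- Polynomials in `v` with coefficients in `𝒱⟦u⁻¹⟧`, extended to arbitrary double sequences: the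
entry at `(k, j)` is the coefficient of `u^{-j} v^k`. -/
abbrev WSpace (N : ℕ) := ℕ → ℕ → VSpace N

/-- Applying the coefficients of a differential operator to a vector. -/
def evalAt (x : VSpace N) : DiffOp (UL N) →ₗ[ℂ] WSpace N where
  toFun P k j := ulAction N (PowerSeries.coeff j (P.coeff k)) x
  map_add' P Q := by ext1 k; ext1 j; simp
  map_smul' c P := by ext1 k; ext1 j; simp

theorem evalAt_apply (x : VSpace N) (P : DiffOp (UL N)) (k j : ℕ) :
    evalAt x P k j = ulAction N (PowerSeries.coeff j (P.coeff k)) x := rfl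

/-- The action of a function of `u`. -/
def actFun (f : PowerSeries (UL N)) : Module.End ℂ (WSpace N) where
  toFun w k j := ∑ p ∈ Finset.HasAntidiagonal.antidiagonal j,
    ulAction N (PowerSeries.coeff p.1 f) (w k p.2)
  map_add' w w' := by ext1 k; ext1 j; simp [Finset.sum_add_distrib]
  map_smul' c w := by
    ext1 k; ext1 j
    simp only [Pi.smul_apply, RingHom.id_apply, Finset.smul_sum]
    exact Finset.sum_congr rfl fun p _ => LinearMap.map_smul_of_tower _ _ _

/-- The action of `∂`. -/
def actDel (N : ℕ) : Module.End ℂ (WSpace N) where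
  toFun w k j := (match k with
      | 0 => 0
      | k + 1 => w k j) + match j with
      | 0 => 0
      | j + 1 => -((j : ℂ) • w k j)
  map_add' w w' := by
    ext1 k; ext1 j
    rcases k with _ | k <;> rcases j with _ | j <;> simp <;> abel
  map_smul' c w := by
    ext1 k; ext1 j
    rcases k with _ | k <;> rcases j with _ | j <;> simp [smul_comm c]

theorem evalAt_mulFun (x : VSpace N) (f : PowerSeries (UL N)) (P : DiffOp (UL N)) :
    evalAt x (mulFun f P) = actFun f (evalAt x P) := by
  ext1 k; ext1 j
  change ulAction N (PowerSeries.coeff j ((Polynomial.C f * P).coeff k)) x = _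
  rw [Polynomial.coeff_C_mul, PowerSeries.coeff_mul, map_sum, LinearMap.sum_apply]
  simp only [map_mul]
  rfl

theorem evalAt_mulDel (x : VSpace N) (P : DiffOp (UL N)) :
    evalAt x (mulDel P) = actDel N (evalAt x P) := by
  ext1 k; ext1 j
  change ulAction N (PowerSeries.coeff j ((mulDel P).coeff k)) x = _
  rw [coeff_mulDel, map_add, map_add, LinearMap.add_apply]
  change _ = (match k with
      | 0 => 0
      | k + 1 => ulAction N (PowerSeries.coeff j (P.coeff k)) x) + match j with
      | 0 => 0
      | j + 1 => -((j : ℂ) • ulAction N (PowerSeries.coeff j (P.coeff k)) x)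
  congr 1
  · rcases k with _ | k <;> simp
  · rcases j with _ | j <;> simp [uDeriv]

/-- The element `F ε_g` of `WSpace`. -/
def emb (g : Fin N → Fin N) : DiffOp (ZL N) →ₗ[ℂ] WSpace N where
  toFun F k j := PowerSeries.coeff j (F.coeff k) • epsF g
  map_add' P Q := by ext1 k; ext1 j; simp [add_smul]
  map_smul' c P := by ext1 k; ext1 j; simp

theorem emb_apply (g : Fin N → Fin N) (F : DiffOp (ZL N)) (k j : ℕ) :
    emb g F k j = PowerSeries.coeff j (F.coeff k) • epsF g := rfl

theorem actDel_emb (g : Fin N → Fin N) (F : DiffOp (ZL N)) :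
    actDel N (emb g F) = emb g (mulDel F) := by
  ext1 k; ext1 j
  rw [emb_apply, coeff_mulDel, map_add, add_smul]
  change (match k with
      | 0 => 0
      | k + 1 => PowerSeries.coeff j (F.coeff k) • epsF g) + (match j with
      | 0 => 0
      | j + 1 => -((j : ℂ) • (PowerSeries.coeff j (F.coeff k) • epsF g))) = _
  congr 1
  · rcases k with _ | k <;> simp
  · rcases j with _ | j <;> simp [uDeriv]

theorem actFun_lam_emb (i : Fin N) (g : Fin N → Fin N) (F : DiffOp (ZL N)) :
    actFun (PowerSeries.C (lamUL N i)) (emb g F) =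
      emb g (Polynomial.C (PowerSeries.C (lv i)) * F) := by
  ext1 k; ext1 j
  change ∑ p ∈ Finset.HasAntidiagonal.antidiagonal j,
    ulAction N (PowerSeries.coeff p.1 (PowerSeries.C (lamUL N i)))
      (PowerSeries.coeff p.2 (F.coeff k) • epsF g) = _
  rw [Finset.sum_eq_single (0, j), emb_apply, Polynomial.coeff_C_mul, PowerSeries.coeff_C_mul]
  · rw [PowerSeries.coeff_zero_C, ulAction_lamUL, smul_smul]
  · rintro ⟨a, b⟩ h hne
    have ha : a ≠ 0 := by
      rintro rfl
      rw [Finset.HasAntidiagonal.mem_antidiagonal] at h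
      exact hne (by simpa using h)
    rw [PowerSeries.coeff_C, if_neg ha, map_zero, LinearMap.zero_apply]
  · simp

theorem actFun_eSeries_emb (i j : Fin N) (g : Fin N → Fin N) (F : DiffOp (ZL N)) :
    actFun (eSeries N i j) (emb g F) = ∑ k, if g k = j then
      emb (Function.update g k i) (Polynomial.C (geom (zv k)) * F) else 0 := by
  ext1 n; ext1 m
  rw [Finset.sum_apply, Finset.sum_apply]
  change ∑ p ∈ Finset.HasAntidiagonal.antidiagonal m,
    ulAction N (PowerSeries.coeff p.1 (eSeries N i j))
      (PowerSeries.coeff p.2 (F.coeff n) • epsF g) = _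
  have h1 : ∀ p : ℕ × ℕ, ulAction N (PowerSeries.coeff p.1 (eSeries N i j))
      (PowerSeries.coeff p.2 (F.coeff n) • epsF g) = ∑ k, if g k = j then
        (PowerSeries.coeff p.1 (geom (zv k : ZL N)) * PowerSeries.coeff p.2 (F.coeff n)) •
          epsF (Function.update g k i) else 0 := by
    rintro ⟨a, b⟩
    rcases a with _ | a
    · simp [eSeries, geom]
    · simp only [eSeries, geom, PowerSeries.coeff_mk, ulAction_eUL, map_smul, eFactor_epsF]
      rw [Finset.smul_sum]
      refine Finset.sum_congr rfl fun k _ => ?_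
      split_ifs
      · rw [smul_smul, mul_comm]
      · rw [smul_zero, smul_zero]
  simp only [h1]
  rw [Finset.sum_comm]
  refine Finset.sum_congr rfl fun k _ => ?_
  split_ifs
  · rw [emb_apply, Polynomial.coeff_C_mul, PowerSeries.coeff_mul, Finset.sum_smul]
  · simp

/-- The action of the entry `(i, j)` of the matrix `(δ_{ij} (∂ - λ_i) - e_{ji}(u))`. -/
def actEntry (i j : Fin N) : Module.End ℂ (WSpace N) :=
  (if i = j then actDel N - actFun (PowerSeries.C (lamUL N i)) else 0) - actFun (eSeries N j i)

/-- The map which agrees with `σ` on the rows from `i` on and is the identity on the others. -/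
def part (i : ℕ) (σ : Equiv.Perm (Fin N)) (a : Fin N) : Fin N := if i ≤ a then σ a else a

/-- The factor `δ_{σ(a), a} (v - λ_a) - (u - z_{τ⁻¹(a)})⁻¹`. -/
def rowFactor (σ τ : Equiv.Perm (Fin N)) (a : Fin N) : DiffOp (ZL N) :=
  factor (σ a = a) (lv a) (geom (zv (τ⁻¹ a)))

theorem rowFactor_of_ne {σ τ : Equiv.Perm (Fin N)} {a : Fin N} (h : σ a ≠ a) :
    rowFactor σ τ a = -Polynomial.C (geom (zv (τ⁻¹ a))) := by
  rw [rowFactor, factor, if_neg h, zero_sub]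

/-- The normally ordered product of the rows from `i` on, applied to `ε_τ`. -/
def rowState (τ : Equiv.Perm (Fin N)) (i : ℕ) (σ : Equiv.Perm (Fin N)) : WSpace N :=
  emb (part i σ ∘ τ) (∏ a with i ≤ Fin.val a, rowFactor σ τ a)

/-- The contribution to the action of row `i` that arises when `∂` is applied to
`-(u - z_{τ⁻¹(a)})⁻¹`. -/
def contraction (τ : Equiv.Perm (Fin N)) (i a : Fin N) (σ : Equiv.Perm (Fin N)) : WSpace N :=
  if σ i = i then emb (part (i + 1) σ ∘ τ) (Polynomial.C (geom (zv (τ⁻¹ a)) ^ 2) *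
    ∏ b ∈ (Finset.univ.filter fun b : Fin N => i < b).erase a, rowFactor σ τ b) else 0

theorem update_part (τ σ : Equiv.Perm (Fin N)) (i : Fin N) :
    Function.update (part (i + 1) σ ∘ τ) (τ⁻¹ i) (σ i) = part i σ ∘ τ := by
  funext k
  by_cases hk : k = τ⁻¹ i
  · subst hk
    simp [part]
  · have hne : τ k ≠ i := fun e => hk (by rw [← e]; simp)
    have : ((i : ℕ) + 1 ≤ τ k) ↔ ((i : ℕ) ≤ τ k) := by
      have : (τ k : ℕ) ≠ i := fun e => hne (Fin.ext e)
      omega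
    rw [Function.update_of_ne hk]
    simp only [Function.comp_apply, part, this]

theorem update_part_of_lt (τ σ : Equiv.Perm (Fin N)) {i a : Fin N} (h : i < a) :
    Function.update (part (i + 1) σ ∘ τ) (τ⁻¹ a) (σ i) =
      part (i + 1) (σ * Equiv.swap i a) ∘ τ := by
  funext k
  by_cases hk : k = τ⁻¹ a
  · subst hk
    have h' : (i : ℕ) + 1 ≤ a := h
    simp [part, h']
  · have hne : τ k ≠ a := fun e => hk (by rw [← e]; simp)
    rw [Function.update_of_ne hk]
    simp only [Function.comp_apply, part]
    split_ifs with hi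
    · rw [Equiv.Perm.mul_apply, Equiv.swap_apply_of_ne_of_ne _ hne]
      intro e
      rw [e] at hi
      omega
    · rfl

theorem filter_le_eq_insert (i : Fin N) :
    (Finset.univ.filter fun a : Fin N => (i : ℕ) ≤ a) =
      insert i (Finset.univ.filter fun b : Fin N => i < b) := by
  ext a
  simp only [Finset.mem_filter, Finset.mem_univ, true_and, Finset.mem_insert]
  rw [← Fin.le_def, le_iff_eq_or_lt, eq_comm]

theorem contraction_swap (τ σ : Equiv.Perm (Fin N)) {i a : Fin N} (h : i < a) :
    contraction τ i a (σ * Equiv.swap i a) = if σ a = i then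
      emb (Function.update (part (i + 1) σ ∘ τ) (τ⁻¹ a) (σ i))
        (Polynomial.C (geom (zv (τ⁻¹ a)) ^ 2) *
          ∏ b ∈ (Finset.univ.filter fun b : Fin N => i < b).erase a, rowFactor σ τ b) else 0 := by
  rw [contraction, update_part_of_lt τ σ h, Equiv.Perm.mul_apply, Equiv.swap_apply_left]
  have : ∀ b ∈ (Finset.univ.filter fun b : Fin N => i < b).erase a,
      rowFactor (σ * Equiv.swap i a) τ b = rowFactor σ τ b := by
    intro b hb
    rw [Finset.mem_erase, Finset.mem_filter] at hb
    simp only [rowFactor]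
    rw [Equiv.Perm.mul_apply, Equiv.swap_apply_of_ne_of_ne hb.2.2.ne' hb.1]
  rw [Finset.prod_congr rfl this]

/-- The action of one more row on a normally ordered product. The sum over the sites of
`e_{σ(i) i}` has the term of the site of `i`, and a second term if some `σ(a)` equals `i`. -/
theorem actEntry_rowState (τ σ : Equiv.Perm (Fin N)) (i : Fin N) :
    actEntry i (σ i) (rowState τ (i + 1) σ) = rowState τ i σ +
      ∑ a with i < a, (contraction τ i a σ + contraction τ i a (σ * Equiv.swap i a)) := by
  set I : Finset (Fin N) := Finset.univ.filter fun b : Fin N => i < b with hI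
  have hiI : i ∉ I := by simp [hI]
  set F : DiffOp (ZL N) := ∏ a ∈ I, rowFactor σ τ a with hF
  set g := part (i + 1) σ ∘ τ with hg
  have hstate : rowState τ (i + 1) σ = emb g F := rfl
  have hstate' : rowState τ i σ = emb (part i σ ∘ τ) (rowFactor σ τ i * F) := by
    rw [rowState, filter_le_eq_insert, Finset.prod_insert hiI]
  -- the part of `e_{σ(i) i}(u)`
  have hE : actFun (eSeries N (σ i) i) (emb g F) =
      emb (part i σ ∘ τ) (Polynomial.C (geom (zv (τ⁻¹ i))) * F) -
        ∑ a ∈ I, contraction τ i a (σ * Equiv.swap i a) := by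
    rw [actFun_eSeries_emb, ← Equiv.sum_comp τ⁻¹]
    have hs : ∀ a : Fin N, (g (τ⁻¹ a) = i) ↔ (a = i ∨ (a ∈ I ∧ σ a = i)) := by
      intro a
      simp only [hg, Function.comp_apply, part, hI, Finset.mem_filter, Finset.mem_univ, true_and,
        Equiv.Perm.inv_def, Equiv.apply_symm_apply, Fin.lt_def]
      split_ifs with h
      · have : a ≠ i := by rintro rfl; omega
        simp only [this, false_or]
        exact ⟨fun e => ⟨h, e⟩, fun e => e.2⟩
      · exact ⟨fun e => Or.inl e, fun e => e.elim id fun e => absurd e.1 h⟩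
    have hsplit : ∀ a : Fin N, (if g (τ⁻¹ a) = i then
        emb (Function.update g (τ⁻¹ a) (σ i)) (Polynomial.C (geom (zv (τ⁻¹ a))) * F) else 0) =
        (if a = i then emb (part i σ ∘ τ) (Polynomial.C (geom (zv (τ⁻¹ i))) * F) else 0) -
          if a ∈ I then contraction τ i a (σ * Equiv.swap i a) else 0 := by
      intro a
      by_cases hai : a = i
      · subst hai
        rw [if_pos ((hs a).2 (Or.inl rfl)), if_pos rfl, if_neg hiI, sub_zero, hg, update_part]
      · by_cases haI : a ∈ I
        · have hlt : i < a := (Finset.mem_filter.1 haI).2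
          rw [if_neg hai, if_pos haI, zero_sub, contraction_swap τ σ hlt, ← hI, ← hg]
          by_cases hσ : σ a = i
          · rw [if_pos ((hs a).2 (Or.inr ⟨haI, hσ⟩)), if_pos hσ, ← map_neg]
            congr 1
            rw [hF, ← Finset.mul_prod_erase I _ haI, rowFactor_of_ne (by rw [hσ]; exact hlt.ne),
              map_pow]
            ring
          · rw [if_neg (by rw [hs]; tauto), if_neg hσ, neg_zero]
        · rw [if_neg (by rw [hs]; tauto), if_neg hai, if_neg haI, sub_zero]
    rw [Finset.sum_congr rfl fun a _ => hsplit a, Finset.sum_sub_distrib, Finset.sum_ite_eq',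
      if_pos (Finset.mem_univ i), ← Finset.sum_filter, Finset.filter_mem_eq_inter,
      Finset.univ_inter]
  rw [hstate, hstate', actEntry, LinearMap.sub_apply, hE, Finset.sum_add_distrib]
  by_cases hσ : σ i = i
  · have hgi : part i σ ∘ τ = g := by
      rw [← update_part τ σ i, hσ, ← hg]
      funext k
      by_cases hk : k = τ⁻¹ i
      · subst hk; simp [hg, part]
      · rw [Function.update_of_ne hk]
    have hc : ∑ a ∈ I, contraction τ i a σ = emb g (∑ a ∈ I, Polynomial.C (geom (zv (τ⁻¹ a)) ^ 2) *
        ∏ b ∈ I.erase a, rowFactor σ τ b) := by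
      rw [map_sum]
      exact Finset.sum_congr rfl fun a _ => if_pos hσ
    rw [if_pos hσ.symm, LinearMap.sub_apply, actDel_emb, actFun_lam_emb, hc, hgi]
    have hm : mulDel F = Polynomial.X * F + ∑ a ∈ I, Polynomial.C (geom (zv (τ⁻¹ a)) ^ 2) *
        ∏ b ∈ I.erase a, rowFactor σ τ b :=
      mulDel_prod_factor I (fun a => σ a = a) (fun a => lv a) fun a => zv (τ⁻¹ a)
    rw [hm, rowFactor, factor, if_pos hσ, sub_mul, sub_mul, map_add, map_sub, map_sub]
    abel
  · have hc : ∑ a ∈ I, contraction τ i a σ = 0 := Finset.sum_eq_zero fun a _ => if_neg hσ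
    have h1 : rowFactor σ τ i * F = -(Polynomial.C (geom (zv (τ⁻¹ i))) * F) := by
      rw [rowFactor_of_ne hσ]; ring
    rw [if_neg (Ne.symm hσ), hc, h1, LinearMap.zero_apply, map_neg]
    abel

/-- The action of the universal operator on `ε_τ`. -/
theorem evalAt_universalOperator (τ : Equiv.Perm (Fin N)) :
    evalAt (epsF τ) (symbol (universalOperator N)) =
      ∑ σ : Equiv.Perm (Fin N), ((Equiv.Perm.sign σ : ℤˣ) : ℤ) •
        emb (σ * τ : Equiv.Perm (Fin N)) (∏ a, rowFactor σ τ a) := by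
  have hentry : ∀ (i j : Fin N) (P : DiffOp (UL N)), evalAt (epsF τ)
      (((if i = j then mulDel - mulFun (PowerSeries.C (lamUL N i)) else 0) -
        mulFun (eSeries N j i)) P) = actEntry i j (evalAt (epsF τ) P) := by
    intro i j P
    rw [actEntry]
    split_ifs <;> simp [evalAt_mulFun, evalAt_mulDel]
  have hlist : ∀ (l : List (Fin N × Fin N)) (P : DiffOp (UL N)), evalAt (epsF τ)
      ((l.map fun p => ((if p.1 = p.2 then mulDel - mulFun (PowerSeries.C (lamUL N p.1)) else 0) -
        mulFun (eSeries N p.2 p.1))).prod P) =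
      (l.map fun p => actEntry p.1 p.2).prod (evalAt (epsF τ) P) := by
    intro l
    induction l with
    | nil => intro P; simp
    | cons p l ih =>
      intro P
      rw [List.map_cons, List.prod_cons, Module.End.mul_apply, hentry, ih, List.map_cons,
        List.prod_cons, Module.End.mul_apply]
  have hone : ∀ σ, evalAt (epsF τ) (1 : DiffOp (UL N)) = rowState τ N σ := by
    intro σ
    have h1 : part N σ ∘ τ = τ := by
      funext k
      simp [part, (τ k).is_lt]
    have h2 : (Finset.univ.filter fun a : Fin N => N ≤ a) = ∅ := by
      ext a
      simp [a.is_lt]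
    rw [rowState, h1, h2, Finset.prod_empty]
    ext1 k; ext1 j
    rw [evalAt_apply, emb_apply, Polynomial.coeff_one, Polynomial.coeff_one]
    split_ifs
    · rw [PowerSeries.coeff_one, PowerSeries.coeff_one]
      split_ifs <;> simp
    · simp
  have hmain := sum_sign_prod_apply N actEntry (rowState τ) (contraction τ)
    fun i σ => actEntry_rowState τ σ i
  rw [symbol, universalOperator, rdet, LinearMap.sum_apply, map_sum]
  refine Eq.trans (Finset.sum_congr rfl fun σ _ => ?_) (hmain.trans
    (Finset.sum_congr rfl fun σ _ => ?_))
  · rw [LinearMap.smul_apply, map_zsmul, ← hone σ]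
    congr 1
    have := hlist (List.ofFn fun i => (i, σ i)) 1
    rw [List.map_ofFn, List.map_ofFn] at this
    exact this
  · congr 1
    rw [rowState]
    have h1 : part 0 σ ∘ τ = (σ * τ : Equiv.Perm (Fin N)) := by
      funext k
      simp [part]
    rw [h1]
    simp

/-! ### The weight space -/

/-- The standard basis of `V^{⊗N}`. -/
def tensorBasis (N : ℕ) : Module.Basis (Fin N → Fin N) ℂ (TensorPower N) :=
  Basis.piTensorProduct fun _ => Pi.basisFun ℂ (Fin N)

theorem tensorBasis_apply (g : Fin N → Fin N) :
    tensorBasis N g = PiTensorProduct.tprod ℂ fun k => (Pi.single (g k) 1 : Fin N → ℂ) := by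
  rw [tensorBasis, Basis.piTensorProduct_apply]
  simp

theorem glTensor_tensorBasis (i : Fin N) (g : Fin N → Fin N) :
    glTensor N i i (tensorBasis N g) =
      ((Finset.univ.filter fun k => g k = i).card : ℂ) • tensorBasis N g := by
  rw [tensorBasis_apply, glTensor, LinearMap.sum_apply]
  have : ∀ k, onFactor N k (eVec N i i)
      (PiTensorProduct.tprod ℂ fun k => (Pi.single (g k) 1 : Fin N → ℂ)) =
      if g k = i then PiTensorProduct.tprod ℂ fun k => (Pi.single (g k) 1 : Fin N → ℂ) else 0 := by
    intro k
    rw [onFactor_eps]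
    split_ifs with h
    · rw [← h, Function.update_eq_self]
    · rfl
  rw [Finset.sum_congr rfl fun k _ => this k, ← Finset.sum_filter, Finset.sum_const,
    Nat.cast_smul_eq_nsmul]

theorem repr_glTensor (i : Fin N) (v : TensorPower N) (g : Fin N → Fin N) :
    (tensorBasis N).repr (glTensor N i i v) g =
      ((Finset.univ.filter fun k => g k = i).card : ℂ) * (tensorBasis N).repr v g := by
  have : (tensorBasis N).coord g ∘ₗ glTensor N i i =
      ((Finset.univ.filter fun k => g k = i).card : ℂ) • (tensorBasis N).coord g := by
    refine (tensorBasis N).ext fun f => ?_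
    rw [LinearMap.comp_apply, glTensor_tensorBasis, map_smul, LinearMap.smul_apply,
      Module.Basis.coord_apply, Module.Basis.repr_self]
    by_cases h : f = g
    · rw [h]
    · simp [h]
  exact LinearMap.congr_fun this v

/-- A basis tensor has weight `(1, …, 1)` exactly when its indices form a permutation. -/
theorem weightOne_eq_span : weightOne N = Submodule.span ℂ (Set.range (eps N)) := by
  refine le_antisymm (fun v hv => ?_) (Submodule.span_le.2 ?_)
  · rw [← (tensorBasis N).sum_repr v]
    refine Submodule.sum_mem _ fun g _ => ?_
    by_cases hg : Function.Surjective g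
    · refine Submodule.smul_mem _ _ (Submodule.subset_span
        ⟨Equiv.ofBijective g (Finite.injective_iff_surjective.2 hg |>.bijective_of_finite), ?_⟩)
      rw [tensorBasis_apply]; rfl
    · obtain ⟨i, hi⟩ := not_forall.1 hg
      have h := repr_glTensor i v g
      rw [hv i, Finset.filter_eq_empty_iff.2 fun k _ hk => hi ⟨k, hk⟩] at h
      rw [h]
      simp
  · rintro _ ⟨τ, rfl⟩
    exact eps_mem N τ

theorem V1_eq_span :
    V1 N = Submodule.span (ZL N) (Set.range fun τ : Equiv.Perm (Fin N) => epsF τ) := by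
  rw [V1, weightOne_eq_span]
  refine (Submodule.baseChange_span (A := ZL N) _).trans ?_
  rw [← Set.range_comp]
  rfl

theorem linearIndependent_epsF :
    LinearIndependent (ZL N) fun τ : Equiv.Perm (Fin N) => epsF (τ : Fin N → Fin N) := by
  have h := ((tensorBasis N).baseChange (ZL N)).linearIndependent.comp
    (fun τ : Equiv.Perm (Fin N) => (τ : Fin N → Fin N)) DFunLike.coe_injective
  have h2 : (((tensorBasis N).baseChange (ZL N)) ∘ fun τ : Equiv.Perm (Fin N) =>
      (τ : Fin N → Fin N)) = fun τ : Equiv.Perm (Fin N) => epsF (τ : Fin N → Fin N) := by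
    funext τ
    rw [Function.comp_apply, Module.Basis.baseChange_apply, tensorBasis_apply]
    rfl
  rw [h2] at h
  exact h

/-- The basis of `𝒱₁` over `ℂ[z, λ]` that consists of the vectors `ε_τ`. -/
def basisV1 (N : ℕ) : Module.Basis (Equiv.Perm (Fin N)) (ZL N) (V1 N) :=
  (Module.Basis.span linearIndependent_epsF).map (LinearEquiv.ofEq _ _ V1_eq_span.symm)

theorem coe_epsV1 (τ : Equiv.Perm (Fin N)) : (epsV1 N τ : VSpace N) = epsF τ := rfl

theorem basisV1_apply (τ : Equiv.Perm (Fin N)) : basisV1 N τ = epsV1 N τ := by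
  refine Subtype.ext ?_
  rw [basisV1, Module.Basis.map_apply, LinearEquiv.coe_ofEq_apply, Module.Basis.span_apply]
  rfl

/-- The isomorphism `𝒱₁ ≃ H_N` with `p(z) q(λ) ε_τ ↦ q(x) τ p(y)`. -/
def iota (N : ℕ) : V1 N ≃ₗ[ℂ] H N :=
  (LinearEquiv.restrictScalars ℂ (basisV1 N).equivFun) ≪≫ₗ psiEquiv N

theorem iota_apply (f : V1 N) : iota N f = psi N ((basisV1 N).equivFun f) := rfl

theorem iota_smul (g : ZL N) (f : V1 N) : iota N (g • f) = theta N g (iota N f) := by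
  rw [iota_apply, map_smul, psi_smul, iota_apply]

theorem iota_epsV1 (τ : Equiv.Perm (Fin N)) : iota N (epsV1 N τ) = permH N τ := by
  have : (basisV1 N).equivFun (basisV1 N τ) = ev τ := by
    funext ρ
    rw [Module.Basis.equivFun_self]
    simp [Pi.single_apply, eq_comm]
  rw [iota_apply, ← basisV1_apply, this, psi_ev]

/-! ### The Bethe operators on the weight space -/

/-- The product of the factors `δ_{σ(a), a} (v - λ_a) - (u - z_{τ⁻¹(a)})⁻¹`. -/
def rowProd (σ τ : Equiv.Perm (Fin N)) : DiffOp (ZL N) := ∏ a, rowFactor σ τ a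

theorem ulAction_betheB (i : Fin N) (j : ℕ) (τ : Equiv.Perm (Fin N)) :
    ulAction N (betheB N i j) (epsF τ) = ∑ σ : Equiv.Perm (Fin N),
      ((Equiv.Perm.sign σ : ℤˣ) : ℤ) •
        (PowerSeries.coeff j ((rowProd σ τ).coeff (N - ((i : ℕ) + 1))) •
          epsF (σ * τ : Equiv.Perm (Fin N))) := by
  have := congrFun (congrFun (evalAt_universalOperator τ) (N - ((i : ℕ) + 1))) j
  rw [Finset.sum_apply, Finset.sum_apply] at this
  exact this

theorem epsF_mem (τ : Equiv.Perm (Fin N)) : epsF τ ∈ V1 N := (epsV1 N τ).2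

theorem bethePreserves (N : ℕ) : BethePreserves N := by
  intro b hb
  induction hb using Algebra.adjoin_induction with
  | mem b hb =>
    obtain ⟨i, j, rfl⟩ := hb
    intro x hx
    rw [V1_eq_span] at hx
    induction hx using Submodule.span_induction with
    | mem x hx =>
      obtain ⟨τ, rfl⟩ := hx
      rw [ulAction_betheB]
      exact Submodule.sum_mem _ fun σ _ => zsmul_mem (Submodule.smul_mem _ _ (epsF_mem _)) _
    | zero => rw [map_zero]; exact Submodule.zero_mem _
    | add x y _ _ hx hy => rw [map_add]; exact Submodule.add_mem _ hx hy
    | smul g x _ hx => rw [map_smul]; exact Submodule.smul_mem _ _ hx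
  | algebraMap c =>
    intro x hx
    rw [AlgHom.commutes, Algebra.algebraMap_eq_smul_one, LinearMap.smul_apply]
    exact Submodule.smul_of_tower_mem _ c hx
  | add a b _ _ ha hb =>
    intro x hx
    rw [map_add, LinearMap.add_apply]
    exact Submodule.add_mem _ (ha x hx) (hb x hx)
  | mul a b _ _ ha hb =>
    intro x hx
    rw [map_mul, Module.End.mul_apply]
    exact ha _ (hb x hx)

variable (hB : BethePreserves N)

theorem coe_betheBbar (i : Fin N) (j : ℕ) (f : V1 N) :
    (betheBbar N hB i j f : VSpace N) = ulAction N (betheB N i j) f := rfl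

theorem betheRep_smul (b : betheAlgebra N) (g : ZL N) (f : V1 N) :
    betheRep N hB b (g • f) = g • betheRep N hB b f :=
  Subtype.ext (map_smul (ulAction N (b : UL N)) g (f : VSpace N))

theorem betheBbar_smul (i : Fin N) (j : ℕ) (g : ZL N) (f : V1 N) :
    betheBbar N hB i j (g • f) = g • betheBbar N hB i j f := betheRep_smul hB _ g f

theorem betheBbar_epsV1 (i : Fin N) (j : ℕ) (τ : Equiv.Perm (Fin N)) :
    betheBbar N hB i j (epsV1 N τ) = ∑ σ : Equiv.Perm (Fin N),
      (((Equiv.Perm.sign σ : ℤˣ) : ℤ) •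
        PowerSeries.coeff j ((rowProd σ τ).coeff (N - ((i : ℕ) + 1)))) • epsV1 N (σ * τ) := by
  refine Subtype.ext ?_
  rw [coe_betheBbar, coe_epsV1, ulAction_betheB, Submodule.coe_sum]
  refine Finset.sum_congr rfl fun σ _ => ?_
  rw [smul_assoc, Submodule.coe_smul_of_tower, Submodule.coe_smul, coe_epsV1]

/-! ### The universal Bethe polynomial -/

section LaurentSeries

variable {K : Type*} [CommRing K]

/-- The series `u - z`. -/
def uSub {E : Type*} [Ring E] (z : E) : USeries E :=
  HahnSeries.single (-1) 1 - HahnSeries.single 0 z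

theorem single_neg_one_mul_X :
    (HahnSeries.single (-1) 1 : LaurentSeries K) * HahnSeries.ofPowerSeries ℤ K PowerSeries.X =
      1 := by
  rw [HahnSeries.ofPowerSeries_X, HahnSeries.single_mul_single]
  simp

theorem uSub_mul_geom (z : K) : uSub z * HahnSeries.ofPowerSeries ℤ K (geom z) = 1 := by
  have h := congrArg (HahnSeries.ofPowerSeries ℤ K) (geom_eq z)
  rw [map_mul, map_add, map_mul, map_one, HahnSeries.ofPowerSeries_C] at h
  have h1 := single_neg_one_mul_X (K := K)
  have h2 : (HahnSeries.single 0 z : LaurentSeries K) = HahnSeries.C z := rfl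
  rw [uSub, h2]
  linear_combination (HahnSeries.single (-1) 1 : LaurentSeries K) * h +
    (1 + HahnSeries.C z * HahnSeries.ofPowerSeries ℤ K (geom z)) * h1

/-- Polynomials in `u` as Laurent series in `u⁻¹`. -/
def uPoly (K : Type*) [CommRing K] : Polynomial K →+* LaurentSeries K :=
  Polynomial.eval₂RingHom HahnSeries.C (HahnSeries.single (-1) 1)

theorem uPoly_C (c : K) : uPoly K (Polynomial.C c) = HahnSeries.C c := by simp [uPoly]

theorem uPoly_X : uPoly K Polynomial.X = HahnSeries.single (-1) 1 := by simp [uPoly]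

theorem uPoly_monomial (m : ℕ) (c : K) :
    uPoly K (Polynomial.monomial m c) = HahnSeries.single (-(m : ℤ)) c := by
  rw [← Polynomial.C_mul_X_pow_eq_monomial, map_mul, map_pow, uPoly_C, uPoly_X,
    HahnSeries.single_pow, HahnSeries.C_apply, HahnSeries.single_mul_single]
  simp

theorem coeff_uPoly_neg (p : Polynomial K) (m : ℕ) : (uPoly K p).coeff (-(m : ℤ)) = p.coeff m := by
  induction p using Polynomial.induction_on' with
  | add p q hp hq => rw [map_add, HahnSeries.coeff_add, hp, hq, Polynomial.coeff_add]
  | monomial n a =>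
    rw [uPoly_monomial, HahnSeries.coeff_single, Polynomial.coeff_monomial]
    simp [eq_comm]

theorem coeff_uPoly_pos (p : Polynomial K) {k : ℤ} (hk : 0 < k) : (uPoly K p).coeff k = 0 := by
  induction p using Polynomial.induction_on' with
  | add p q hp hq => rw [map_add, HahnSeries.coeff_add, hp, hq, add_zero]
  | monomial n a =>
    rw [uPoly_monomial, HahnSeries.coeff_single, if_neg]
    omega

theorem C_uSub_mul_factor (p : Prop) [Decidable p] (l z : K) :
    Polynomial.C (uSub z) * (factor p l (geom z)).map (HahnSeries.ofPowerSeries ℤ K) =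
      if p then -(1 - (Polynomial.X - Polynomial.C (Polynomial.C l)) *
        (Polynomial.C Polynomial.X - Polynomial.C (Polynomial.C z)) :
          Polynomial (Polynomial K)).map (uPoly K) else -1 := by
  have h : Polynomial.C (uSub z) * Polynomial.C (HahnSeries.ofPowerSeries ℤ K (geom z)) = 1 := by
    rw [← map_mul, uSub_mul_geom, map_one]
  rw [factor, Polynomial.map_sub, Polynomial.map_C, mul_sub, h]
  split_ifs
  · have hz : Polynomial.C (uSub z) = Polynomial.C (HahnSeries.single (-1) 1) -
        Polynomial.C (HahnSeries.C z) := by rw [uSub, ← map_sub]; rfl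
    simp only [Polynomial.map_sub, Polynomial.map_mul, Polynomial.map_X, Polynomial.map_C,
      uPoly_X, uPoly_C, HahnSeries.ofPowerSeries_C, Polynomial.map_one, hz]
    ring
  · simp

/-- Clearing denominators: `(u - z)` times `v - l - (u - z)⁻¹` is `-(1 - (v - l)(u - z))`, and
`(u - z)` times `-(u - z)⁻¹` is `-1`. -/
theorem prod_C_uSub_mul_factor {ι : Type*} [Fintype ι] (p : ι → Prop) [DecidablePred p]
    (l z : ι → K) :
    Polynomial.C (∏ a, uSub (z a)) *
        (∏ a, factor (p a) (l a) (geom (z a))).map (HahnSeries.ofPowerSeries ℤ K) =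
      (-1) ^ Fintype.card ι * (∏ a with p a,
        (1 - (Polynomial.X - Polynomial.C (Polynomial.C (l a))) *
        (Polynomial.C Polynomial.X - Polynomial.C (Polynomial.C (z a))) :
          Polynomial (Polynomial K))).map (uPoly K) := by
  rw [map_prod, Polynomial.map_prod, ← Finset.prod_mul_distrib, Polynomial.map_prod,
    Finset.prod_filter, ← Finset.card_univ, ← Finset.prod_const, ← Finset.prod_mul_distrib]
  refine Finset.prod_congr rfl fun a _ => ?_
  rw [C_uSub_mul_factor]
  split_ifs
  · ring
  · simp

theorem natDegree_factor_le (p : Prop) [Decidable p] (l : K) (ζ : PowerSeries K) :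
    (factor p l ζ).natDegree ≤ 1 := by
  rw [factor]
  split_ifs
  · rw [sub_sub, ← map_add]
    exact (Polynomial.natDegree_sub_le _ _).trans
      (max_le Polynomial.natDegree_X_le (by simp))
  · simp

theorem coeff_one_factor (p : Prop) [Decidable p] (l : K) (ζ : PowerSeries K) :
    (factor p l ζ).coeff 1 = if p then 1 else 0 := by
  rw [factor]
  split_ifs <;> simp

end LaurentSeries

theorem coeff_rowProd_of_lt (σ τ : Equiv.Perm (Fin N)) {n : ℕ} (hn : N < n) :
    (rowProd σ τ).coeff n = 0 := by
  refine Polynomial.coeff_eq_zero_of_natDegree_lt (lt_of_le_of_lt ?_ hn)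
  refine (Polynomial.natDegree_prod_le _ _).trans ?_
  refine (Finset.sum_le_card_nsmul _ _ 1 fun a _ => natDegree_factor_le _ _ _).trans ?_
  simp

theorem coeff_rowProd_self (σ τ : Equiv.Perm (Fin N)) :
    (rowProd σ τ).coeff N = if σ = 1 then 1 else 0 := by
  have h := Polynomial.coeff_prod_of_natDegree_le Finset.univ (rowFactor σ τ) 1
    fun a _ => natDegree_factor_le _ _ _
  rw [Finset.card_univ, Fintype.card_fin, mul_one] at h
  rw [rowProd, h]
  simp only [rowFactor, coeff_one_factor]
  by_cases hσ : σ = 1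
  · subst hσ; simp
  · rw [if_neg hσ]
    obtain ⟨a, ha⟩ : ∃ a, σ a ≠ a := by
      by_contra hne
      push Not at hne
      exact hσ (Equiv.ext hne)
    exact Finset.prod_eq_zero (Finset.mem_univ a) (if_neg ha)

/-- The monic polynomial `v^N + ∑ B̄_{ij} u^{-j} v^{N-i}`. -/
def betheSeries : Polynomial (USeries (Module.End ℂ (V1 N))) :=
  Polynomial.X ^ N + ∑ i : Fin N,
      Polynomial.C (HahnSeries.ofPowerSeries ℤ _ (PowerSeries.mk fun j => betheBbar N hB i j)) *
        Polynomial.X ^ (N - ((i : ℕ) + 1))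

theorem bethePoly_eq : bethePoly N hB = Polynomial.C (prodSub (zMul N)) * betheSeries hB := rfl

theorem coeff_betheSeries_of_lt {n : ℕ} (hn : n < N) :
    (betheSeries hB).coeff n = HahnSeries.ofPowerSeries ℤ _
      (PowerSeries.mk fun j => betheBbar N hB ⟨N - (n + 1), by omega⟩ j) := by
  rw [betheSeries, Polynomial.coeff_add, Polynomial.finsetSum_coeff, Polynomial.coeff_X_pow,
    if_neg hn.ne, zero_add, Finset.sum_eq_single ⟨N - (n + 1), by omega⟩]
  · rw [Polynomial.coeff_C_mul, Polynomial.coeff_X_pow, if_pos, mul_one]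
    dsimp only
    omega
  · intro i _ hi
    rw [Polynomial.coeff_C_mul, Polynomial.coeff_X_pow, if_neg, mul_zero]
    intro h
    apply hi
    ext
    dsimp only
    omega
  · simp

theorem coeff_betheSeries_of_le {n : ℕ} (hn : N ≤ n) :
    (betheSeries hB).coeff n = if n = N then 1 else 0 := by
  rw [betheSeries, Polynomial.coeff_add, Polynomial.finsetSum_coeff, Polynomial.coeff_X_pow,
    Finset.sum_eq_zero, add_zero]
  intro i _
  rw [Polynomial.coeff_C_mul, Polynomial.coeff_X_pow, if_neg, mul_zero]
  have := i.is_lt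
  omega

theorem coeff_ofPowerSeries_neg {R : Type*} [Semiring R] (f : PowerSeries R) {k : ℤ} (hk : k < 0) :
    (HahnSeries.ofPowerSeries ℤ R f).coeff k = 0 := by
  rw [HahnSeries.ofPowerSeries_apply, HahnSeries.embDomain_of_notMem_range]
  rintro ⟨n, rfl⟩
  simp only [Nat.castOrderEmbedding_apply] at hk
  omega

theorem coeff_betheSeries_smul (n : ℕ) (k : ℤ) (g : ZL N) (f : V1 N) :
    ((betheSeries hB).coeff n).coeff k (g • f) = g • ((betheSeries hB).coeff n).coeff k f := by
  rcases lt_or_ge n N with hn | hn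
  · rw [coeff_betheSeries_of_lt hB hn]
    rcases lt_or_ge k 0 with hk | hk
    · rw [coeff_ofPowerSeries_neg _ hk]; simp
    · obtain ⟨j, rfl⟩ := Int.eq_ofNat_of_zero_le hk
      rw [HahnSeries.ofPowerSeries_apply_coeff, PowerSeries.coeff_mk, betheBbar_smul]
  · rw [coeff_betheSeries_of_le hB hn]
    split_ifs
    · rw [HahnSeries.coeff_one]
      split_ifs <;> simp
    · simp

theorem coeff_betheSeries_epsV1 (n : ℕ) (k : ℤ) (τ : Equiv.Perm (Fin N)) :
    ((betheSeries hB).coeff n).coeff k (epsV1 N τ) = ∑ σ : Equiv.Perm (Fin N),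
      (((Equiv.Perm.sign σ : ℤˣ) : ℤ) •
        HahnSeries.ofPowerSeries ℤ _ ((rowProd σ τ).coeff n)).coeff k • epsV1 N (σ * τ) := by
  rcases lt_or_ge n N with hn | hn
  · rw [coeff_betheSeries_of_lt hB hn]
    rcases lt_or_ge k 0 with hk | hk
    · rw [coeff_ofPowerSeries_neg _ hk, Finset.sum_eq_zero, LinearMap.zero_apply]
      intro σ _
      rw [HahnSeries.coeff_smul, coeff_ofPowerSeries_neg _ hk, smul_zero, zero_smul]
    · obtain ⟨j, rfl⟩ := Int.eq_ofNat_of_zero_le hk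
      rw [HahnSeries.ofPowerSeries_apply_coeff, PowerSeries.coeff_mk, betheBbar_epsV1]
      refine Finset.sum_congr rfl fun σ _ => ?_
      rw [HahnSeries.coeff_smul, HahnSeries.ofPowerSeries_apply_coeff]
      congr 4
      dsimp only
      omega
  · rw [coeff_betheSeries_of_le hB hn]
    rcases hn.eq_or_lt with rfl | hn
    · rw [if_pos rfl, Finset.sum_eq_single 1]
      · rw [coeff_rowProd_self, if_pos rfl, map_one, map_one, one_mul]
        simp only [Units.val_one, one_smul, HahnSeries.coeff_one]
        split_ifs <;> simp
      · intro σ _ hσ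
        rw [coeff_rowProd_self, if_neg hσ]
        simp
      · simp
    · rw [if_neg hn.ne', Finset.sum_eq_zero]
      · simp
      · intro σ _
        rw [coeff_rowProd_of_lt _ _ hn]
        simp

theorem coeff_sub_single_mul {E : Type*} [Ring E] (a : E) (Q : USeries E) (k : ℤ) :
    ((HahnSeries.single (-1) 1 - HahnSeries.single 0 a : USeries E) * Q).coeff k =
      Q.coeff (k + 1) - a * Q.coeff k := by
  rw [sub_mul, HahnSeries.coeff_sub, HahnSeries.coeff_single_mul, HahnSeries.coeff_single_zero_mul,
    one_mul, sub_neg_eq_add]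

theorem coeff_bethePoly (n : ℕ) : (bethePoly N hB).coeff n =
    ((List.ofFn id).map fun i => uSub (zMul N i)).prod * (betheSeries hB).coeff n := by
  rw [bethePoly_eq, Polynomial.coeff_C_mul, List.map_ofFn]
  rfl

theorem coeff_uSub_zMul_mul_apply (i : Fin N) (Q : USeries (Module.End ℂ (V1 N))) (k : ℤ)
    (f : V1 N) :
    (uSub (zMul N i) * Q).coeff k f = Q.coeff (k + 1) f - (zv i : ZL N) • Q.coeff k f := by
  rw [uSub, coeff_sub_single_mul]
  rfl

theorem coeff_bethePoly_smul (n : ℕ) (k : ℤ) (g : ZL N) (f : V1 N) :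
    ((bethePoly N hB).coeff n).coeff k (g • f) = g • ((bethePoly N hB).coeff n).coeff k f := by
  rw [coeff_bethePoly]
  generalize List.ofFn id = l
  induction l generalizing k with
  | nil => simp [coeff_betheSeries_smul]
  | cons i l ih =>
    rw [List.map_cons, List.prod_cons, mul_assoc, coeff_uSub_zMul_mul_apply,
      coeff_uSub_zMul_mul_apply, ih, ih, smul_sub, smul_comm g]

theorem sub_mul_smul {R M : Type*} [CommRing R] [AddCommGroup M] [Module R M] (a z b : R) (x : M) :
    (a - z * b) • x = a • x - z • b • x := by
  rw [sub_smul, mul_smul]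

/-- Multiplication of a series of operators by `∏ (u - z_i)`, in terms of the coefficients of its
values at a vector `x`. -/
theorem coeff_prod_mul_apply (Q : USeries (Module.End ℂ (V1 N))) (x : V1 N)
    (e : Equiv.Perm (Fin N) → V1 N) (G : Equiv.Perm (Fin N) → LaurentSeries (ZL N))
    (h : ∀ k, Q.coeff k x = ∑ σ, (G σ).coeff k • e σ) (l : List (Fin N)) (k : ℤ) :
    ((l.map fun i => uSub (zMul N i)).prod * Q).coeff k x =
      ∑ σ, ((l.map fun i => uSub (zv i : ZL N)).prod * G σ).coeff k • e σ := by
  induction l generalizing k with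
  | nil => simp [h]
  | cons i l ih =>
    rw [List.map_cons, List.prod_cons, mul_assoc, coeff_uSub_zMul_mul_apply, ih, ih,
      Finset.smul_sum, ← Finset.sum_sub_distrib]
    refine Finset.sum_congr rfl fun σ _ => ?_
    rw [List.map_cons, List.prod_cons, mul_assoc, uSub, coeff_sub_single_mul]
    exact (sub_mul_smul _ _ _ _).symm

theorem mul_zsmul_of_mul_eq {R : Type*} [CommRing R] {n : ℕ} {w f g : R} (c : ℤ)
    (h : w * f = (-1) ^ n * g) : w * (c • f) = ((-1) ^ n * c) • g := by
  rw [zsmul_eq_mul, zsmul_eq_mul]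
  push_cast
  linear_combination (c : R) * h

/-- The universal Bethe polynomial applied to `ε_τ`: the denominators `u - z_i` cancel, and what is
left is the product over the fixed points of each permutation. -/
theorem coeff_bethePoly_epsV1 (n : ℕ) (k : ℤ) (τ : Equiv.Perm (Fin N)) :
    ((bethePoly N hB).coeff n).coeff k (epsV1 N τ) = ∑ σ : Equiv.Perm (Fin N),
      ((-1) ^ N * ((Equiv.Perm.sign σ : ℤˣ) : ℤ)) •
        ((uPoly (ZL N) ((fixProd σ (σ * τ)).coeff n)).coeff k • epsV1 N (σ * τ)) := by
  have h := coeff_prod_mul_apply ((betheSeries hB).coeff n) (epsV1 N τ) _ _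
    (fun k => coeff_betheSeries_epsV1 hB n k τ) (List.ofFn id) k
  rw [coeff_bethePoly]
  refine h.trans (Finset.sum_congr rfl fun σ _ => ?_)
  have h1 : ((List.ofFn id).map fun i => uSub (zv i : ZL N)).prod =
      ∏ a, uSub (zv (τ⁻¹ a) : ZL N) := by
    rw [List.map_ofFn, List.prod_ofFn, ← Equiv.prod_comp τ⁻¹]; rfl
  have h2 := prod_C_uSub_mul_factor (K := ZL N) (fun a => σ a = a) (fun a => lv a)
    fun a => zv (τ⁻¹ a)
  have h3 : fixProd σ (σ * τ) = ∏ a with σ a = a,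
        (1 - (Polynomial.X - Polynomial.C (Polynomial.C (lv a))) *
        (Polynomial.C Polynomial.X - Polynomial.C (Polynomial.C (zv (τ⁻¹ a)))) :
          Polynomial (Polynomial (ZL N))) := by
    rw [fixProd]
    refine Finset.prod_congr rfl fun a ha => ?_
    have : (σ * τ)⁻¹ a = τ⁻¹ a := by
      rw [mul_inv_rev, Equiv.Perm.mul_apply]
      congr 1
      exact Equiv.Perm.inv_eq_iff_eq.2 (Finset.mem_filter.1 ha).2.symm
    rw [this]
  rw [← h3] at h2
  have h4 := congrArg (fun P => Polynomial.coeff P n) h2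
  have hsign : ((-1) ^ Fintype.card (Fin N) : Polynomial (LaurentSeries (ZL N))) =
      Polynomial.C ((-1) ^ N) := by simp
  simp only [hsign, Polynomial.coeff_C_mul, Polynomial.coeff_map] at h4
  have h5 := mul_zsmul_of_mul_eq ((Equiv.Perm.sign σ : ℤˣ) : ℤ) h4
  rw [h1, rowProd]
  refine (congrArg (fun S : LaurentSeries (ZL N) => S.coeff k • epsV1 N (σ * τ)) h5).trans ?_
  rw [HahnSeries.coeff_smul, smul_assoc]

/-! ### The intertwining property -/

/-- A linear map out of `𝒱₁` is determined by its values at the vectors `g ε_τ`. -/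
theorem V1_ext {K : Type*} [AddCommGroup K] [Module ℂ K] {S T : V1 N →ₗ[ℂ] K}
    (h : ∀ (g : ZL N) (τ : Equiv.Perm (Fin N)), S (g • epsV1 N τ) = T (g • epsV1 N τ)) : S = T := by
  refine LinearMap.ext fun f => ?_
  rw [← (basisV1 N).sum_equivFun f, map_sum, map_sum]
  exact Finset.sum_congr rfl fun τ _ => by rw [basisV1_apply, h]

/-- Multiplication by a central element commutes with the action of `ℂ[z, λ]` on `H_N`. -/
theorem theta_mul_of_comm {c : H N} (hc : ∀ h, c * h = h * c) (g : ZL N) (h : H N) :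
    theta N g (c * h) = c * theta N g h := by
  induction g using MvPolynomial.induction_on generalizing h with
  | C a =>
    rw [← MvPolynomial.algebraMap_eq, AlgHom.commutes, Algebra.algebraMap_eq_smul_one,
      LinearMap.smul_apply, LinearMap.smul_apply, Module.End.one_apply, Module.End.one_apply,
      mul_smul_comm]
  | add p q hp hq => rw [map_add, LinearMap.add_apply, LinearMap.add_apply, hp, hq, mul_add]
  | mul_X p i hp =>
    rw [map_mul (theta N), Module.End.mul_apply, Module.End.mul_apply]
    rcases i with i | i
    · rw [theta_zv, theta_zv, mul_assoc, hp]
    · rw [theta_lv, theta_lv, ← mul_assoc, ← hc, mul_assoc, hp]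

theorem coeff_bethePoly_pos (n : ℕ) {k : ℤ} (hk : 0 < k) :
    ((bethePoly N hB).coeff n).coeff k = 0 := by
  refine V1_ext fun g τ => ?_
  rw [coeff_bethePoly_smul, coeff_bethePoly_epsV1, Finset.sum_eq_zero]
  · rw [smul_zero]; rfl
  · intro σ _
    rw [coeff_uPoly_pos _ hk, zero_smul, smul_zero]

/-- Both sides commute with `ℂ[z, λ]`, because the coefficients of the universal central polynomial
are central; on the vectors `ε_τ` the two formulas agree term by term. -/
theorem iota_coeff_bethePoly (m n : ℕ) (f : V1 N) :
    iota N (((bethePoly N hB).coeff n).coeff (-(m : ℤ)) f) =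
      ((centralPoly N).coeff n).coeff m * iota N f := by
  have : (iota N : V1 N →ₗ[ℂ] H N) ∘ₗ ((bethePoly N hB).coeff n).coeff (-(m : ℤ)) =
      LinearMap.mulLeft ℂ (((centralPoly N).coeff n).coeff m) ∘ₗ (iota N : V1 N →ₗ[ℂ] H N) := by
    refine V1_ext fun g τ => ?_
    change iota N (((bethePoly N hB).coeff n).coeff (-(m : ℤ)) (g • epsV1 N τ)) =
      ((centralPoly N).coeff n).coeff m * iota N (g • epsV1 N τ)
    rw [coeff_bethePoly_smul, iota_smul, iota_smul, iota_epsV1,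
      ← theta_mul_of_comm (coeff_centralPoly_comm n m), coeff_centralPoly_mul_permH,
      coeff_bethePoly_epsV1, map_sum]
    congr 1
    refine Finset.sum_congr rfl fun σ _ => ?_
    rw [map_zsmul, iota_smul, iota_epsV1, coeff_uPoly_neg]
  exact LinearMap.congr_fun this f

theorem iota_polyZ_mul_polyLam_smul (p q : MvPolynomial (Fin N) ℂ) (τ : Equiv.Perm (Fin N)) :
    iota N ((polyZ N p * polyLam N q) • epsV1 N τ) =
      evalPoly xH q * permH N τ * evalPoly yH p := by
  rw [iota_smul, iota_epsV1, map_mul (theta N), Module.End.mul_apply, theta_polyLam, theta_polyZ,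
    evalPoly_eq_evalHom xH xH_comm, evalPoly_eq_evalHom yH yH_comm]

/-! ### The filtration by the degree in `z` -/

/-- The homomorphism `z_i ↦ z_i T`, `λ_i ↦ λ_i`, which records the degree in `z`. -/
def zScale (N : ℕ) : ZL N →ₐ[ℂ] Polynomial (ZL N) :=
  MvPolynomial.aeval (Sum.elim (fun i => Polynomial.C (zv i) * Polynomial.X)
    fun i => Polynomial.C (lv i))

theorem zScale_zv (i : Fin N) : zScale N (zv i) = Polynomial.C (zv i) * Polynomial.X := by
  simp [zScale]

theorem zScale_lv (i : Fin N) : zScale N (lv i) = Polynomial.C (lv i) := by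
  simp [zScale]

theorem eval_one_zScale (g : ZL N) : (zScale N g).eval 1 = g := by
  induction g using MvPolynomial.induction_on with
  | C c => rw [← MvPolynomial.algebraMap_eq, AlgHom.commutes]; simp [Polynomial.algebraMap_apply]
  | add p q hp hq => rw [map_add, Polynomial.eval_add, hp, hq]
  | mul_X p i hp =>
    rw [map_mul, Polynomial.eval_mul, hp]
    rcases i with i | i
    · rw [zScale_zv]; simp
    · rw [zScale_lv]; simp

/-- The polynomials of degree less than `d` in the variables `z`. -/
def degLT (N : ℕ) (d : ℕ) : Submodule ℂ (ZL N) :=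
  ((Polynomial.degreeLT (ZL N) d).restrictScalars ℂ).comap (zScale N).toLinearMap

theorem mem_degLT {d : ℕ} {g : ZL N} : g ∈ degLT N d ↔ (zScale N g).degree < d :=
  Polynomial.mem_degreeLT

theorem degLT_mono {d e : ℕ} (h : d ≤ e) : degLT N d ≤ degLT N e := fun _ hg =>
  mem_degLT.2 ((mem_degLT.1 hg).trans_le (by exact_mod_cast h))

theorem eq_zero_of_mem_degLT_zero {g : ZL N} (hg : g ∈ degLT N 0) : g = 0 := by
  have h := mem_degLT.1 hg
  rw [Nat.cast_zero, ← Polynomial.degree_one (R := ZL N)] at h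
  have h0 : zScale N g = 0 := by
    rw [← Polynomial.degree_eq_bot]
    rw [Polynomial.degree_one] at h
    exact Nat.WithBot.lt_zero_iff.1 h
  rw [← eval_one_zScale g, h0, Polynomial.eval_zero]

theorem exists_mem_degLT (g : ZL N) : ∃ d, g ∈ degLT N d :=
  ⟨(zScale N g).natDegree + 1, mem_degLT.2 (lt_of_le_of_lt Polynomial.degree_le_natDegree
    (by exact_mod_cast Nat.lt_succ_self _))⟩

theorem mul_mem_degLT {d e : ℕ} {g h : ZL N} (hg : g ∈ degLT N (d + 1)) (hh : h ∈ degLT N e) :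
    g * h ∈ degLT N (d + e) := by
  rw [mem_degLT, map_mul, Polynomial.degree_mul]
  by_cases hg0 : (zScale N g).degree = ⊥
  · rw [hg0, WithBot.bot_add]; exact WithBot.bot_lt_coe _
  · have h1 : (zScale N g).degree ≤ d := by
      have := mem_degLT.1 hg
      have h0 : zScale N g ≠ 0 := fun h0 => hg0 (by rw [h0, Polynomial.degree_zero])
      exact Polynomial.degree_le_of_natDegree_le
        (Nat.lt_succ_iff.1 ((Polynomial.natDegree_lt_iff_degree_lt h0).2 this))
    push_cast
    calc _ < (zScale N g).degree + (e : WithBot ℕ) :=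
          WithBot.add_lt_add_left hg0 (mem_degLT.1 hh)
      _ ≤ d + e := by gcongr

/-- Degrees in `z` add up under multiplication, because `ℂ[z, λ]` is a domain. -/
theorem mem_degLT_of_zScale_eq_C_mul {g h a : ZL N} {d e : ℕ} (ha : a ≠ 0)
    (hh : h ∈ degLT N (d + e)) (heq : zScale N h = Polynomial.C a * Polynomial.X ^ e * zScale N g) :
    g ∈ degLT N d := by
  rw [mem_degLT, heq, Polynomial.degree_mul, Polynomial.degree_C_mul_X_pow _ ha, add_comm] at hh
  push_cast at hh
  rw [mem_degLT]
  exact lt_of_add_lt_add_right hh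

theorem lv_mem_degLT (i : Fin N) : (lv i : ZL N) ∈ degLT N 1 := by
  rw [mem_degLT, zScale_lv]
  exact lt_of_le_of_lt Polynomial.degree_C_le (by norm_num)

theorem one_mem_degLT : (1 : ZL N) ∈ degLT N 1 := by
  rw [mem_degLT, map_one, Polynomial.degree_one]
  norm_num

theorem zv_pow_mem_degLT (i : Fin N) (b : ℕ) : (zv i ^ b : ZL N) ∈ degLT N (b + 1) := by
  rw [mem_degLT, map_pow, zScale_zv, mul_pow, ← map_pow]
  exact lt_of_le_of_lt (Polynomial.degree_C_mul_X_pow_le _ _) (by exact_mod_cast Nat.lt_succ_self b)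

theorem zScale_permLam (σ : Equiv.Perm (Fin N)) (g : ZL N) :
    zScale N (permLam σ g) = (zScale N g).map (permLam σ : ZL N →+* ZL N) := by
  have : (zScale N).comp (permLam σ) = (Polynomial.mapAlgHom (permLam σ)).comp (zScale N) := by
    refine MvPolynomial.algHom_ext fun i => ?_
    rcases i with i | i
    · simp [zScale_zv]
    · simp [zScale_lv]
  exact AlgHom.congr_fun this g

theorem permLam_mem_degLT (σ : Equiv.Perm (Fin N)) {d : ℕ} {g : ZL N} (hg : g ∈ degLT N d) :
    permLam σ g ∈ degLT N d := by
  rw [mem_degLT, zScale_permLam]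
  exact lt_of_le_of_lt Polynomial.degree_map_le (mem_degLT.1 hg)

theorem divDiff_mem_degLT (i j : Fin N) {d : ℕ} {g : ZL N} (hg : g ∈ degLT N d) :
    divDiff i j g ∈ degLT N d := by
  by_cases h : i = j
  · subst h; rw [divDiff_self]; exact Submodule.zero_mem _
  · refine mem_degLT_of_zScale_eq_C_mul (e := 0) (lv_sub_ne_zero h)
      (Submodule.sub_mem _ hg (permLam_mem_degLT (Equiv.swap i j) hg)) ?_
    rw [← mul_divDiff, map_mul, map_sub, zScale_lv, zScale_lv, map_sub, pow_zero, mul_one]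

theorem mem_degLT_of_zv_sub_mul {j k : Fin N} (hjk : j ≠ k) {d : ℕ} {g : ZL N}
    (hg : (zv j - zv k) * g ∈ degLT N (d + 1)) : g ∈ degLT N d := by
  have h0 : (zv j - zv k : ZL N) ≠ 0 := by
    rw [sub_ne_zero]
    exact fun e => hjk (Sum.inl_injective (MvPolynomial.X_injective e))
  refine mem_degLT_of_zScale_eq_C_mul h0 hg ?_
  rw [map_mul, map_sub, zScale_zv, zScale_zv, map_sub]
  ring

/-- The degree of a monomial in the variables `z`. -/
def zDeg (m : Fin N ⊕ Fin N →₀ ℕ) : ℕ := ∑ i, m (Sum.inl i)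

theorem zScale_monomial (m : Fin N ⊕ Fin N →₀ ℕ) (c : ℂ) :
    zScale N (MvPolynomial.monomial m c) =
      Polynomial.monomial (zDeg m) (MvPolynomial.monomial m c) := by
  rw [zScale, MvPolynomial.aeval_monomial, Finsupp.prod_fintype _ _ fun _ => pow_zero _,
    Fintype.prod_sum_type, MvPolynomial.monomial_eq,
    Finsupp.prod_fintype _ _ fun _ => pow_zero _, Fintype.prod_sum_type]
  simp only [Sum.elim_inl, Sum.elim_inr, mul_pow, Finset.prod_mul_distrib,
    Finset.prod_pow_eq_pow_sum, ← Polynomial.C_mul_X_pow_eq_monomial, map_mul, map_prod, map_pow,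
    Polynomial.algebraMap_apply, MvPolynomial.algebraMap_eq, zDeg]
  ring

theorem zDeg_lt_of_mem_support {d : ℕ} {g : ZL N} (hg : g ∈ degLT N d)
    {m : Fin N ⊕ Fin N →₀ ℕ} (hm : m ∈ g.support) : zDeg m < d := by
  have key : ∀ g : ZL N, ((zScale N g).coeff (zDeg m)).coeff m = g.coeff m := by
    intro g
    induction g using MvPolynomial.induction_on' with
    | monomial m' c =>
      rw [zScale_monomial, Polynomial.coeff_monomial, MvPolynomial.coeff_monomial]
      split_ifs with h1 h2 h2
      · rw [MvPolynomial.coeff_monomial, if_pos h2]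
      · rw [MvPolynomial.coeff_monomial, if_neg h2]
      · exact absurd (congrArg zDeg h2) h1
      · rfl
    | add p q hp hq => rw [map_add, Polynomial.coeff_add, MvPolynomial.coeff_add, hp, hq,
        MvPolynomial.coeff_add]
  by_contra hlt
  refine MvPolynomial.mem_support_iff.1 hm ?_
  rw [← key, Polynomial.coeff_eq_zero_of_degree_lt, MvPolynomial.coeff_zero]
  exact (mem_degLT.1 hg).trans_le (by exact_mod_cast not_lt.1 hlt)

/-! ### The coefficients of central elements -/

/-- Right multiplication by `σ` permutes the variables `z`, which stand for the `y_i` on the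
right. -/
theorem theta_mul_permH (g : ZL N) (h : H N) (σ : Equiv.Perm (Fin N)) :
    theta N g h * permH N σ = theta N (permZ σ⁻¹ g) (h * permH N σ) := by
  induction g using MvPolynomial.induction_on generalizing h with
  | C a =>
    rw [← MvPolynomial.algebraMap_eq, AlgHom.commutes, AlgHom.commutes, AlgHom.commutes,
      Algebra.algebraMap_eq_smul_one, LinearMap.smul_apply, LinearMap.smul_apply,
      Module.End.one_apply, Module.End.one_apply, smul_mul_assoc]
  | add p q hp hq =>
    rw [map_add, LinearMap.add_apply, add_mul, hp, hq, map_add, map_add, LinearMap.add_apply]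
  | mul_X p i hp =>
    rw [map_mul (permZ σ⁻¹), map_mul (theta N), map_mul (theta N), Module.End.mul_apply,
      Module.End.mul_apply, hp]
    congr 1
    rcases i with i | i
    · have hy : permH N σ * yH (σ⁻¹ i) = yH (σ (σ⁻¹ i)) * permH N σ := (dataH N).s_y _ _
      rw [permZ_zv, theta_zv, theta_zv, mul_assoc, mul_assoc, hy, Equiv.Perm.inv_def,
        Equiv.apply_symm_apply]
    · rw [permZ_lv, theta_lv, theta_lv, mul_assoc]

theorem psi_mul_permH (f : Mod N) (σ : Equiv.Perm (Fin N)) :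
    psi N f * permH N σ = psi N fun τ => permZ σ⁻¹ (f (τ * σ⁻¹)) := by
  rw [psi_apply, psi_apply, Finset.sum_mul,
    ← Equiv.sum_comp (Equiv.mulRight σ) fun τ => theta N (permZ σ⁻¹ (f (τ * σ⁻¹))) (permH N τ)]
  refine Finset.sum_congr rfl fun τ _ => ?_
  rw [theta_mul_permH, Equiv.coe_mulRight, map_mul (permH N), mul_inv_cancel_right]

/-- The coefficient of `1` in a central element is a symmetric polynomial. -/
theorem permZ_permLam_of_central {f : Mod N} (hf : ∀ h, psi N f * h = h * psi N f)
    (σ : Equiv.Perm (Fin N)) : permZ σ⁻¹ (f 1) = permLam σ (f 1) := by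
  have h := hf (permH N σ)
  rw [psi_mul_permH, ← psi_opS] at h
  have := congrFun (psi_injective h) σ
  rwa [opS_apply, mul_inv_cancel, inv_mul_cancel] at this

theorem zv_sub_mul_of_central {f : Mod N} (hf : ∀ h, psi N f * h = h * psi N f) (j : Fin N)
    (τ : Equiv.Perm (Fin N)) :
    (zv j - zv (τ⁻¹ j)) * f τ = ∑ a, divDiff j a (f (Equiv.swap j a * τ)) := by
  have h := hf (yH j)
  rw [← psi_zv_smul, ← psi_opY] at h
  have := congrFun (psi_injective h) τ
  rw [opY_apply, Pi.smul_apply, smul_eq_mul] at this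
  linear_combination this

/-- In a central element the coefficient of `1` has the highest degree in `z`: for `τ ≠ 1` the
commutation with some `y_j` expresses `(z_j - z_{τ⁻¹(j)}) f_τ` through divided differences of the
other coefficients, which do not raise the degree. -/
theorem mem_degLT_of_central {f : Mod N} (hf : ∀ h, psi N f * h = h * psi N f) {d : ℕ}
    (h1 : f 1 ∈ degLT N (d + 1)) {τ : Equiv.Perm (Fin N)} (hτ : τ ≠ 1) : f τ ∈ degLT N d := by
  have step : ∀ e, (∀ τ, f τ ∈ degLT N (e + 1)) → ∀ τ, τ ≠ 1 → f τ ∈ degLT N e := by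
    intro e he τ hτ
    obtain ⟨j, hj⟩ : ∃ j, j ≠ τ⁻¹ j := by
      by_contra hne
      push Not at hne
      exact hτ (inv_eq_one.1 (Equiv.ext fun j => (hne j).symm))
    refine mem_degLT_of_zv_sub_mul hj ?_
    rw [zv_sub_mul_of_central hf]
    exact Submodule.sum_mem _ fun a _ => divDiff_mem_degLT j a (he _)
  have descend : ∀ k, (∀ τ, f τ ∈ degLT N (d + k + 1)) → ∀ τ, τ ≠ 1 → f τ ∈ degLT N d := by
    intro k
    induction k with
    | zero => exact step d
    | succ k ih =>
      intro hk
      refine ih fun τ => ?_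
      by_cases hτ : τ = 1
      · subst hτ; exact degLT_mono (by omega) h1
      · exact step _ hk τ hτ
  choose e he using fun τ => exists_mem_degLT (f τ)
  refine descend (∑ τ, e τ) (fun τ => degLT_mono ?_ (he τ)) τ hτ
  have := Finset.single_le_sum (f := e) (fun _ _ => Nat.zero_le _) (Finset.mem_univ τ)
  omega

theorem rho_lv_smul_of_central {c : H N} (hc : ∀ h, c * h = h * c) (i : Fin N) (f : Mod N) :
    rho N c ((lv i : ZL N) • f) = (lv i : ZL N) • rho N c f := by
  rw [← opX_eq_smul, ← rho_xH, ← Module.End.mul_apply, ← map_mul, hc, map_mul,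
    Module.End.mul_apply, rho_xH, opX_eq_smul]

theorem rho_smul_of_central {c : H N} (hc : ∀ h, c * h = h * c) (g : ZL N) (f : Mod N) :
    rho N c (g • f) = g • rho N c f := by
  induction g using MvPolynomial.induction_on generalizing f with
  | C a =>
    have : ∀ f : Mod N, (MvPolynomial.C a : ZL N) • f = a • f := fun f => by
      funext τ
      rw [Pi.smul_apply, Pi.smul_apply, smul_eq_mul, MvPolynomial.smul_eq_C_mul]
    rw [this, this, map_smul]
  | add p q hp hq => rw [add_smul, map_add, hp, hq, add_smul]
  | mul_X p i hp =>
    rw [mul_smul, hp, mul_smul]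
    rcases i with i | i
    · rw [rho_zv_smul]
    · rw [rho_lv_smul_of_central hc]

/-- The product with a central element, in terms of coefficients. -/
theorem psi_mul_psi_of_central {f : Mod N} (hf : ∀ h, psi N f * h = h * psi N f) (f' : Mod N) :
    psi N f * psi N f' =
      psi N fun ρ => ∑ τ, f' τ * permLam τ (f (τ⁻¹ * ρ)) := by
  rw [← psi_rho]
  congr 1
  have h1 : f' = ∑ τ, f' τ • ev τ := by
    funext ρ
    simp [Pi.single_apply]
  have h2 : ∀ τ, rho N (psi N f) (ev τ) = opS τ f := by
    intro τ
    rw [← mul_one τ, ← opS_ev, ← rho_permH, ← Module.End.mul_apply, ← map_mul, hf, map_mul,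
      Module.End.mul_apply, rho_psi_ev_one, mul_one, rho_permH]
  conv_lhs => rw [h1]
  rw [map_sum]
  funext ρ
  rw [Finset.sum_apply]
  refine Finset.sum_congr rfl fun τ _ => ?_
  rw [rho_smul_of_central hf, h2, Pi.smul_apply, opS_apply, smul_eq_mul]

/-! ### The Bethe algebra acts by central elements -/

/-- The operators on `𝒱₁` that `ι` turns into left multiplications by central elements. -/
def centralOps (N : ℕ) : Subalgebra ℂ (Module.End ℂ (V1 N)) :=
  ((Subalgebra.center ℂ (H N)).map (Algebra.lmul ℂ (H N))).comap ((iota N).conjAlgEquiv ℂ).toAlgHom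

theorem conj_iota_apply (T : Module.End ℂ (V1 N)) (f : V1 N) :
    ((iota N).conjAlgEquiv ℂ).toAlgHom T (iota N f) = iota N (T f) := by
  change iota N (T ((iota N).symm (iota N f))) = _
  rw [LinearEquiv.symm_apply_apply]

theorem lmul_eq_conj_iota {T : Module.End ℂ (V1 N)} {c : H N}
    (h : ∀ f, iota N (T f) = c * iota N f) :
    Algebra.lmul ℂ (H N) c = ((iota N).conjAlgEquiv ℂ).toAlgHom T := by
  refine LinearMap.ext fun a => ?_
  obtain ⟨f, rfl⟩ := (iota N).surjective a
  rw [conj_iota_apply, h]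
  rfl

theorem eq_of_lmul_eq_conj_iota {T : Module.End ℂ (V1 N)} {c : H N}
    (h : Algebra.lmul ℂ (H N) c = ((iota N).conjAlgEquiv ℂ).toAlgHom T) :
    c = iota N (T (epsV1 N 1)) := by
  rw [← conj_iota_apply, ← h, iota_epsV1, map_one]
  exact (mul_one c).symm

theorem mem_centralOps_of_forall {T : Module.End ℂ (V1 N)} {c : H N} (hc : ∀ h, c * h = h * c)
    (h : ∀ f, iota N (T f) = c * iota N f) : T ∈ centralOps N :=
  ⟨c, Subalgebra.mem_center_iff.2 fun h => (hc h).symm, lmul_eq_conj_iota h⟩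

theorem coeff_bethePoly_mem_centralOps (n : ℕ) (k : ℤ) :
    ((bethePoly N hB).coeff n).coeff k ∈ centralOps N := by
  rcases lt_or_ge 0 k with hk | hk
  · rw [coeff_bethePoly_pos hB n hk]
    exact zero_mem _
  · obtain ⟨m, hm⟩ := Int.eq_ofNat_of_zero_le (neg_nonneg.2 hk)
    obtain rfl : k = -(m : ℤ) := by omega
    exact mem_centralOps_of_forall (coeff_centralPoly_comm n m) (iota_coeff_bethePoly hB m n)

section PowerSeries

variable {E : Type*} [Ring E]

theorem single_one_mul_comm (a : ℤ) (P : USeries E) :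
    HahnSeries.single a 1 * P = P * HahnSeries.single a 1 := by
  ext k
  rw [HahnSeries.coeff_single_mul, HahnSeries.coeff_mul_single, one_mul, mul_one]

theorem uSub_eq (a : E) : uSub a = HahnSeries.single (-1) 1 *
    HahnSeries.ofPowerSeries ℤ E (1 - PowerSeries.C a * PowerSeries.X) := by
  have h : HahnSeries.single (-1 : ℤ) (1 : E) * (HahnSeries.C a * HahnSeries.single 1 1) =
      HahnSeries.single 0 a := by
    rw [HahnSeries.C_apply, HahnSeries.single_mul_single, HahnSeries.single_mul_single]
    simp
  rw [map_sub, map_one (HahnSeries.ofPowerSeries ℤ E), map_mul, HahnSeries.ofPowerSeries_C,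
    HahnSeries.ofPowerSeries_X, mul_sub, mul_one, h]
  rfl

theorem prod_uSub_eq (l : List E) : (l.map uSub).prod = HahnSeries.single (-(l.length : ℤ)) 1 *
    HahnSeries.ofPowerSeries ℤ E (l.map fun a => 1 - PowerSeries.C a * PowerSeries.X).prod := by
  induction l with
  | nil => simp
  | cons a l ih =>
    rw [List.map_cons, List.prod_cons, ih, uSub_eq, mul_assoc,
      ← mul_assoc _ (HahnSeries.single _ _), ← single_one_mul_comm, List.map_cons, List.prod_cons, map_mul,
      mul_assoc, ← mul_assoc,
      HahnSeries.single_mul_single, one_mul, List.length_cons]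
    congr 3
    push_cast
    ring

theorem coeff_zero_prod_one_sub (l : List E) :
    PowerSeries.coeff 0 (l.map fun a => 1 - PowerSeries.C a * PowerSeries.X).prod = (1 : E) := by
  induction l with
  | nil => simp
  | cons a l ih =>
    rw [List.map_cons, List.prod_cons, sub_mul, one_mul, map_sub, ih, mul_assoc,
      PowerSeries.coeff_C_mul, PowerSeries.coeff_zero_X_mul, mul_zero, sub_zero]

/-- A power series `f` with constant coefficient `1` can be inverted within a subalgebra. -/
theorem coeff_mem_of_coeff_mul_mem [Algebra ℂ E] {A : Subalgebra ℂ E} {f g : PowerSeries E}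
    (hf0 : PowerSeries.coeff 0 f = 1) (hf : ∀ n, PowerSeries.coeff n f ∈ A)
    (hfg : ∀ n, PowerSeries.coeff n (f * g) ∈ A) (n : ℕ) : PowerSeries.coeff n g ∈ A := by
  induction n using Nat.strong_induction_on with
  | _ n ih =>
    have h := hfg n
    rw [PowerSeries.coeff_mul, ← Finset.add_sum_erase _ _
      (Finset.HasAntidiagonal.mem_antidiagonal.2 (zero_add n) : (0, n) ∈ _), hf0, one_mul] at h
    refine (add_mem_cancel_right (sum_mem fun p hp => mul_mem (hf _) (ih _ ?_))).1 h
    rw [Finset.mem_erase, Finset.HasAntidiagonal.mem_antidiagonal] at hp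
    have : p.1 ≠ 0 := fun h0 => hp.1 (Prod.ext h0 (by simpa [h0] using hp.2))
    omega

/-- If the coefficients of `w = ∏ (u - a_i)` and of `w q` lie in a subalgebra, then so do those
of `q`, since `w` is monic in `u`. -/
theorem coeff_mem_of_coeff_prod_uSub_mul_mem [Algebra ℂ E] {A : Subalgebra ℂ E} {l : List E}
    {q : PowerSeries E} (h1 : ∀ k, (l.map uSub).prod.coeff k ∈ A)
    (h : ∀ k, ((l.map uSub).prod * HahnSeries.ofPowerSeries ℤ E q).coeff k ∈ A) (j : ℕ) :
    PowerSeries.coeff j q ∈ A := by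
  have key : ∀ q : PowerSeries E,
      (∀ k, ((l.map uSub).prod * HahnSeries.ofPowerSeries ℤ E q).coeff k ∈ A) →
      ∀ j, PowerSeries.coeff j ((l.map fun a => 1 - PowerSeries.C a * PowerSeries.X).prod * q) ∈
        A := by
    intro q hq j
    have h := hq ((j : ℤ) - l.length)
    rwa [prod_uSub_eq, mul_assoc, ← map_mul, HahnSeries.coeff_single_mul, one_mul,
      sub_neg_eq_add, sub_add_cancel, HahnSeries.ofPowerSeries_apply_coeff] at h
  have hW := key 1 (by simpa using h1)
  simp only [mul_one] at hW
  exact coeff_mem_of_coeff_mul_mem (coeff_zero_prod_one_sub l) hW (key q h) j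

end PowerSeries

theorem coeff_betheSeries_mem_centralOps (n j : ℕ) :
    ((betheSeries hB).coeff n).coeff (j : ℤ) ∈ centralOps N := by
  have hw : ∀ n, (bethePoly N hB).coeff n =
      ((List.ofFn (zMul N)).map uSub).prod * (betheSeries hB).coeff n := by
    intro n
    rw [coeff_bethePoly, List.map_ofFn, List.map_ofFn]; rfl
  obtain ⟨q, hq⟩ : ∃ q, (betheSeries hB).coeff n = HahnSeries.ofPowerSeries ℤ _ q := by
    rcases lt_or_ge n N with hn | hn
    · exact ⟨_, coeff_betheSeries_of_lt hB hn⟩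
    · exact ⟨if n = N then 1 else 0, by
        rw [coeff_betheSeries_of_le hB hn]; split_ifs <;> simp⟩
  rw [hq, HahnSeries.ofPowerSeries_apply_coeff]
  refine coeff_mem_of_coeff_prod_uSub_mul_mem (l := List.ofFn (zMul N)) (fun k => ?_)
    (fun k => ?_) j
  · have := coeff_bethePoly_mem_centralOps hB N k
    rwa [hw, coeff_betheSeries_of_le hB le_rfl, if_pos rfl, mul_one] at this
  · rw [← hq, ← hw]
    exact coeff_bethePoly_mem_centralOps hB n k

/-- The coefficients of the universal Bethe polynomial correspond to central elements. The one of
`v^N` is `∏ (u - z_i)`, so that this factor can be removed from the others. -/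
theorem betheBbar_mem_centralOps (i : Fin N) (j : ℕ) : betheBbar N hB i j ∈ centralOps N := by
  have h := coeff_betheSeries_mem_centralOps hB (N - ((i : ℕ) + 1)) j
  have hi := i.is_lt
  rw [coeff_betheSeries_of_lt hB (by omega), HahnSeries.ofPowerSeries_apply_coeff,
    PowerSeries.coeff_mk] at h
  convert h
  omega

theorem betheRep_range_le : (betheRep N hB).range ≤ centralOps N := by
  rintro _ ⟨⟨b, hb⟩, rfl⟩
  change betheRep N hB ⟨b, hb⟩ ∈ _
  induction hb using Algebra.adjoin_induction with
  | mem b hb =>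
    obtain ⟨i, j, rfl⟩ := hb
    exact betheBbar_mem_centralOps hB i j
  | algebraMap c => 
    exact ((betheRep N hB).commutes c).symm ▸ Subalgebra.algebraMap_mem _ c
  | add a b ha hb iha ihb =>
    have := map_add (betheRep N hB) ⟨a, ha⟩ ⟨b, hb⟩
    exact this.symm ▸ add_mem iha ihb
  | mul a b ha hb iha ihb =>
    have := map_mul (betheRep N hB) ⟨a, ha⟩ ⟨b, hb⟩
    exact this.symm ▸ mul_mem iha ihb

/-- The subalgebra of `H_N` that corresponds to the image of the Bethe algebra. -/
def betheImage : Subalgebra ℂ (H N) :=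
  ((betheRep N hB).range.map ((iota N).conjAlgEquiv ℂ).toAlgHom).comap (Algebra.lmul ℂ (H N))

theorem mul_comm_of_mem_betheImage {c : H N} (hc : c ∈ betheImage hB) (h : H N) :
    c * h = h * c := by
  obtain ⟨T, hT, hTc⟩ := hc
  obtain ⟨c', hc', hc'T⟩ := betheRep_range_le hB hT
  have : c = c' := (eq_of_lmul_eq_conj_iota hTc.symm).trans (eq_of_lmul_eq_conj_iota hc'T).symm
  rw [this]
  exact (Subalgebra.mem_center_iff.1 hc' h).symm

/-- The coordinates of the element of `H_N` by which the coefficient of `u^{-j} v^n` of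
`v^N + ∑ B̄_{ij} u^{-j} v^{N-i}` acts, for `n < N`. -/
def betheCoeff (n j : ℕ) : Mod N := fun σ =>
  ((Equiv.Perm.sign σ : ℤˣ) : ℤ) • PowerSeries.coeff j ((rowProd σ 1).coeff n)

theorem psi_betheCoeff_mem {n : ℕ} (hn : n < N) (j : ℕ) :
    psi N (betheCoeff n j) ∈ betheImage hB := by
  set i : Fin N := ⟨N - (n + 1), by omega⟩ with hi
  have hin : N - ((i : ℕ) + 1) = n := by rw [hi]; dsimp only; omega
  obtain ⟨c, hc, hcT⟩ := betheBbar_mem_centralOps hB i j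
  have h := eq_of_lmul_eq_conj_iota hcT
  rw [betheBbar_epsV1, hin, map_sum] at h
  have h2 : c = psi N (betheCoeff n j) := by
    rw [h, psi_apply]
    refine Finset.sum_congr rfl fun σ _ => ?_
    rw [iota_smul, iota_epsV1, mul_one]
    rfl
  rw [← h2]
  exact ⟨_, ⟨_, rfl⟩, hcT.symm⟩

/-! ### Leading terms of the elements of the Bethe algebra -/

/-- The polynomials `g` of degree at most `d` in `z` which occur as leading terms: some element
of the image of the Bethe algebra equals `g` up to terms of degree less than `d` in `z`. -/
def leadingTerms (d : ℕ) : Submodule ℂ (ZL N) where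
  carrier := {g | g ∈ degLT N (d + 1) ∧
    ∃ f : Mod N, psi N f ∈ betheImage hB ∧ f 1 - g ∈ degLT N d ∧ ∀ τ, τ ≠ 1 → f τ ∈ degLT N d}
  add_mem' := by
    rintro g g' ⟨hg, f, hf, h1, h⟩ ⟨hg', f', hf', h1', h'⟩
    refine ⟨add_mem hg hg', f + f', by rw [map_add]; exact add_mem hf hf', ?_,
      fun τ hτ => add_mem (h τ hτ) (h' τ hτ)⟩
    rw [Pi.add_apply, add_sub_add_comm]
    exact add_mem h1 h1'
  zero_mem' := ⟨zero_mem _, 0, by rw [map_zero]; exact zero_mem _, by simp, fun τ _ => zero_mem _⟩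
  smul_mem' := by
    rintro c g ⟨hg, f, hf, h1, h⟩
    refine ⟨Submodule.smul_mem _ c hg, c • f, by rw [map_smul]; exact Subalgebra.smul_mem _ hf c,
      ?_, fun τ hτ => Submodule.smul_mem _ c (h τ hτ)⟩
    rw [Pi.smul_apply, ← smul_sub]
    exact Submodule.smul_mem _ c h1

theorem mem_leadingTerms_of {d : ℕ} {g : ZL N} (hg : g ∈ degLT N (d + 1)) {f : Mod N}
    (hf : psi N f ∈ betheImage hB) (h1 : f 1 - g ∈ degLT N d)
    (h : ∀ τ, τ ≠ 1 → f τ ∈ degLT N d) : g ∈ leadingTerms hB d := ⟨hg, f, hf, h1, h⟩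

theorem mem_leadingTerms_of_mem_degLT {d : ℕ} {g : ZL N} (hg : g ∈ degLT N d) :
    g ∈ leadingTerms hB d := by
  refine mem_leadingTerms_of hB (degLT_mono (Nat.le_succ d) hg) (f := 0)
    (by rw [map_zero]; exact zero_mem _) ?_ fun _ _ => zero_mem _
  rw [Pi.zero_apply, zero_sub]
  exact neg_mem hg

theorem leadingTerms_mono {d e : ℕ} (h : d ≤ e) : leadingTerms hB d ≤ leadingTerms hB e := by
  intro g hg
  rcases h.eq_or_lt with rfl | h
  · exact hg
  · exact mem_leadingTerms_of_mem_degLT hB (degLT_mono h hg.1)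

theorem one_mem_leadingTerms : 1 ∈ leadingTerms hB 0 := by
  refine mem_leadingTerms_of hB one_mem_degLT (f := ev 1)
    (by rw [psi_ev, map_one]; exact one_mem _) ?_ fun τ hτ => ?_
  · rw [show (ev 1 : Mod N) 1 = 1 from Pi.single_eq_same _ _, sub_self]; exact zero_mem _
  · rw [show (ev 1 : Mod N) τ = 0 from Pi.single_eq_of_ne hτ _]; exact zero_mem _

/-- Leading terms multiply, because in the product of two central elements the coefficients other
than that of `1` contribute only terms of lower degree in `z`. -/
theorem mul_mem_leadingTerms {d e : ℕ} {g g' : ZL N} (hg : g ∈ leadingTerms hB d)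
    (hg' : g' ∈ leadingTerms hB e) : g * g' ∈ leadingTerms hB (d + e) := by
  obtain ⟨hg, f, hf, h1, hne⟩ := hg
  obtain ⟨hg', f', hf', h1', hne'⟩ := hg'
  have hf1 : f 1 ∈ degLT N (d + 1) := by
    rw [← sub_add_cancel (f 1) g]
    exact add_mem (degLT_mono (Nat.le_succ d) h1) hg
  have hf1' : f' 1 ∈ degLT N (e + 1) := by
    rw [← sub_add_cancel (f' 1) g']
    exact add_mem (degLT_mono (Nat.le_succ e) h1') hg'
  have hall : ∀ τ, f τ ∈ degLT N (d + 1) := fun τ => by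
    by_cases hτ : τ = 1
    · rw [hτ]; exact hf1
    · exact degLT_mono (Nat.le_succ d) (hne τ hτ)
  have hterm : ∀ ρ τ, τ ≠ 1 → f' τ * permLam τ (f (τ⁻¹ * ρ)) ∈ degLT N (d + e) := by
    intro ρ τ hτ
    rw [mul_comm]
    exact mul_mem_degLT (permLam_mem_degLT _ (hall _)) (hne' τ hτ)
  have hmul := mul_mem hf hf'
  rw [psi_mul_psi_of_central (mul_comm_of_mem_betheImage hB hf)] at hmul
  refine mem_leadingTerms_of hB ?_ hmul ?_ fun ρ hρ => ?_
  · rw [add_assoc]; exact mul_mem_degLT hg hg'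
  · rw [← Finset.add_sum_erase _ _ (Finset.mem_univ 1), inv_one, one_mul, permLam_one,
      add_sub_right_comm]
    refine add_mem ?_ (Submodule.sum_mem _ fun τ hτ => hterm 1 τ (Finset.ne_of_mem_erase hτ))
    have : f' 1 * f 1 - g * g' = f 1 * (f' 1 - g') + g' * (f 1 - g) := by ring
    rw [this]
    refine add_mem (mul_mem_degLT hf1 h1') ?_
    rw [add_comm]
    exact mul_mem_degLT hg' h1
  · rw [← Finset.add_sum_erase _ _ (Finset.mem_univ 1), inv_one, one_mul, permLam_one]
    refine add_mem ?_ (Submodule.sum_mem _ fun τ hτ => hterm ρ τ (Finset.ne_of_mem_erase hτ))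
    rw [add_comm d e]
    exact mul_mem_degLT hf1' (hne ρ hρ)

/-! ### The leading terms of the generators -/

/-- The operators in which the coefficient of `u^{-j}` has degree at most `j - r` in `z`, and
vanishes for `j < r`. -/
def orderGE (N : ℕ) (r : ℕ) : Submodule ℂ (DiffOp (ZL N)) where
  carrier := {F | ∀ n j, PowerSeries.coeff j (F.coeff n) ∈ degLT N (j + 1 - r)}
  add_mem' hF hG n j := by
    rw [Polynomial.coeff_add, map_add]; exact add_mem (hF n j) (hG n j)
  zero_mem' n j := by simp
  smul_mem' c F hF n j := by
    rw [Polynomial.coeff_smul]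
    exact Submodule.smul_mem _ c (hF n j)

theorem orderGE_antitone {r s : ℕ} (h : r ≤ s) : orderGE N s ≤ orderGE N r :=
  fun _ hF n j => degLT_mono (by omega) (hF n j)

theorem mul_mem_orderGE {r s t : ℕ} {F G : DiffOp (ZL N)} (hF : F ∈ orderGE N r)
    (hG : G ∈ orderGE N s) (ht : t = r + s) : F * G ∈ orderGE N t := by
  subst ht
  intro n j
  rw [Polynomial.coeff_mul, map_sum]
  refine Submodule.sum_mem _ fun p _ => ?_
  rw [PowerSeries.coeff_mul]
  refine Submodule.sum_mem _ fun q hq => ?_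
  have hq := Finset.HasAntidiagonal.mem_antidiagonal.1 hq
  have h1 := hF p.1 q.1
  have h2 := hG p.2 q.2
  rcases lt_or_ge q.1 r with h | h
  · rw [show q.1 + 1 - r = 0 by omega] at h1
    rw [eq_zero_of_mem_degLT_zero h1, zero_mul]; exact zero_mem _
  · rw [show q.1 + 1 - r = (q.1 - r) + 1 by omega] at h1
    rcases lt_or_ge q.2 s with h' | h'
    · rw [show q.2 + 1 - s = 0 by omega] at h2
      rw [eq_zero_of_mem_degLT_zero h2, mul_zero]; exact zero_mem _
    · exact degLT_mono (by omega) (mul_mem_degLT h1 h2)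

theorem one_mem_orderGE : (1 : DiffOp (ZL N)) ∈ orderGE N 0 := by
  intro n j
  rw [Polynomial.coeff_one]
  split_ifs
  · rw [PowerSeries.coeff_one]
    split_ifs
    · exact degLT_mono (by omega) one_mem_degLT
    · exact zero_mem _
  · rw [map_zero]; exact zero_mem _

theorem prod_mem_orderGE {ι : Type*} {I : Finset ι} {F : ι → DiffOp (ZL N)}
    (h : ∀ i ∈ I, F i ∈ orderGE N 0) : ∏ i ∈ I, F i ∈ orderGE N 0 :=
  Finset.prod_induction _ (· ∈ orderGE N 0) (fun _ _ hF hG => mul_mem_orderGE hF hG rfl)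
    one_mem_orderGE h

theorem C_geom_mem_orderGE (i : Fin N) :
    (Polynomial.C (geom (zv i)) : DiffOp (ZL N)) ∈ orderGE N 1 := by
  intro n j
  rw [Polynomial.coeff_C]
  split_ifs
  · rcases j with _ | j
    · simp [geom]
    · simpa [geom] using zv_pow_mem_degLT i j
  · rw [map_zero]; exact zero_mem _

/-- The operator `v - λ_i`. -/
def linFactor (i : Fin N) : DiffOp (ZL N) := Polynomial.X - Polynomial.C (PowerSeries.C (lv i))

theorem linFactor_mem_orderGE (i : Fin N) : linFactor i ∈ orderGE N 0 := by
  have hX : (Polynomial.X : DiffOp (ZL N)) ∈ orderGE N 0 := by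
    intro n j
    rw [Polynomial.coeff_X]
    split_ifs
    · rw [PowerSeries.coeff_one]
      split_ifs
      · exact degLT_mono (by omega) one_mem_degLT
      · exact zero_mem _
    · rw [map_zero]; exact zero_mem _
  refine sub_mem hX fun n j => ?_
  rw [Polynomial.coeff_C]
  split_ifs
  · rw [PowerSeries.coeff_C]
    split_ifs
    · exact degLT_mono (by omega) (lv_mem_degLT i)
    · exact zero_mem _
  · rw [map_zero]; exact zero_mem _

theorem rowFactor_mem_orderGE_one {σ τ : Equiv.Perm (Fin N)} {a : Fin N} (h : σ a ≠ a) :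
    rowFactor σ τ a ∈ orderGE N 1 := by
  rw [rowFactor_of_ne h]
  exact neg_mem (C_geom_mem_orderGE _)

theorem rowFactor_of_eq {σ τ : Equiv.Perm (Fin N)} {a : Fin N} (h : σ a = a) :
    rowFactor σ τ a = linFactor a - Polynomial.C (geom (zv (τ⁻¹ a))) := by
  rw [rowFactor, factor, if_pos h, linFactor]

theorem rowFactor_mem_orderGE (σ τ : Equiv.Perm (Fin N)) (a : Fin N) :
    rowFactor σ τ a ∈ orderGE N 0 := by
  by_cases h : σ a = a
  · rw [rowFactor_of_eq h]
    exact sub_mem (linFactor_mem_orderGE a)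
      (orderGE_antitone (Nat.zero_le 1) (C_geom_mem_orderGE _))
  · exact orderGE_antitone (Nat.zero_le 1) (rowFactor_mem_orderGE_one h)

/-- A permutation other than `1` moves two points at least, and each of them contributes a factor
`(u - z_i)⁻¹`. -/
theorem rowProd_mem_orderGE_two {σ : Equiv.Perm (Fin N)} (hσ : σ ≠ 1) (τ : Equiv.Perm (Fin N)) :
    rowProd σ τ ∈ orderGE N 2 := by
  obtain ⟨a, ha⟩ : ∃ a, σ a ≠ a := by
    by_contra hne
    push Not at hne
    exact hσ (Equiv.ext hne)
  have hb : σ (σ a) ≠ σ a := fun h => ha (σ.injective h)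
  rw [rowProd, ← Finset.mul_prod_erase _ _ (Finset.mem_univ a),
    ← Finset.mul_prod_erase _ _ (Finset.mem_erase.2 ⟨ha, Finset.mem_univ (σ a)⟩)]
  exact mul_mem_orderGE (rowFactor_mem_orderGE_one ha) (mul_mem_orderGE
    (rowFactor_mem_orderGE_one hb) (prod_mem_orderGE fun i _ => rowFactor_mem_orderGE σ τ i)
    rfl) rfl

theorem sub_mul_sub_mul {R : Type*} [CommRing R] (A z P Q : R) :
    (A - z) * P - A * Q = A * (P - Q) - z * P := by ring

theorem sub_mul_sub_mul_add {R : Type*} [CommRing R] (A z P Q S : R) :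
    (A - z) * P - A * Q + (z * Q + A * S) = A * (P - Q + S) - z * (P - Q) := by ring

theorem sub_mul_mem_orderGE {A z P Q S : DiffOp (ZL N)} (hA : A ∈ orderGE N 0)
    (hz : z ∈ orderGE N 1) (hP : P ∈ orderGE N 0) (h1 : P - Q ∈ orderGE N 1)
    (h2 : P - Q + S ∈ orderGE N 2) : (A - z) * P - A * Q ∈ orderGE N 1 ∧
      (A - z) * P - A * Q + (z * Q + A * S) ∈ orderGE N 2 := by
  rw [sub_mul_sub_mul_add, sub_mul_sub_mul]
  exact ⟨sub_mem (mul_mem_orderGE hA h1 rfl) (mul_mem_orderGE hz hP rfl),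
    sub_mem (mul_mem_orderGE hA h2 rfl) (mul_mem_orderGE hz h1 rfl)⟩

/-- The expansion of `∏ (v - λ_i - (u - z_i)⁻¹)` to first order in the series `(u - z_i)⁻¹`. -/
theorem prod_sub_mem_orderGE (I : Finset (Fin N)) :
    ∏ i ∈ I, (linFactor i - Polynomial.C (geom (zv i))) - ∏ i ∈ I, linFactor i ∈ orderGE N 1 ∧
    ∏ i ∈ I, (linFactor i - Polynomial.C (geom (zv i))) - ∏ i ∈ I, linFactor i +
      ∑ a ∈ I, Polynomial.C (geom (zv a)) * ∏ i ∈ I.erase a, linFactor i ∈ orderGE N 2 := by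
  induction I using Finset.induction_on with
  | empty => simp
  | insert i I hi ih =>
    have hsum : ∑ a ∈ I, Polynomial.C (geom (zv a)) * ∏ b ∈ (insert i I).erase a, linFactor b =
        linFactor i * ∑ a ∈ I, Polynomial.C (geom (zv a)) * ∏ b ∈ I.erase a, linFactor b := by
      rw [Finset.mul_sum]
      refine Finset.sum_congr rfl fun a ha => ?_
      have hai : i ≠ a := fun e => hi (e ▸ ha)
      rw [Finset.erase_insert_of_ne hai, Finset.prod_insert fun h => hi (Finset.mem_of_mem_erase h)]
      ring
    rw [Finset.prod_insert hi, Finset.prod_insert hi, Finset.sum_insert hi,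
      Finset.erase_insert hi, hsum]
    have hP : ∏ i ∈ I, (linFactor i - Polynomial.C (geom (zv i))) ∈ orderGE N 0 := by
      refine prod_mem_orderGE fun i _ => sub_mem (linFactor_mem_orderGE i)
        (orderGE_antitone (Nat.zero_le 1) (C_geom_mem_orderGE i))
    exact sub_mul_mem_orderGE (linFactor_mem_orderGE i) (C_geom_mem_orderGE i) hP ih.1 ih.2

/-- The polynomial `∏_{i ∈ I} (v - λ_i)`. -/
def lamProd (I : Finset (Fin N)) : Polynomial (ZL N) :=
  ∏ i ∈ I, (Polynomial.X - Polynomial.C (lv i))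

theorem prod_linFactor (I : Finset (Fin N)) :
    ∏ i ∈ I, linFactor i = (lamProd I).map (PowerSeries.C (R := ZL N)) := by
  rw [lamProd, Polynomial.map_prod]
  refine Finset.prod_congr rfl fun i _ => ?_
  rw [Polynomial.map_sub, Polynomial.map_X, Polynomial.map_C]
  rfl

theorem rowProd_one_one :
    rowProd 1 1 = ∏ i : Fin N, (linFactor i - Polynomial.C (geom (zv i))) := by
  refine Finset.prod_congr rfl fun i _ => ?_
  rw [rowFactor_of_eq (by simp)]
  simp

theorem coeff_lamProd_mem_degLT (I : Finset (Fin N)) (n : ℕ) :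
    (lamProd I).coeff n ∈ degLT N 1 := by
  have h := prod_mem_orderGE (I := I) (fun i _ => linFactor_mem_orderGE i) n 0
  rw [prod_linFactor, Polynomial.coeff_map, PowerSeries.coeff_zero_C] at h
  exact h

theorem natDegree_lamProd (I : Finset (Fin N)) : (lamProd I).natDegree = I.card :=
  Polynomial.natDegree_finsetProd_X_sub_C_eq_card I lv

theorem lamProd_monic (I : Finset (Fin N)) : (lamProd I).Monic :=
  Polynomial.monic_prod_X_sub_C _ _

/-- The elementary symmetric polynomials in `λ` are leading terms, from the coefficients of
`u^0`. -/
theorem coeff_lamProd_univ_mem_leadingTerms (n : ℕ) :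
    (lamProd Finset.univ).coeff n ∈ leadingTerms hB 0 := by
  rcases lt_trichotomy n N with hn | hn | hn
  · refine mem_leadingTerms_of hB (coeff_lamProd_mem_degLT _ _) (psi_betheCoeff_mem hB hn 0) ?_
      fun σ hσ => ?_
    · have h := (prod_sub_mem_orderGE (Finset.univ : Finset (Fin N))).1 n 0
      rw [← rowProd_one_one, prod_linFactor, Polynomial.coeff_sub, Polynomial.coeff_map, map_sub,
        PowerSeries.coeff_zero_C] at h
      simpa [betheCoeff] using h
    · exact zsmul_mem (degLT_mono (by omega) (rowProd_mem_orderGE_two hσ 1 n 0)) _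
  · have h : (lamProd (Finset.univ : Finset (Fin N))).coeff n = 1 := by
      have := (lamProd_monic (Finset.univ : Finset (Fin N))).coeff_natDegree
      rw [natDegree_lamProd, Finset.card_univ, Fintype.card_fin] at this
      rw [hn, this]
    rw [h]
    exact one_mem_leadingTerms hB
  · rw [Polynomial.coeff_eq_zero_of_natDegree_lt]
    · exact zero_mem _
    · rwa [natDegree_lamProd, Finset.card_univ, Fintype.card_fin]

/-- The leading terms that come from the coefficients of `u^{-b-1}`. -/
theorem sum_zv_pow_mul_coeff_mem_leadingTerms (n b : ℕ) :
    ∑ a, zv a ^ b * (lamProd (Finset.univ.erase a)).coeff n ∈ leadingTerms hB b := by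
  rcases lt_or_ge n N with hn | hn
  · have hdeg : ∑ a, zv a ^ b * (lamProd (Finset.univ.erase a)).coeff n ∈ degLT N (b + 1) :=
      Submodule.sum_mem _ fun a _ =>
        mul_mem_degLT (zv_pow_mem_degLT a b) (coeff_lamProd_mem_degLT _ n)
    rw [← neg_mem_iff]
    refine mem_leadingTerms_of hB (neg_mem hdeg) (psi_betheCoeff_mem hB hn (b + 1)) ?_
      fun σ hσ => ?_
    · have h := (prod_sub_mem_orderGE (Finset.univ : Finset (Fin N))).2 n (b + 1)
      rw [← rowProd_one_one, prod_linFactor, Polynomial.coeff_add, Polynomial.coeff_sub,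
        Polynomial.coeff_map, map_add, map_sub, PowerSeries.coeff_C, if_neg (Nat.succ_ne_zero b),
        sub_zero, Polynomial.finsetSum_coeff, map_sum] at h
      have h2 : ∀ a : Fin N, PowerSeries.coeff (b + 1) ((Polynomial.C (geom (zv a)) *
          ∏ i ∈ Finset.univ.erase a, linFactor i).coeff n) =
          zv a ^ b * (lamProd (Finset.univ.erase a)).coeff n := by
        intro a
        rw [prod_linFactor, Polynomial.coeff_C_mul, Polynomial.coeff_map, PowerSeries.coeff_mul_C]
        simp [geom]
      rw [Finset.sum_congr rfl fun a _ => h2 a] at h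
      simpa [betheCoeff] using h
    · exact zsmul_mem (degLT_mono (by omega) (rowProd_mem_orderGE_two hσ 1 n (b + 1))) _
  · rw [Finset.sum_eq_zero]
    · exact zero_mem _
    · intro a _
      rw [Polynomial.coeff_eq_zero_of_natDegree_lt, mul_zero]
      rw [natDegree_lamProd, Finset.card_erase_of_mem (Finset.mem_univ a), Finset.card_univ,
        Fintype.card_fin]
      have := a.is_lt
      omega

theorem sub_mul_coeff_succ {K : Type*} [CommRing K] (l : K) (Q : Polynomial K) (n : ℕ) :
    ((Polynomial.X - Polynomial.C l) * Q).coeff (n + 1) = Q.coeff n - l * Q.coeff (n + 1) := by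
  rw [sub_mul, Polynomial.coeff_sub, Polynomial.coeff_X_mul, Polynomial.coeff_C_mul]

/-- The polarized power sums `∑_a λ_a^k z_a^b` are leading terms: they are obtained recursively from
the identity `(v - λ_a) ∏_{i ≠ a} (v - λ_i) = ∏_i (v - λ_i)`, as in Newton's identities. -/
theorem powerSum_mem_leadingTerms (k b : ℕ) :
    ∑ a : Fin N, lv a ^ k * zv a ^ b ∈ leadingTerms hB b := by
  have hQ : ∀ a : Fin N, (Polynomial.X - Polynomial.C (lv a)) * lamProd (Finset.univ.erase a) =
      lamProd Finset.univ := fun a =>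
    Finset.mul_prod_erase Finset.univ (fun i : Fin N => Polynomial.X - Polynomial.C (lv i))
      (Finset.mem_univ a)
  -- the elements `∑_a λ_a^k z_a^b q_{a,n}` with `∏_{i ≠ a} (v - λ_i) = ∑_n q_{a,n} v^n`; the
  -- required ones are those for `n = N - 1`
  set R : ℕ → ℕ → ZL N := fun k n =>
    ∑ a : Fin N, lv a ^ k * zv a ^ b * (lamProd (Finset.univ.erase a)).coeff n with hR
  have hR_top : ∀ k, ∑ a : Fin N, lv a ^ k * zv a ^ b = R k (N - 1) := by
    intro k
    refine Finset.sum_congr rfl fun a _ => ?_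
    have := (lamProd_monic (Finset.univ.erase a)).coeff_natDegree
    rw [natDegree_lamProd, Finset.card_erase_of_mem (Finset.mem_univ a), Finset.card_univ,
      Fintype.card_fin] at this
    rw [this, mul_one]
  have hR_succ : ∀ k n, R (k + 1) (n + 1) = R k n - (lamProd Finset.univ).coeff (n + 1) *
      ∑ a : Fin N, lv a ^ k * zv a ^ b := by
    intro k n
    rw [Finset.mul_sum, ← Finset.sum_sub_distrib]
    refine Finset.sum_congr rfl fun a _ => ?_
    have := congrArg (fun P => Polynomial.coeff P (n + 1)) (hQ a)
    rw [sub_mul_coeff_succ] at this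
    linear_combination (-(lv a ^ k * zv a ^ b)) * this
  have hR_zero : ∀ k, R (k + 1) 0 = -((lamProd Finset.univ).coeff 0 *
      ∑ a : Fin N, lv a ^ k * zv a ^ b) := by
    intro k
    rw [Finset.mul_sum, ← Finset.sum_neg_distrib]
    refine Finset.sum_congr rfl fun a _ => ?_
    have := congrArg (fun P => Polynomial.coeff P 0) (hQ a)
    simp only [Polynomial.mul_coeff_zero, Polynomial.coeff_sub, Polynomial.coeff_X_zero,
      Polynomial.coeff_C_zero] at this
    linear_combination (-(lv a ^ k * zv a ^ b)) * this
  have hmem : ∀ k n, R k n ∈ leadingTerms hB b := by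
    intro k
    induction k with
    | zero =>
      intro n
      have := sum_zv_pow_mul_coeff_mem_leadingTerms hB n b
      simpa only [hR, pow_zero, one_mul] using this
    | succ k ih =>
      have hp : ∀ n, (lamProd Finset.univ).coeff n * ∑ a : Fin N, lv a ^ k * zv a ^ b ∈
          leadingTerms hB b := by
        intro n
        have := mul_mem_leadingTerms hB (coeff_lamProd_univ_mem_leadingTerms hB n) (ih (N - 1))
        rwa [zero_add, ← hR_top] at this
      intro n
      rcases n with _ | n
      · rw [hR_zero]; exact neg_mem (hp 0)
      · rw [hR_succ]; exact sub_mem (ih n) (hp (n + 1))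
  rw [hR_top]
  exact hmem k (N - 1)

/-! ### Symmetric polynomials are leading terms -/

/-- The monomial `λ_a^k z_a^b`, for `α = (k, b)`. -/
def mono (α : ℕ × ℕ) (a : Fin N) : ZL N := lv a ^ α.1 * zv a ^ α.2

theorem mono_add (α β : ℕ × ℕ) (a : Fin N) : mono (α + β) a = mono α a * mono β a := by
  rw [mono, mono, mono, Prod.fst_add, Prod.snd_add, pow_add, pow_add]
  ring

/-- The augmented monomial symmetric polynomial `∑_e ∏_i λ_{e(i)}^{k_i} z_{e(i)}^{b_i}`, where `e`
runs over the injective maps and `α i = (k_i, b_i)`. -/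
def embSum (N : ℕ) {r : ℕ} (α : Fin r → ℕ × ℕ) : ZL N :=
  ∑ e : Fin r ↪ Fin N, ∏ i, mono (α i) (e i)

theorem sum_notMem_range {M : Type*} [AddCommGroup M] {r : ℕ} (e : Fin r ↪ Fin N)
    (g : Fin N → M) : ∑ i : {i // i ∉ Set.range e}, g i = ∑ a, g a - ∑ j, g (e j) := by
  classical
  rw [eq_sub_iff_add_eq, ← Fintype.sum_subtype_add_sum_subtype (· ∈ Set.range e) g, add_comm]
  congr 1
  convert Equiv.sum_comp (Equiv.ofInjective e e.injective) fun i => g (i : Fin N)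
  rfl

/-- Multiplying by a power sum either uses a new index or merges with one of the present ones. -/
theorem embSum_cons {r : ℕ} (α : ℕ × ℕ) (β : Fin r → ℕ × ℕ) :
    embSum N (Fin.cons α β : Fin (r + 1) → ℕ × ℕ) = (∑ a, mono α a) * embSum N β -
      ∑ j, embSum N (Function.update β j (α + β j)) := by
  have h1 : embSum N (Fin.cons α β : Fin (r + 1) → ℕ × ℕ) = ∑ e : Fin r ↪ Fin N,
      ∑ i : {i // i ∉ Set.range e}, mono α (i : Fin N) * ∏ j, mono (β j) (e j) := by
    rw [embSum, ← Equiv.sum_comp (Equiv.embeddingFinSucc r (Fin N)).symm, Fintype.sum_sigma]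
    refine Finset.sum_congr rfl fun e _ => Finset.sum_congr rfl fun i _ => ?_
    rw [Fin.prod_univ_succ]
    simp
  rw [h1, embSum, Finset.mul_sum]
  simp only [embSum]
  rw [Finset.sum_comm, ← Finset.sum_sub_distrib]
  refine Finset.sum_congr rfl fun e _ => ?_
  rw [sum_notMem_range e fun a => mono α a * ∏ j, mono (β j) (e j), ← Finset.sum_mul]
  congr 1
  refine Finset.sum_congr rfl fun j _ => ?_
  rw [← Finset.mul_prod_erase _ _ (Finset.mem_univ j),
    ← Finset.mul_prod_erase (a := j) _ _ (Finset.mem_univ j), Function.update_self, mono_add,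
    mul_assoc]
  congr 2
  refine Finset.prod_congr rfl fun i hi => ?_
  rw [Function.update_of_ne (Finset.ne_of_mem_erase hi)]

theorem embSum_mem_leadingTerms {r : ℕ} (α : Fin r → ℕ × ℕ) :
    embSum N α ∈ leadingTerms hB (∑ i, (α i).2) := by
  induction r with
  | zero =>
    have : embSum N α = 1 := by simp [embSum]
    rw [this]
    simpa using one_mem_leadingTerms hB
  | succ r ih =>
    obtain ⟨α, β, rfl⟩ : ∃ a b, α = Fin.cons a b := ⟨α 0, Fin.tail α, (Fin.cons_self_tail α).symm⟩
    rw [embSum_cons, Fin.sum_univ_succ]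
    simp only [Fin.cons_zero, Fin.cons_succ]
    refine sub_mem (mul_mem_leadingTerms hB (powerSum_mem_leadingTerms hB α.1 α.2) (ih β))
      (sum_mem fun j _ => ?_)
    convert ih (Function.update β j (α + β j)) using 2
    rw [← Finset.add_sum_erase _ _ (Finset.mem_univ j),
      ← Finset.add_sum_erase (a := j) _ _ (Finset.mem_univ j), Function.update_self, Prod.snd_add,
      add_assoc]
    congr 2
    refine Finset.sum_congr rfl fun i hi => ?_
    rw [Function.update_of_ne (Finset.ne_of_mem_erase hi)]

theorem monomial_eq_prod_mono (m : Fin N ⊕ Fin N →₀ ℕ) (c : ℂ) :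
    MvPolynomial.monomial m c = c • ∏ i, mono (m (Sum.inr i), m (Sum.inl i)) i := by
  rw [MvPolynomial.monomial_eq, Finsupp.prod_fintype _ _ fun _ => pow_zero _,
    Fintype.prod_sum_type, MvPolynomial.smul_eq_C_mul]
  simp only [mono, Finset.prod_mul_distrib]
  ring

/-- The simultaneous permutation of the variables `z` and `λ`. -/
def permZL (σ : Equiv.Perm (Fin N)) : ZL N →ₐ[ℂ] ZL N := (permZ σ).comp (permLam σ)

theorem permZL_mono (σ : Equiv.Perm (Fin N)) (α : ℕ × ℕ) (a : Fin N) :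
    permZL σ (mono α a) = mono α (σ a) := by
  simp [permZL, mono]

theorem sum_permZL_mem_leadingTerms {d : ℕ} {g : ZL N} (hg : g ∈ degLT N (d + 1)) :
    ∑ σ : Equiv.Perm (Fin N), permZL σ g ∈ leadingTerms hB d := by
  rw [g.as_sum]
  simp only [map_sum]
  rw [Finset.sum_comm]
  refine sum_mem fun m hm => ?_
  have h : ∑ σ : Equiv.Perm (Fin N), permZL σ (MvPolynomial.monomial m (g.coeff m)) =
      g.coeff m • embSum N fun i => (m (Sum.inr i), m (Sum.inl i)) := by
    rw [embSum, ← Equiv.sum_comp (Equiv.embeddingEquivOfFinite (Fin N)).symm,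
      Finset.smul_sum]
    refine Finset.sum_congr rfl fun σ _ => ?_
    rw [monomial_eq_prod_mono, map_smul, map_prod]
    simp only [permZL_mono]
    rfl
  rw [h]
  refine Submodule.smul_mem _ _ (leadingTerms_mono hB ?_ (embSum_mem_leadingTerms hB _))
  exact Nat.lt_succ_iff.1 (zDeg_lt_of_mem_support hg hm)

/-- Every symmetric polynomial is a leading term, as the average of its symmetrized monomials. -/
theorem mem_leadingTerms_of_symmetric {d : ℕ} {g : ZL N} (hg : g ∈ degLT N (d + 1))
    (hs : ∀ σ, permZL σ g = g) : g ∈ leadingTerms hB d := by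
  have h := sum_permZL_mem_leadingTerms hB hg
  simp only [hs, Finset.sum_const, Finset.card_univ] at h
  rw [← Nat.cast_smul_eq_nsmul ℂ] at h
  have h2 := Submodule.smul_mem _ (Fintype.card (Equiv.Perm (Fin N)) : ℂ)⁻¹ h
  rwa [smul_smul, inv_mul_cancel₀ (Nat.cast_ne_zero.2 Fintype.card_ne_zero), one_smul] at h2

theorem permZL_of_central {f : Mod N} (hf : ∀ h, psi N f * h = h * psi N f)
    (σ : Equiv.Perm (Fin N)) : permZL σ (f 1) = f 1 := by
  have h : ∀ g : ZL N, permZ σ (permZ σ⁻¹ g) = g := by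
    intro g
    rw [permZ, permZ, MvPolynomial.rename_rename, Sum.map_comp_map, ← Equiv.Perm.coe_mul,
      mul_inv_cancel]
    simp
  rw [permZL, AlgHom.comp_apply, ← permZ_permLam_of_central hf, h]

/-! ### The center is the image of the Bethe algebra -/

/-- By induction on the degree in `z` of the coefficient of `1`, subtracting an element of the
image of the Bethe algebra with the same leading term. -/
theorem mem_betheImage_of_central (d : ℕ) {f : Mod N} (hf : ∀ h, psi N f * h = h * psi N f)
    (h1 : f 1 ∈ degLT N d) : psi N f ∈ betheImage hB := by
  induction d generalizing f with
  | zero =>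
    have : f = 0 := by
      funext τ
      by_cases hτ : τ = 1
      · rw [hτ]; exact eq_zero_of_mem_degLT_zero h1
      · exact eq_zero_of_mem_degLT_zero
          (mem_degLT_of_central hf (degLT_mono (Nat.zero_le 1) h1) hτ)
    rw [this, map_zero]
    exact zero_mem _
  | succ d ih =>
    obtain ⟨-, f', hf', h1', -⟩ := mem_leadingTerms_of_symmetric hB h1 (permZL_of_central hf)
    have hsub : psi N (f - f') ∈ betheImage hB := by
      refine ih (fun h => ?_) ?_
      · rw [map_sub, sub_mul, mul_sub, hf, mul_comm_of_mem_betheImage hB hf']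
      · rw [Pi.sub_apply, ← neg_sub]
        exact neg_mem h1'
    have := add_mem hsub hf'
    rwa [← map_add, sub_add_cancel] at this

theorem center_le_betheImage : Subalgebra.center ℂ (H N) ≤ betheImage hB := by
  intro c hc
  obtain ⟨f, rfl⟩ := (psiEquiv N).surjective c
  obtain ⟨d, hd⟩ := exists_mem_degLT (f 1)
  exact mem_betheImage_of_central hB d (fun h => (Subalgebra.mem_center_iff.1 hc h).symm) hd

theorem map_betheRep_range : (betheRep N hB).range.map ((iota N).conjAlgEquiv ℂ).toAlgHom =
    (Subalgebra.center ℂ (H N)).map (Algebra.lmul ℂ (H N)) := by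
  refine le_antisymm (Subalgebra.map_le.2 (betheRep_range_le hB)) (Subalgebra.map_le.2 ?_)
  exact center_le_betheImage hB

end BetheCherednik

end

theorem theorem2p9 (N : ℕ) :
    ∃ hB : BetheCherednik.BethePreserves N,
    ∃ ι : BetheCherednik.V1 N ≃ₗ[ℂ] BetheCherednik.H N,
      -- `ι` sends `p(z) q(λ) ε_τ` to `q(x) τ p(y)`
      (∀ (p q : MvPolynomial (Fin N) ℂ) (τ : Equiv.Perm (Fin N)),
        ι ((BetheCherednik.polyZ N p * BetheCherednik.polyLam N q) • BetheCherednik.epsV1 N τ) =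
          BetheCherednik.evalPoly BetheCherednik.xH q * BetheCherednik.permH N τ *
            BetheCherednik.evalPoly BetheCherednik.yH p) ∧
      -- the universal Bethe polynomial has no negative powers of `u`
      (∀ (n : ℕ) (k : ℤ), 0 < k →
        ((BetheCherednik.bethePoly N hB).coeff n).coeff k = 0) ∧
      -- `ι` intertwines the coefficients of `u ^ m * v ^ n`
      (∀ (m n : ℕ) (f : BetheCherednik.V1 N),
        ι (((BetheCherednik.bethePoly N hB).coeff n).coeff (-(m : ℤ)) f) =
          ((BetheCherednik.centralPoly N).coeff n).coeff m * ι f) ∧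
      -- `ι` carries the action of the Bethe algebra to the action of the center
      ((BetheCherednik.betheRep N hB).range.map (ι.conjAlgEquiv ℂ).toAlgHom =
        (Subalgebra.center ℂ (BetheCherednik.H N)).map
          (Algebra.lmul ℂ (BetheCherednik.H N))) := by
  open BetheCherednik in
  exact ⟨bethePreserves N, iota N, iota_polyZ_mul_polyLam_smul,
    fun n _ hk => coeff_bethePoly_pos (bethePreserves N) n hk,
    iota_coeff_bethePoly (bethePreserves N), map_betheRep_range (bethePreserves N)⟩
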